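/- Let $\mathcal I=[a,b]$ ($a<b$) be a compact interval, let $X$ be a random function on $\mathcal I$ (a jointly measurable real stochastic process), and let $X_{[1]},X_{[2]},\dots$ be independent copies of $X$. Write $$\operatorname{cov}\{X(s),X(t)\}=\sum_{k\ge1}\theta_k\psi_k(s)\psi_k(t),\qquad \frac1n\sum_{i=1}^n\{X_{[i]}(s)-\bar X(s)\}\{X_{[i]}(t)-\bar X(t)\}=\sum_{k\ge1}\hat\theta_k\hat\psi_k(s)\hat\psi_k(t),$$ where $\bar X=n^{-1}\sum_{i=1}^nX_{[i]}$, for spectral expansions converging in $L_2(\mathcal I^2)$, with $\theta_1\ge\theta_2\ge\dots\ge0$, $\hat\theta_1\ge\hat\theta_2\ge\dots\ge0$, and with $(\psi_k)$ and $(\hat\psi_k)$ orthonormal in $L_2(\mathcal I)$; the $\hat\theta_k,\hat\psi_k$ depend on $n$ and on the data and may be any such choice. Assume that the principal component scores $\theta_k^{-1/2}\int_{\mathcal I}(X-EX)\psi_k$, $k\ge1$, are independent (a score with $\theta_k=0$ is read as $0$). Fix $j\ge1$ and assume: 1. for each $C>0$ there is $\delta>0$ such that $\sup_{t\in\mathcal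 I}E|X(t)|^C<\infty$ and $\sup_{s,t\in\mathcal I,\,s\ne t}E\{|s-t|^{-\delta}|X(s)-X(t)|^C\}<\infty$; 2. for each integer $r\ge1$, $\theta_k^{-r}E\{\int_{\mathcal I}(X-EX)\psi_k\}^{2r}$ is bounded uniformly in $k$ (with $\theta_k>0$); 3. there are no ties among the $j+1$ largest eigenvalues, that is, $\theta_1>\theta_2>\dots>\theta_{j+1}$; 4. the $j$th score $\theta_j^{-1/2}\int_{\mathcal I}(X-EX)\psi_j$ has a probability density that is bounded and has a bounded derivative; the kernel $W$ is a symmetric, compactly supported probability density on $\mathbb R$ with two bounded derivatives; the bandwidths $h=h(n)>0$ satisfy, for some $\delta>0$, $h=O(n^{-\delta})$, and $n^{1-\delta}h^3$ is bounded away from zero as $n\to\infty$. For $x\in L_2(\mathcal I)$ put $$\hat f_j(\hat x_j)=\frac1{nh}\sum_{i=1}^nW\Big\{\frac{\int_{\mathcal I}(X_{[i]}-x)\hat\psi_j}{h\,\hat\theta_j^{1/2}}\Big\},\qquad \bar f_j(x_j)=\frac1{nh}\sum_{i=1}^nW\Big\{\frac{\int_{\mathcal I}(X_{[i]}-x)\psi_j}{h\,\theta_j^{1/2}}\Big\}.$$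 Then, for every $c>0$, with probability one, $$\sup_{\|x\|\le c}\big|\hat f_j(\hat x_j)-\bar f_j(x_j)\big|=o\{(nh)^{-1/2}\}\qquad(n\to\infty),$$ where the supremum is over all $x\in L_2(\mathcal I)$ with $L_2$ norm at most $c$ (and is finite). -/

import Mathlib

open MeasureTheory ProbabilityTheory Filter Topology Asymptotics

noncomputable section

namespace FunctionalPCA

/-- Lebesgue measure on the compact interval `[a, b]`. -/
abbrev leb (a b : ℝ) : Measure (Set.Icc a b) := Measure.comap Subtype.val volume

/-- Square-integrable functions on `[a, b]`. -/
abbrev L2 (a b : ℝ) : Type := Lp ℝ 2 (leb a b)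

/-- `K(s, t) = ∑ₖ θₖ ψₖ(s) ψₖ(t)`, with convergence in `L²([a, b]²)`, where the `ψₖ` are
orthonormal in `L²([a, b])` and `θ₀ ≥ θ₁ ≥ ⋯ ≥ 0`. Thus `θₖ`, `ψₖ` (`k = 0, 1, …`) are the ordered
eigenvalues, repeated according to multiplicity, and the eigenfunctions of the integral operator
with kernel `K`; trailing eigenvalues may be zero. -/
structure IsSpectralExpansion {a b : ℝ} (K : Set.Icc a b → Set.Icc a b → ℝ)
    (θ : ℕ → ℝ) (ψ : ℕ → L2 a b) : Prop where
  antitone : Antitone θ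
  nonneg : ∀ k, 0 ≤ θ k
  orthonormal : Orthonormal ℝ ψ
  expansion : Tendsto
    (fun m : ℕ => eLpNorm
      (fun p : Set.Icc a b × Set.Icc a b =>
        K p.1 p.2 - ∑ k ∈ Finset.range m, θ k * ψ k p.1 * ψ k p.2)
      2 ((leb a b).prod (leb a b)))
    atTop (𝓝 0)

variable {Ω : Type*} [MeasurableSpace Ω] {a b : ℝ}

/-- The mean function `t ↦ E X(t)`. -/
def meanFn (P : Measure Ω) (Y : Ω → Set.Icc a b → ℝ) (t : Set.Icc a b) : ℝ :=
  ∫ ω, Y ω t ∂P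

/-- The covariance function `(s, t) ↦ cov(X(s), X(t))`. -/
def covFn (P : Measure Ω) (Y : Ω → Set.Icc a b → ℝ) (s t : Set.Icc a b) : ℝ :=
  cov[fun ω => Y ω s, fun ω => Y ω t; P]

/-- `∫ (X - E X) ψ`. -/
def centredCoeff (P : Measure Ω) (Y : Ω → Set.Icc a b → ℝ) (ψ : L2 a b) (ω : Ω) : ℝ :=
  ∫ t, (Y ω t - meanFn P Y t) * ψ t ∂(leb a b)

/-- The principal component score `θₖ^{-1/2} ∫ (X - E X) ψₖ`. (If `θₖ = 0` the integral vanishes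
almost surely, and the score is read as `0`.) -/
def score (P : Measure Ω) (Y : Ω → Set.Icc a b → ℝ) (θ : ℕ → ℝ) (ψ : ℕ → L2 a b)
    (k : ℕ) (ω : Ω) : ℝ :=
  centredCoeff P Y (ψ k) ω / √(θ k)

/-- The sample mean function of the first `n` data. -/
def sampleMean (X : ℕ → Ω → Set.Icc a b → ℝ) (n : ℕ) (ω : Ω) (t : Set.Icc a b) : ℝ :=
  (1 / (n : ℝ)) * ∑ i ∈ Finset.range n, X i ω t

/-- The sample covariance function of the first `n` data, centred at the sample mean. -/
def sampleCov (X : ℕ → Ω → Set.Icc a b → ℝ) (n : ℕ) (ω : Ω) (s t : Set.Icc a b) : ℝ :=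
  (1 / (n : ℝ)) * ∑ i ∈ Finset.range n,
    (X i ω s - sampleMean X n ω s) * (X i ω t - sampleMean X n ω t)

/-- Moment and Hölder-type conditions: for each `C > 0` there is `δ > 0` with
`sup_t E |X(t)|^C < ∞` and `sup_{s ≠ t} E (|s - t|^{-δ} |X(s) - X(t)|^C) < ∞`. -/
def MomentHolder (P : Measure Ω) (Y : Ω → Set.Icc a b → ℝ) : Prop :=
  ∀ C : ℝ, 0 < C → ∃ δ : ℝ, 0 < δ ∧
    (⨆ t : Set.Icc a b, ∫⁻ ω, ENNReal.ofReal (|Y ω t| ^ C) ∂P) < ⊤ ∧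
    (⨆ (s : Set.Icc a b) (t : Set.Icc a b) (_ : s ≠ t),
      ∫⁻ ω, ENNReal.ofReal (|(s : ℝ) - (t : ℝ)| ^ (-δ) * |Y ω s - Y ω t| ^ C) ∂P) < ⊤

/-- For each integer `r ≥ 1`, `θₖ^{-r} E (∫ (X - E X) ψₖ)^{2r}` is bounded uniformly in `k`. -/
def ScoreMomentsBounded (P : Measure Ω) (Y : Ω → Set.Icc a b → ℝ)
    (θ : ℕ → ℝ) (ψ : ℕ → L2 a b) : Prop :=
  ∀ r : ℕ, 1 ≤ r → ∃ B : ℝ, ∀ k : ℕ,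
    (θ k ^ r)⁻¹ * ∫ ω, (centredCoeff P Y (ψ k) ω) ^ (2 * r) ∂P ≤ B

/-- The real random variable `Z` has a probability density that is bounded and has a bounded
derivative. -/
def HasSmoothDensity (P : Measure Ω) (Z : Ω → ℝ) : Prop :=
  ∃ f : ℝ → ℝ, (∀ u, 0 ≤ f u) ∧
    P.map Z = volume.withDensity (fun u => ENNReal.ofReal (f u)) ∧
    (∃ B, ∀ u, f u ≤ B) ∧ Differentiable ℝ f ∧ ∃ B, ∀ u, |deriv f u| ≤ B

/-- A symmetric, compactly supported probability density with two bounded derivatives. -/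
structure IsKernel (W : ℝ → ℝ) : Prop where
  nonneg : ∀ u, 0 ≤ W u
  integral_eq_one : ∫ u, W u = 1
  symm : ∀ u, W (-u) = W u
  compactSupport : HasCompactSupport W
  differentiable : Differentiable ℝ W
  deriv_bounded : ∃ B, ∀ u, |deriv W u| ≤ B
  differentiable_deriv : Differentiable ℝ (deriv W)
  deriv_deriv_bounded : ∃ B, ∀ u, |deriv (deriv W) u| ≤ B

/-- For some `δ > 0`, `h(n) = O(n^{-δ})` and `n^{1-δ} h(n)^3` is bounded away from zero as
`n → ∞`. -/
def IsBandwidth (h : ℕ → ℝ) : Prop :=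
  (∀ n, 0 < h n) ∧ ∃ δ : ℝ, 0 < δ ∧
    h =O[atTop] (fun n : ℕ => (n : ℝ) ^ (-δ)) ∧
    ∃ κ : ℝ, 0 < κ ∧ ∀ᶠ n : ℕ in atTop, κ ≤ (n : ℝ) ^ (1 - δ) * h n ^ 3

/-- `(n h)⁻¹ ∑_{i<n} W (∫ (X_[i] - x) φ / (h τ^{1/2}))`, the kernel estimator evaluated at the score
of `x`, built from the eigenvalue `τ` and the eigenfunction `φ`. With the true pair `(θⱼ, ψⱼ)` it is
the ideal estimator; with the pair computed from the data it is the empirical one. -/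
def scoreDensityEst (W : ℝ → ℝ) (bw : ℝ) (X : ℕ → Ω → Set.Icc a b → ℝ)
    (n : ℕ) (ω : Ω) (τ : ℝ) (φ x : L2 a b) : ℝ :=
  (1 / ((n : ℝ) * bw)) * ∑ i ∈ Finset.range n,
    W ((∫ t, (X i ω t - x t) * φ t ∂(leb a b)) / (bw * √τ))

end FunctionalPCA

end

open scoped NNReal ENNReal

noncomputable section

namespace FunctionalPCA

section

/-! ### Moment bounds for sums of independent centred random variables -/

/-! Put `yᵢ = Xᵢ - EX`, `w = x - EX`, `z = ⟨w, ψⱼ⟩/√θⱼ` and `r = n^{-1/2+ε}` for a small `ε > 0`.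
Both estimators are averages of `W(⟨yᵢ - w, φ⟩/h)`. The ideal one uses the direction `φ = ψⱼ/√θⱼ`,
the empirical one uses `φ + D`, where `φ + D = ±ψ̂ⱼ/√θ̂ⱼ`. The sign is free because `W` is even.
Everything rests on the smallness of `D` and on a cancellation in the first-order Taylor term.

Size of `D`. Even moments of centred independent sums give the almost sure rate `r` for averages in
`L²` (`ae_eventually_eLpNorm_average_sub_le`), hence for the sample covariance. The eigenvalue gap
around `θⱼ` turns this into `‖D‖ = O(r)` through Weyl and Davis–Kahan arguments
(`exists_sign_norm_sub_le`).

First-order term. It is linear in `D` and equals `h⁻²⟨T - T₀ w, D⟩`, where `T` and `T₀` are the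
averages of `W'((⟨yᵢ, φ⟩ - z)/h) yᵢ` and of `W'((⟨yᵢ, φ⟩ - z)/h)`. By Cauchy–Schwarz the
data-dependent `D` enters only through its norm (`IsKernel.abs_average_sub_le`). `T` and `T₀` are
within `r` of their means, uniformly for `z` in a compact interval, by a grid of `n + 1` points. The
means are `O(h²)`. Indeed, independence of the scores makes `ET` a multiple of `ψⱼ` with coefficient
`√θⱼ E{W'((ξ - z)/h) ξ}`, `ξ` being the `j`th score. Since `W'` integrates to zero and the density
of `ξ` is bounded and Lipschitz, this integral is `h · O(h)`, and so is `ET₀`. The first-order term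
is thus `O(h⁻²(r + h²) r) = O((r/h)² + r)`; without the cancellation `h⁻² r` would be left.

Second-order term. The Taylor remainder is nonzero only for the scores within `O(h)` of `z`, an
`O(h)` fraction of the sample. As `max ‖yᵢ‖ ≤ n^ε` eventually, it contributes `O((n^ε r/h)²)`.

Conclusion. Divided by `(nh)^{-1/2}`, the terms `(n^ε r/h)²` and `r` become `n^{-1/2+4ε} h^{-3/2}`
and `n^ε h^{1/2}`. These vanish by the lower and the upper bound on the bandwidth respectively.

One measure-theoretic point needs care: independence and equality of laws are assumed for the
product σ-algebra on paths, for which `x ↦ ∫ x φ` is not measurable. Mean-square Hölder continuity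
supplies a measurable version along the data (`IsSample.exists_measurable_functional`). -/

lemma abs_add_pow_sub_le (s y : ℝ) (n : ℕ) :
    |(s + y) ^ (n + 2) - s ^ (n + 2) - (n + 2) * s ^ (n + 1) * y|
      ≤ (n + 2) ^ 2 * (y ^ 2 * (|s| + |y|) ^ n) := by
  induction n with
  | zero =>
    have : (s + y) ^ (0 + 2) - s ^ (0 + 2) - ((0 : ℕ) + 2) * s ^ (0 + 1) * y = y ^ 2 := by
      push_cast; ring
    rw [this, abs_of_nonneg (sq_nonneg y)]
    have := sq_nonneg y
    norm_num
    linarith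
  | succ n ih =>
    -- Recursion for the Taylor remainder; the constants close up because `(n + 2)² + (n + 2) ≤ (n +
    -- 3)²`.
    have hid : (s + y) ^ (n + 1 + 2) - s ^ (n + 1 + 2) - ((n + 1 : ℕ) + 2) * s ^ (n + 1 + 1) * y
        = (s + y) * ((s + y) ^ (n + 2) - s ^ (n + 2) - (n + 2) * s ^ (n + 1) * y)
          + (n + 2) * s ^ (n + 1) * y ^ 2 := by
      push_cast; ring
    rw [hid]
    have hy : |y ^ 2| = y ^ 2 := abs_of_nonneg (sq_nonneg y)
    have h1 : |s + y| ≤ |s| + |y| := abs_add_le s y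
    have h2 : |s| ^ (n + 1) ≤ (|s| + |y|) ^ (n + 1) := by
      gcongr; linarith [abs_nonneg y]
    have h3 : |((n : ℝ) + 2) * s ^ (n + 1) * y ^ 2|
        ≤ (n + 2) * (|s| + |y|) ^ (n + 1) * y ^ 2 := by
      rw [abs_mul, abs_mul, hy, abs_pow, abs_of_nonneg (by positivity : (0 : ℝ) ≤ n + 2)]
      gcongr
    have h4 : |(s + y) * ((s + y) ^ (n + 2) - s ^ (n + 2) - (n + 2) * s ^ (n + 1) * y)|
        ≤ (|s| + |y|) * ((n + 2) ^ 2 * (y ^ 2 * (|s| + |y|) ^ n)) := by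
      rw [abs_mul]
      gcongr
    refine (abs_add_le _ _).trans ((add_le_add h4 h3).trans ?_)
    have h5 : 0 ≤ y ^ 2 * (|s| + |y|) ^ (n + 1) := by positivity
    have h6 : (|s| + |y|) * (((n : ℝ) + 2) ^ 2 * (y ^ 2 * (|s| + |y|) ^ n))
        + (n + 2) * (|s| + |y|) ^ (n + 1) * y ^ 2
        = (((n : ℝ) + 2) ^ 2 + (n + 2)) * (y ^ 2 * (|s| + |y|) ^ (n + 1)) := by ring
    rw [h6]
    gcongr
    push_cast
    nlinarith [(Nat.cast_nonneg n : (0 : ℝ) ≤ n)]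

/-- Even powers make absolute values unnecessary. With `y` centred and independent of `s`, the
linear term has mean zero and the remaining products factor under expectation. -/
lemma add_pow_two_mul_add_two_le (s y : ℝ) (p : ℕ) :
    (s + y) ^ (2 * p + 2) ≤ s ^ (2 * p + 2) + (2 * p + 2) * (s ^ (2 * p + 1) * y)
      + (2 * p + 2) ^ 2 * 2 ^ (2 * p) * (s ^ (2 * p) * y ^ 2 + y ^ (2 * p + 2)) := by
  have h := (abs_le.1 (abs_add_pow_sub_le s y (2 * p))).2
  have h1 : (|s| + |y|) ^ (2 * p) ≤ 2 ^ (2 * p) * (s ^ (2 * p) + y ^ (2 * p)) := by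
    refine (add_pow_le (abs_nonneg s) (abs_nonneg y) _).trans ?_
    rw [← (even_two_mul p).pow_abs s, ← (even_two_mul p).pow_abs y]
    gcongr
    · norm_num
    · omega
  have h2 : y ^ 2 * (|s| + |y|) ^ (2 * p)
      ≤ 2 ^ (2 * p) * (s ^ (2 * p) * y ^ 2 + y ^ (2 * p + 2)) := by
    calc y ^ 2 * (|s| + |y|) ^ (2 * p) ≤ y ^ 2 * (2 ^ (2 * p) * (s ^ (2 * p) + y ^ (2 * p))) := by
          gcongr
      _ = _ := by ring
  have h3 := mul_le_mul_of_nonneg_left h2 (by positivity : (0 : ℝ) ≤ ((2 * p : ℕ) + 2) ^ 2)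
  push_cast at h h3
  linarith

variable {Ω : Type*} [MeasurableSpace Ω]

lemma integrable_pow_of_memLp {P : Measure Ω} [IsFiniteMeasure P] {f : Ω → ℝ}
    (hf : ∀ q : ℕ, MemLp f q P) (k : ℕ) : Integrable (fun ω => f ω ^ k) P := by
  rcases Nat.eq_zero_or_pos k with rfl | hk
  · simp
  · refine ((hf k).integrable_norm_pow hk.ne').mono ((hf 1).aestronglyMeasurable.pow k) ?_
    filter_upwards with ω
    simp

/-- Even moments of sums of independent centred random variables grow at most like `n ^ p`. -/
theorem exists_integral_sum_pow_le (P : Measure Ω) [IsProbabilityMeasure P] (p : ℕ) (M : ℝ) :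
    ∃ C : ℝ, 0 ≤ C ∧ ∀ ξ : ℕ → Ω → ℝ, iIndepFun ξ P → (∀ i, Measurable (ξ i)) →
      (∀ i (q : ℕ), MemLp (ξ i) q P) → (∀ i, ∀ q ≤ p, ∫ ω, ξ i ω ^ (2 * q) ∂P ≤ M) →
      (∀ i, ∫ ω, ξ i ω ∂P = 0) → ∀ n : ℕ,
      ∫ ω, (∑ i ∈ Finset.range n, ξ i ω) ^ (2 * p) ∂P ≤ C * n ^ p := by
  induction p with
  | zero => exact ⟨1, zero_le_one, fun ξ _ _ _ _ _ n => by simp⟩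
  | succ p ih =>
    obtain ⟨C, hC0, hC⟩ := ih
    set A : ℝ := (2 * p + 2) ^ 2 * 2 ^ (2 * p)
    have hA : 0 ≤ A := by positivity
    -- Adding the `n`th summand costs at most this constant times `(n + 1) ^ p`, and `n ^ (p + 1) +
    -- (n + 1) ^ p ≤ (n + 1) ^ (p + 1)`. The constant is fixed before the sequence `ξ`, so it serves
    -- all grid points and all `t` at once.
    refine ⟨A * (C * |M| + |M|), by positivity, fun ξ hind hmeas hmem hM hzero n => ?_⟩
    have hCξ := hC ξ hind hmeas hmem (fun i q hq => hM i q (by omega)) hzero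
    induction n with
    | zero => simp
    | succ n ihn =>
      set S : Ω → ℝ := fun ω => ∑ i ∈ Finset.range n, ξ i ω with hS
      have hSmem : ∀ q : ℕ, MemLp S q P := fun q => memLp_finsetSum _ fun i _ => hmem i q
      have hSmeas : Measurable S := Finset.measurable_sum _ fun i _ => hmeas i
      have hindS : IndepFun S (ξ n) P := by
        have := hind.indepFun_finsetSum_of_notMem hmeas (s := Finset.range n) (i := n) (by simp)
        convert this using 1
        ext ω
        simp [hS]
      have iS := integrable_pow_of_memLp hSmem
      have iξ := integrable_pow_of_memLp (hmem n)
      have hind2 : ∀ k l : ℕ, IndepFun (fun ω => S ω ^ k) (fun ω => ξ n ω ^ l) P := fun k l =>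
        hindS.comp (measurable_id.pow_const k) (measurable_id.pow_const l)
      have iprod : ∀ k l : ℕ, Integrable (fun ω => S ω ^ k * ξ n ω ^ l) P := fun k l =>
        (hind2 k l).integrable_mul (iS k) (iξ l)
      have eprod : ∀ k l : ℕ, ∫ ω, S ω ^ k * ξ n ω ^ l ∂P
          = (∫ ω, S ω ^ k ∂P) * ∫ ω, ξ n ω ^ l ∂P := fun k l =>
        (hind2 k l).integral_fun_mul_eq_mul_integral (iS k).aestronglyMeasurable
          (iξ l).aestronglyMeasurable
      have i1 : Integrable (fun ω => S ω ^ (2 * p + 1) * ξ n ω) P := by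
        simpa using iprod (2 * p + 1) 1
      have e1 : ∫ ω, S ω ^ (2 * p + 1) * ξ n ω ∂P = 0 := by
        have := eprod (2 * p + 1) 1
        simpa [hzero n] using this
      have ia : Integrable
          (fun ω => S ω ^ (2 * p + 2) + (2 * p + 2) * (S ω ^ (2 * p + 1) * ξ n ω)) P :=
        (iS _).add (i1.const_mul _)
      have ib : Integrable
          (fun ω => A * (S ω ^ (2 * p) * ξ n ω ^ 2 + ξ n ω ^ (2 * p + 2))) P :=
        ((iprod _ _).add (iξ _)).const_mul _
      have hstep : ∫ ω, (S ω + ξ n ω) ^ (2 * p + 2) ∂P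
          ≤ ∫ ω, (S ω ^ (2 * p + 2) + (2 * p + 2) * (S ω ^ (2 * p + 1) * ξ n ω)
            + A * (S ω ^ (2 * p) * ξ n ω ^ 2 + ξ n ω ^ (2 * p + 2))) ∂P := by
        refine integral_mono ?_ ?_ fun ω => add_pow_two_mul_add_two_le _ _ _
        · exact integrable_pow_of_memLp (fun q => (hSmem q).add (hmem n q)) _
        · exact ia.add ib
      rw [integral_add ia ib,
        integral_add (iS _) (i1.const_mul _), integral_const_mul, integral_const_mul,
        integral_add (iprod _ _) (iξ _), e1, eprod] at hstep
      have hMabs : M ≤ |M| := le_abs_self M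
      have m2 : ∫ ω, ξ n ω ^ 2 ∂P ≤ |M| := by
        simpa using (hM n 1 (by omega)).trans hMabs
      have m2p : ∫ ω, ξ n ω ^ (2 * p + 2) ∂P ≤ |M| := (hM n (p + 1) le_rfl).trans hMabs
      have m2nn : 0 ≤ ∫ ω, ξ n ω ^ 2 ∂P := integral_nonneg fun ω => sq_nonneg _
      have hprodle : (∫ ω, S ω ^ (2 * p) ∂P) * ∫ ω, ξ n ω ^ 2 ∂P ≤ C * n ^ p * |M| :=
        mul_le_mul (hCξ n) m2 m2nn (by positivity)
      have hn : (n : ℝ) ^ p ≤ (n + 1 : ℝ) ^ p := by gcongr; linarith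
      have h1n : (1 : ℝ) ≤ (n + 1 : ℝ) ^ p := one_le_pow₀ (by linarith [(Nat.cast_nonneg n : (0 : ℝ) ≤ n)])
      have hfin : ∫ ω, (∑ i ∈ Finset.range (n + 1), ξ i ω) ^ (2 * (p + 1)) ∂P
          = ∫ ω, (S ω + ξ n ω) ^ (2 * p + 2) ∂P := by
        simp only [Finset.sum_range_succ, hS, mul_add, mul_one]
      rw [hfin]
      have hihn : ∫ ω, S ω ^ (2 * p + 2) ∂P ≤ A * (C * |M| + |M|) * (n : ℝ) ^ (p + 1) := ihn
      have hb : A * ((∫ ω, S ω ^ (2 * p) ∂P) * (∫ ω, ξ n ω ^ 2 ∂P) + ∫ ω, ξ n ω ^ (2 * p + 2) ∂P)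
          ≤ A * (C * |M| + |M|) * (n + 1 : ℝ) ^ p := by
        have h1 : (∫ ω, S ω ^ (2 * p) ∂P) * (∫ ω, ξ n ω ^ 2 ∂P) + ∫ ω, ξ n ω ^ (2 * p + 2) ∂P
            ≤ (C * |M| + |M|) * (n + 1 : ℝ) ^ p := by
          have h2 := mul_le_mul_of_nonneg_left h1n (abs_nonneg M)
          have h3 := mul_le_mul_of_nonneg_left hn (by positivity : 0 ≤ C * |M|)
          linarith
        exact (mul_le_mul_of_nonneg_left h1 hA).trans_eq (by ring)
      have hc : (n : ℝ) ^ (p + 1) ≤ n * (n + 1 : ℝ) ^ p := by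
        rw [pow_succ']; gcongr
      have hd := mul_le_mul_of_nonneg_left hc (by positivity : 0 ≤ A * (C * |M| + |M|))
      push_cast
      have he : A * (C * |M| + |M|) * (n + 1 : ℝ) ^ (p + 1)
          = A * (C * |M| + |M|) * (n * (n + 1 : ℝ) ^ p) + A * (C * |M| + |M|) * (n + 1 : ℝ) ^ p := by
        ring
      linarith

/-! ### Almost sure rates -/

/-- Borel–Cantelli in integrated form: `∑ Fₙ` has finite integral, hence is finite almost
everywhere, and the terms of a convergent series tend to zero. -/
lemma ae_tendsto_zero_of_tsum_lintegral_ne_top {P : Measure Ω} {F : ℕ → Ω → ENNReal}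
    (hF : ∀ n, AEMeasurable (F n) P) (hsum : ∑' n, ∫⁻ ω, F n ω ∂P ≠ ⊤) :
    ∀ᵐ ω ∂P, Tendsto (fun n => F n ω) atTop (𝓝 0) := by
  rw [← lintegral_tsum hF] at hsum
  filter_upwards [ae_lt_top' (AEMeasurable.tsum hF) hsum] with ω hω
  exact ENNReal.tendsto_atTop_zero_of_tsum_ne_top hω.ne

lemma ae_tendsto_zero_of_lintegral_le_rpow {P : Measure Ω} [IsProbabilityMeasure P]
    {F : ℕ → Ω → ENNReal} (hF : ∀ n, AEMeasurable (F n) P) {C : ℝ}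
    (hC : ∀ n : ℕ, 1 ≤ n → ∫⁻ ω, F n ω ∂P ≤ ENNReal.ofReal (C * (n : ℝ) ^ (-2 : ℝ))) :
    ∀ᵐ ω ∂P, Tendsto (fun n => F n ω) atTop (𝓝 0) := by
  have h := ae_tendsto_zero_of_tsum_lintegral_ne_top (P := P) (F := fun n => F (n + 1))
    (fun n => hF (n + 1)) ?_
  · filter_upwards [h] with ω hω
    exact (tendsto_add_atTop_iff_nat 1).1 hω
  · have hs : Summable fun n : ℕ => |C| * (n : ℝ) ^ (-2 : ℝ) :=
      (Real.summable_nat_rpow.2 (by norm_num)).mul_left _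
    have hs' := (summable_nat_add_iff 1).2 hs
    refine ne_top_of_le_ne_top (hs'.tsum_ofReal_ne_top) (ENNReal.tsum_le_tsum fun n => ?_)
    refine (hC (n + 1) (by omega)).trans (ENNReal.ofReal_le_ofReal ?_)
    gcongr
    exact le_abs_self C

end

/-! ### Almost sure rates for averages in `L²` -/

section

variable {Ω : Type*} [MeasurableSpace Ω]

lemma eLpNorm_pow_eq_lintegral {α : Type*} [MeasurableSpace α] {μ : Measure α} (f : α → ℝ)
    {p : ℕ} (hp : p ≠ 0) : eLpNorm f p μ ^ p = ∫⁻ x, ‖f x‖ₑ ^ p ∂μ := by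
  have h := eLpNorm_nnreal_pow_eq_lintegral (f := f) (μ := μ) (p := (p : ℝ≥0))
    (Nat.cast_ne_zero.2 hp)
  simpa using h

lemma memLp_of_lintegral_pow_le {P : Measure Ω} {f : Ω → ℝ} (hf : AEStronglyMeasurable f P)
    {q : ℕ} {M : ℝ≥0} (h : ∫⁻ ω, ‖f ω‖ₑ ^ q ∂P ≤ M) : MemLp f q P := by
  rcases Nat.eq_zero_or_pos q with rfl | hq
  · simpa using memLp_zero_iff_aestronglyMeasurable.2 hf
  · refine ⟨hf, ?_⟩
    have := eLpNorm_pow_eq_lintegral (μ := P) f hq.ne'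
    by_contra hcon
    rw [not_lt, top_le_iff] at hcon
    rw [hcon, ENNReal.top_pow hq.ne'] at this
    exact absurd (this ▸ h) (by simp)

lemma integral_norm_pow_le {P : Measure Ω} {f : Ω → ℝ} (hf : AEStronglyMeasurable f P)
    {q : ℕ} {M : ℝ≥0} (h : ∫⁻ ω, ‖f ω‖ₑ ^ q ∂P ≤ M) : ∫ ω, ‖f ω‖ ^ q ∂P ≤ M := by
  rw [integral_eq_lintegral_of_nonneg_ae (Eventually.of_forall fun ω => by positivity)
    (show AEStronglyMeasurable (fun ω => ‖f ω‖ ^ q) P from hf.norm.pow q)]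
  refine ENNReal.toReal_le_of_le_ofReal M.2 ?_
  rw [ENNReal.ofReal_coe_nnreal]
  refine le_trans (le_of_eq (lintegral_congr fun ω => ?_)) h
  rw [ENNReal.ofReal_pow (norm_nonneg _), ofReal_norm]

/-- The inclusion of `L^q` in `L²` for a finite measure, in threshold form: once a weighted `q`th
moment tends to zero, the rate `r⁻¹` in `L²` follows with no constant in front. -/
lemma exists_pos_eLpNorm_two_le {T : Type*} [MeasurableSpace T] (ν : Measure T)
    [IsFiniteMeasure ν] {q : ℕ} (hq : 2 ≤ q) :
    ∃ κ : ℝ≥0∞, 0 < κ ∧ ∀ (f : T → ℝ) (r : ℝ≥0∞), AEStronglyMeasurable f ν → r ≠ 0 → r ≠ ⊤ →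
      r ^ q * ∫⁻ t, ‖f t‖ₑ ^ q ∂ν ≤ κ → eLpNorm f 2 ν ≤ r⁻¹ := by
  have hq0 : q ≠ 0 := by omega
  -- The added `1` keeps `c` invertible when `ν` is zero.
  set c : ℝ≥0∞ := ν Set.univ ^ (1 / (2 : ℝ≥0∞).toReal - 1 / (q : ℝ≥0∞).toReal) + 1 with hc
  have hexp : (0 : ℝ) ≤ 1 / (2 : ℝ≥0∞).toReal - 1 / (q : ℝ≥0∞).toReal := by
    have : (2 : ℝ) ≤ q := by exact_mod_cast hq
    rw [sub_nonneg, ENNReal.toReal_natCast, ENNReal.toReal_ofNat]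
    gcongr
  have hctop : c ≠ ⊤ :=
    ENNReal.add_ne_top.2 ⟨ENNReal.rpow_ne_top_of_nonneg hexp (measure_ne_top _ _), by simp⟩
  have hc0 : c ≠ 0 := by simp [hc]
  refine ⟨(c⁻¹) ^ q, ENNReal.pow_pos (ENNReal.inv_pos.2 hctop) _,
    fun f r hf hr0 hrtop hterm => ?_⟩
  rw [← eLpNorm_pow_eq_lintegral _ hq0, ← mul_pow, ENNReal.pow_le_pow_left_iff hq0] at hterm
  have hcmp := eLpNorm_le_eLpNorm_mul_rpow_measure_univ (μ := ν) (p := 2) (q := (q : ℝ≥0∞))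
    (by exact_mod_cast hq) hf
  have hle : r * eLpNorm f 2 ν ≤ 1 := by
    calc r * eLpNorm f 2 ν ≤ r * (eLpNorm f q ν * c) := by
          gcongr
          exact hcmp.trans (mul_le_mul_right le_self_add _)
      _ = (r * eLpNorm f q ν) * c := by ring
      _ ≤ c⁻¹ * c := by gcongr
      _ = 1 := ENNReal.inv_mul_cancel hc0 hctop
  rwa [ENNReal.mul_le_iff_le_inv hr0 hrtop, mul_one] at hle

/-- Almost sure rate `n ^ (-1/2 + ε)`, uniform over grids of size at most `n + 1`, for averages of
functionals of independent identically distributed data with bounded moments. -/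
theorem ae_eventually_eLpNorm_average_sub_le {P : Measure Ω} [IsProbabilityMeasure P]
    {E T ι : Type*} [MeasurableSpace E] [MeasurableSpace T] {ν : Measure T} [IsFiniteMeasure ν]
    {X : ℕ → Ω → E} (hX : ∀ i, Measurable (X i)) (hindep : iIndepFun X P)
    (hident : ∀ i, IdentDistrib (X i) (X 0) P P)
    {g : ℕ → ι → T → E → ℝ} (hg : ∀ n l t, Measurable (g n l t))
    (hjoint : ∀ n l i, Measurable (fun p : Ω × T => g n l p.2 (X i p.1)))
    (hmom : ∀ q : ℕ, ∃ M : ℝ≥0, ∀ n l t, ∫⁻ ω, ‖g n l t (X 0 ω)‖ₑ ^ q ∂P ≤ M)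
    {G : ℕ → Finset ι} (hG : ∀ n, (G n).card ≤ n + 1) {ε : ℝ} (hε : 0 < ε) :
    ∀ᵐ ω ∂P, ∀ᶠ n : ℕ in atTop, ∀ l ∈ G n,
      eLpNorm (fun t => (1 / (n : ℝ)) * ∑ i ∈ Finset.range n, g n l t (X i ω)
        - ∫ ω', g n l t (X 0 ω') ∂P) 2 ν ≤ ENNReal.ofReal ((n : ℝ) ^ (-(1 / 2) + ε : ℝ)) := by
  choose M hM using hmom
  set m : ℕ → ι → T → ℝ := fun n l t => ∫ ω', g n l t (X 0 ω') ∂P with hm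
  have hgX : ∀ n l t i, Measurable fun ω => g n l t (X i ω) := fun n l t i =>
    (hg n l t).comp (hX i)
  have hidg : ∀ n l t i, IdentDistrib (fun ω => g n l t (X i ω)) (fun ω => g n l t (X 0 ω)) P P :=
    fun n l t i => (hident i).comp (hg n l t)
  have hmem0 : ∀ n l t (q : ℕ), MemLp (fun ω => g n l t (X 0 ω)) q P := fun n l t q =>
    memLp_of_lintegral_pow_le (hgX n l t 0).aestronglyMeasurable (hM q n l t)
  have hmem : ∀ n l t i (q : ℕ), MemLp (fun ω => g n l t (X i ω)) q P := fun n l t i q =>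
    (hidg n l t i).memLp_iff.2 (hmem0 n l t q)
  have hmean : ∀ n l t i, ∫ ω, g n l t (X i ω) ∂P = m n l t := fun n l t i =>
    (hidg n l t i).integral_eq
  have hmle : ∀ n l t, |m n l t| ≤ M 1 := fun n l t => by
    refine (norm_integral_le_integral_norm (fun ω => g n l t (X 0 ω))).trans ?_
    have := integral_norm_pow_le (hgX n l t 0).aestronglyMeasurable (hM 1 n l t)
    simpa using this
  -- centred moments
  have hcent : ∀ n l t i (q : ℕ), ∫ ω, (g n l t (X i ω) - m n l t) ^ (2 * q) ∂P
      ≤ 2 ^ (2 * q) * (M (2 * q) + M 1 ^ (2 * q)) := by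
    intro n l t i q
    have hid2 : IdentDistrib (fun ω => (g n l t (X i ω) - m n l t) ^ (2 * q))
        (fun ω => (g n l t (X 0 ω) - m n l t) ^ (2 * q)) P P :=
      (hident i).comp (((hg n l t).sub_const _).pow_const _)
    rw [hid2.integral_eq]
    have hint : Integrable (fun ω => ‖g n l t (X 0 ω)‖ ^ (2 * q)) P := by
      have := (integrable_pow_of_memLp (hmem0 n l t) (2 * q)).norm
      simpa only [norm_pow] using this
    calc ∫ ω, (g n l t (X 0 ω) - m n l t) ^ (2 * q) ∂P
        ≤ ∫ ω, 2 ^ (2 * q) * (‖g n l t (X 0 ω)‖ ^ (2 * q) + M 1 ^ (2 * q)) ∂P := by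
          refine integral_mono ?_ ?_ fun ω => ?_
          · exact integrable_pow_of_memLp
              (fun r => (hmem0 n l t r).sub (memLp_const (m n l t))) _
          · exact (hint.add (integrable_const _)).const_mul _
          · show (g n l t (X 0 ω) - m n l t) ^ (2 * q) ≤ _
            rw [← (even_two_mul q).pow_abs]
            have h1 : |g n l t (X 0 ω) - m n l t| ≤ ‖g n l t (X 0 ω)‖ + M 1 :=
              (abs_sub _ _).trans (add_le_add le_rfl (hmle n l t))
            refine (pow_le_pow_left₀ (abs_nonneg _) h1 _).trans ?_
            refine (add_pow_le (norm_nonneg _) (M 1).2 _).trans ?_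
            have h2 : (0 : ℝ) ≤ ‖g n l t (X 0 ω)‖ ^ (2 * q) + (M 1 : ℝ) ^ (2 * q) := by positivity
            exact mul_le_mul_of_nonneg_right
              (pow_le_pow_right₀ (by norm_num) (Nat.sub_le _ _)) h2
      _ = 2 ^ (2 * q) * ((∫ ω, ‖g n l t (X 0 ω)‖ ^ (2 * q) ∂P) + M 1 ^ (2 * q)) := by
          rw [integral_const_mul, integral_add hint (integrable_const _)]
          simp
      _ ≤ _ := by
          gcongr
          exact integral_norm_pow_le (hgX n l t 0).aestronglyMeasurable (hM _ n l t)
  -- With `2pε ≥ 3`, each weighted moment is `O(n^{-2pε})`, hence `O(n^{-3})`. The union over at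
  -- most `n + 1 ≤ 2n` indices leaves `O(n^{-2})`, which is summable.
  obtain ⟨p, hp⟩ : ∃ p : ℕ, 3 / (2 * ε) < p := exists_nat_gt _
  have hp0 : 0 < p := by
    have : (0 : ℝ) < p := lt_trans (by positivity) hp
    exact_mod_cast this
  have hpε : 3 ≤ 2 * p * ε := by
    rw [div_lt_iff₀ (by positivity)] at hp
    linarith
  obtain ⟨C, hC0, hC⟩ := exists_integral_sum_pow_le P p
    (∑ q ∈ Finset.range (p + 1), 2 ^ (2 * q) * ((M (2 * q) : ℝ) + M 1 ^ (2 * q)))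
  set avg : ℕ → ι → Ω → T → ℝ := fun n l ω t =>
    (1 / (n : ℝ)) * ∑ i ∈ Finset.range n, g n l t (X i ω) - m n l t with havg
  have havg_eq : ∀ n l ω t, 1 ≤ n → avg n l ω t
      = (1 / (n : ℝ)) * ∑ i ∈ Finset.range n, (g n l t (X i ω) - m n l t) := by
    intro n l ω t hn
    have : (n : ℝ) ≠ 0 := by positivity
    simp only [havg, Finset.sum_sub_distrib, Finset.sum_const, Finset.card_range, nsmul_eq_mul]
    field_simp
  have hmmeas : ∀ n l, Measurable (m n l) := fun n l => by
    have : StronglyMeasurable fun p : T × Ω => g n l p.1 (X 0 p.2) :=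
      ((hjoint n l 0).comp measurable_swap).stronglyMeasurable
    exact this.integral_prod_right.measurable
  have havgmeas : ∀ n l, Measurable fun p : Ω × T => avg n l p.1 p.2 := fun n l =>
    ((Finset.measurable_sum _ fun i _ => hjoint n l i).const_mul _).sub
      ((hmmeas n l).comp measurable_snd)
  have hmoment : ∀ n l t, 1 ≤ n →
      ∫⁻ ω, ‖avg n l ω t‖ₑ ^ (2 * p) ∂P ≤ ENNReal.ofReal (C * (n : ℝ) ^ (-(p : ℝ))) := by
    intro n l t hn
    have hn0 : (0 : ℝ) < n := by exact_mod_cast hn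
    have h1 := hC (fun i ω => g n l t (X i ω) - m n l t)
      (hindep.comp (fun _ x => g n l t x - m n l t) fun _ => (hg n l t).sub_const _)
      (fun i => (hgX n l t i).sub_const _)
      (fun i q => (hmem n l t i q).sub (memLp_const _))
      (fun i q hq => (hcent n l t i q).trans <|
        Finset.single_le_sum (f := fun q : ℕ => (2 : ℝ) ^ (2 * q) * ((M (2 * q) : ℝ) + M 1 ^ (2 * q)))
          (fun q _ => by positivity) (Finset.mem_range.2 (by omega)))
      (fun i => by
        rw [integral_sub, hmean]
        · simp
        · exact (hmem n l t i 1).integrable (by simp)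
        · simp) n
    have hint : Integrable (fun ω => (avg n l ω t) ^ (2 * p)) P := by
      refine integrable_pow_of_memLp (fun q => ?_) _
      exact ((memLp_finsetSum _ fun i _ => hmem n l t i q).const_mul _).sub (memLp_const _)
    have h2 : ∫⁻ ω, ‖avg n l ω t‖ₑ ^ (2 * p) ∂P
        = ENNReal.ofReal (∫ ω, (avg n l ω t) ^ (2 * p) ∂P) := by
      rw [ofReal_integral_eq_lintegral_ofReal hint
        (Eventually.of_forall fun ω => (even_two_mul p).pow_nonneg _)]
      refine lintegral_congr fun ω => ?_
      rw [← (even_two_mul p).pow_abs, ENNReal.ofReal_pow (abs_nonneg _), ← Real.norm_eq_abs,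
        ofReal_norm]
    rw [h2]
    refine ENNReal.ofReal_le_ofReal ?_
    simp only [havg_eq n l _ t hn, mul_pow, integral_const_mul]
    calc (1 / (n : ℝ)) ^ (2 * p) * _ ≤ (1 / (n : ℝ)) ^ (2 * p) * (C * n ^ p) := by gcongr
      _ = C * (n : ℝ) ^ (-(p : ℝ)) := by
        rw [Real.rpow_neg hn0.le, Real.rpow_natCast, two_mul, pow_add, one_div, inv_pow]
        field_simp
  set r : ℕ → ℝ≥0∞ := fun n => ENNReal.ofReal ((n : ℝ) ^ (1 / 2 - ε : ℝ)) with hr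
  set F : ℕ → Ω → ℝ≥0∞ := fun n ω => ∑ l ∈ G n,
    r n ^ (2 * p) * ∫⁻ t, ‖avg n l ω t‖ₑ ^ (2 * p) ∂ν with hF
  have hinner : ∀ n l, Measurable fun ω => ∫⁻ t, ‖avg n l ω t‖ₑ ^ (2 * p) ∂ν := fun n l =>
    Measurable.lintegral_prod_right' (f := fun q : Ω × T => ‖avg n l q.1 q.2‖ₑ ^ (2 * p))
      ((havgmeas n l).enorm.pow_const _)
  have hFmeas : ∀ n, Measurable (F n) := fun n =>
    Finset.measurable_sum _ fun l _ => (hinner n l).const_mul _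
  have hFle : ∀ n : ℕ, 1 ≤ n → ∫⁻ ω, F n ω ∂P
      ≤ ENNReal.ofReal ((2 * (C * ν.real Set.univ)) * (n : ℝ) ^ (-2 : ℝ)) := by
    intro n hn
    have hn0 : (0 : ℝ) < n := by exact_mod_cast hn
    have hn1 : (1 : ℝ) ≤ n := by exact_mod_cast hn
    rw [hF, lintegral_finsetSum _ fun l _ => (hinner n l).const_mul _]
    have h1 : ∀ l ∈ G n, ∫⁻ ω, r n ^ (2 * p) * ∫⁻ t, ‖avg n l ω t‖ₑ ^ (2 * p) ∂ν ∂P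
        ≤ ENNReal.ofReal (C * ν.real Set.univ * (n : ℝ) ^ (-3 : ℝ)) := by
      intro l _
      -- By Tonelli the scalar moment bound is applied at each fixed `t` and then integrated.
      rw [lintegral_const_mul _ (hinner n l), lintegral_lintegral_swap
        ((havgmeas n l).enorm.pow_const _).aemeasurable]
      calc r n ^ (2 * p) * ∫⁻ t, ∫⁻ ω, ‖avg n l ω t‖ₑ ^ (2 * p) ∂P ∂ν
          ≤ r n ^ (2 * p) * ∫⁻ _, ENNReal.ofReal (C * (n : ℝ) ^ (-(p : ℝ))) ∂ν := by
            gcongr with t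
            exact hmoment n l t hn
        _ = ENNReal.ofReal (((n : ℝ) ^ (1 / 2 - ε : ℝ)) ^ (2 * p)
              * (C * (n : ℝ) ^ (-(p : ℝ)) * ν.real Set.univ)) := by
            rw [lintegral_const, hr, ← ENNReal.ofReal_pow (by positivity), measureReal_def,
              ENNReal.ofReal_mul (p := ((n : ℝ) ^ (1 / 2 - ε : ℝ)) ^ (2 * p)) (by positivity),
              ENNReal.ofReal_mul (p := C * (n : ℝ) ^ (-(p : ℝ))) (by positivity),
              ENNReal.ofReal_toReal (measure_ne_top _ _)]
        _ ≤ _ := by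
            refine ENNReal.ofReal_le_ofReal ?_
            rw [← Real.rpow_natCast, ← Real.rpow_mul hn0.le]
            have : (n : ℝ) ^ ((1 / 2 - ε) * (2 * p : ℕ)) * (n : ℝ) ^ (-(p : ℝ))
                ≤ (n : ℝ) ^ (-3 : ℝ) := by
              rw [← Real.rpow_add hn0]
              refine Real.rpow_le_rpow_of_exponent_le hn1 ?_
              push_cast
              nlinarith
            have h0 : 0 ≤ C * ν.real Set.univ := by positivity
            nlinarith [mul_le_mul_of_nonneg_left this h0]
    refine (Finset.sum_le_card_nsmul _ _ _ h1).trans ?_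
    rw [nsmul_eq_mul, ← ENNReal.ofReal_natCast, ← ENNReal.ofReal_mul (Nat.cast_nonneg _)]
    refine ENNReal.ofReal_le_ofReal ?_
    have h2 : ((G n).card : ℝ) ≤ 2 * n := by
      have : ((G n).card : ℝ) ≤ n + 1 := by exact_mod_cast hG n
      linarith
    have h3 : (n : ℝ) ^ (-2 : ℝ) = n * (n : ℝ) ^ (-3 : ℝ) := by
      rw [← Real.rpow_one_add' hn0.le (by norm_num : (1 : ℝ) + -3 ≠ 0)]
      norm_num
    rw [h3]
    have h0 : 0 ≤ C * ν.real Set.univ * (n : ℝ) ^ (-3 : ℝ) := by positivity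
    nlinarith [mul_le_mul_of_nonneg_right h2 h0]
  obtain ⟨κ, hκ, hκle⟩ := exists_pos_eLpNorm_two_le ν (by omega : 2 ≤ 2 * p)
  filter_upwards [ae_tendsto_zero_of_lintegral_le_rpow (fun n => (hFmeas n).aemeasurable) hFle]
    with ω hω
  filter_upwards [hω.eventually (gt_mem_nhds hκ), eventually_ge_atTop 1] with n hn hn1 l hl
  have hn0 : (0 : ℝ) < n := by exact_mod_cast hn1
  have hterm : r n ^ (2 * p) * ∫⁻ t, ‖avg n l ω t‖ₑ ^ (2 * p) ∂ν ≤ κ :=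
    (Finset.single_le_sum (f := fun l => r n ^ (2 * p) * ∫⁻ t, ‖avg n l ω t‖ₑ ^ (2 * p) ∂ν)
      (fun _ _ => zero_le) hl).trans hn.le
  have hsm : AEStronglyMeasurable (fun t => avg n l ω t) ν :=
    ((havgmeas n l).comp measurable_prodMk_left).aestronglyMeasurable
  have hr0 : r n ≠ 0 := by
    simp only [hr, ne_eq, ENNReal.ofReal_eq_zero, not_le]
    positivity
  have hle := hκle _ (r n) hsm hr0 ENNReal.ofReal_ne_top hterm
  refine hle.trans (le_of_eq ?_)
  rw [hr, ← ENNReal.ofReal_inv_of_pos (by positivity), ← Real.rpow_neg hn0.le]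
  congr 2
  ring

end

section

/-! ### Perturbation of eigenvalues and eigenvectors -/

section Perturbation

variable {H : Type*} [NormedAddCommGroup H] [InnerProductSpace ℝ H]

/-- The quadratic form with eigenvalues `θ k` and eigenvectors `ψ k`. -/
def specForm (θ : ℕ → ℝ) (ψ : ℕ → H) (u v : H) : ℝ :=
  ∑' k, θ k * (inner ℝ (ψ k) u * inner ℝ (ψ k) v)

variable {θ : ℕ → ℝ} {ψ : ℕ → H}

lemma summable_specForm (hθ : Antitone θ) (hθ0 : ∀ k, 0 ≤ θ k) (hψ : Orthonormal ℝ ψ) (u v : H) :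
    Summable fun k => θ k * (inner ℝ (ψ k) u * inner ℝ (ψ k) v) := by
  have hu := hψ.inner_products_summable u
  have hv := hψ.inner_products_summable v
  refine Summable.of_norm_bounded ((hu.add hv).mul_left (θ 0)) fun k => ?_
  rw [norm_mul, norm_mul, Real.norm_of_nonneg (hθ0 k)]
  have h0 : 0 ≤ ‖inner ℝ (ψ k) u‖ := norm_nonneg _
  have h1 : 0 ≤ ‖inner ℝ (ψ k) v‖ := norm_nonneg _
  refine mul_le_mul (hθ (Nat.zero_le k)) ?_ (by positivity) (hθ0 0)
  nlinarith [sq_nonneg (‖inner ℝ (ψ k) u‖ - ‖inner ℝ (ψ k) v‖)]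

lemma specForm_comm (u v : H) : specForm θ ψ u v = specForm θ ψ v u := by
  simp only [specForm, mul_comm (inner ℝ (ψ _) u)]

lemma specForm_sub_left (hθ : Antitone θ) (hθ0 : ∀ k, 0 ≤ θ k) (hψ : Orthonormal ℝ ψ)
    (u u' v : H) : specForm θ ψ (u - u') v = specForm θ ψ u v - specForm θ ψ u' v := by
  rw [specForm, specForm, specForm, ← (summable_specForm hθ hθ0 hψ u v).tsum_sub
    (summable_specForm hθ hθ0 hψ u' v)]
  congr 1 with k
  rw [inner_sub_right]; ring

lemma specForm_smul_left (c : ℝ) (u v : H) :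
    specForm θ ψ (c • u) v = c * specForm θ ψ u v := by
  rw [specForm, specForm, ← tsum_mul_left]
  congr 1 with k
  rw [inner_smul_right]; ring

lemma specForm_eigenvector (hψ : Orthonormal ℝ ψ) (j : ℕ) (v : H) :
    specForm θ ψ (ψ j) v = θ j * inner ℝ (ψ j) v := by
  rw [specForm, tsum_eq_single j fun k hk => by rw [hψ.2 hk]; simp]
  simp [hψ.1 j]

lemma specForm_self_le (hθ : Antitone θ) (hθ0 : ∀ k, 0 ≤ θ k) (hψ : Orthonormal ℝ ψ) {m : ℕ}
    {v : H} (hv : ∀ k < m, inner ℝ (ψ k) v = 0) : specForm θ ψ v v ≤ θ m * ‖v‖ ^ 2 := by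
  have hs := hψ.inner_products_summable v
  calc specForm θ ψ v v ≤ ∑' k, θ m * ‖inner ℝ (ψ k) v‖ ^ 2 := by
        refine (summable_specForm hθ hθ0 hψ v v).tsum_le_tsum (fun k => ?_) (hs.mul_left _)
        rcases lt_or_ge k m with hk | hk
        · simp [hv k hk]
        · rw [Real.norm_eq_abs, sq_abs, ← sq]
          exact mul_le_mul_of_nonneg_right (hθ hk) (sq_nonneg _)
    _ = θ m * ∑' k, ‖inner ℝ (ψ k) v‖ ^ 2 := tsum_mul_left
    _ ≤ _ := mul_le_mul_of_nonneg_left (hψ.tsum_inner_products_le v) (hθ0 m)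

lemma inner_sum_range (hψ : Orthonormal ℝ ψ) (c : ℕ → ℝ) (m k : ℕ) :
    inner ℝ (ψ k) (∑ i ∈ Finset.range m, c i • ψ i) = if k < m then c k else 0 := by
  rw [inner_sum]
  simp only [inner_smul_right, orthonormal_iff_ite.1 hψ]
  simp

lemma le_specForm_self (hθ : Antitone θ) (hθ0 : ∀ k, 0 ≤ θ k) (hψ : Orthonormal ℝ ψ) {m : ℕ}
    {τ : ℝ} (hτ : ∀ k < m, τ ≤ θ k) (c : ℕ → ℝ) :
    τ * ‖∑ i ∈ Finset.range m, c i • ψ i‖ ^ 2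
      ≤ specForm θ ψ (∑ i ∈ Finset.range m, c i • ψ i) (∑ i ∈ Finset.range m, c i • ψ i) := by
  set v := ∑ i ∈ Finset.range m, c i • ψ i with hv
  have hnorm : ‖v‖ ^ 2 = ∑ i ∈ Finset.range m, c i ^ 2 := by
    rw [← real_inner_self_eq_norm_sq]
    nth_rewrite 1 [hv]
    rw [sum_inner]
    refine Finset.sum_congr rfl fun i hi => ?_
    rw [real_inner_smul_left, hv, inner_sum_range hψ, if_pos (Finset.mem_range.1 hi), sq]
  rw [hnorm, Finset.mul_sum]
  refine le_trans (Finset.sum_le_sum fun i hi => ?_)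
    ((summable_specForm hθ hθ0 hψ v v).sum_le_tsum (Finset.range m) fun k _ => ?_)
  · rw [hv, inner_sum_range hψ, if_pos (Finset.mem_range.1 hi), sq]
    exact mul_le_mul_of_nonneg_right (hτ i (Finset.mem_range.1 hi)) (mul_self_nonneg _)
  · exact mul_nonneg (hθ0 k) (mul_self_nonneg _)

variable {θ' : ℕ → ℝ} {ψ' : ℕ → H} {Δ : ℝ}

/-- Weyl's inequality, one side. -/
lemma eigenvalue_le_add (hθ : Antitone θ) (hθ0 : ∀ k, 0 ≤ θ k) (hψ : Orthonormal ℝ ψ)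
    (hθ' : Antitone θ') (hθ0' : ∀ k, 0 ≤ θ' k) (hψ' : Orthonormal ℝ ψ')
    (hΔ : ∀ u v, specForm θ ψ u v - specForm θ' ψ' u v ≤ Δ * (‖u‖ * ‖v‖)) (j : ℕ) :
    θ j ≤ θ' j + Δ := by
  -- Dimension count: some nonzero `v` in the span of `ψ 0, …, ψ j` is orthogonal to `ψ' 0, …, ψ' (j
  -- - 1)`. On it the first form is at least `θ j ‖v‖²`, the second at most `θ' j ‖v‖²`.
  let f : (Fin (j + 1) → ℝ) →ₗ[ℝ] (Fin j → ℝ) :=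
    { toFun := fun c k => ∑ i, c i * inner ℝ (ψ' k) (ψ i)
      map_add' := fun c d => by ext k; simp [add_mul, Finset.sum_add_distrib]
      map_smul' := fun r c => by ext k; simp [mul_assoc, Finset.mul_sum] }
  have hker : LinearMap.ker f ≠ ⊥ := LinearMap.ker_ne_bot_of_finrank_lt (by simp)
  obtain ⟨c, hcker, hc0⟩ := (Submodule.ne_bot_iff _).1 hker
  set c' : ℕ → ℝ := fun i => if h : i < j + 1 then c ⟨i, h⟩ else 0 with hc'
  set v : H := ∑ i ∈ Finset.range (j + 1), c' i • ψ i with hv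
  have hvorth : ∀ k < j, inner ℝ (ψ' k) v = 0 := by
    intro k hk
    have h1 := congrFun (LinearMap.mem_ker.1 hcker) ⟨k, hk⟩
    rw [hv, inner_sum, Finset.sum_range]
    refine Eq.trans (Finset.sum_congr rfl fun i _ => ?_) h1
    simp only [hc', Fin.is_lt, dif_pos, inner_smul_right]
  have hvne : v ≠ 0 := by
    intro h0
    apply hc0
    ext i
    have := inner_sum_range hψ c' (j + 1) i
    rw [← hv, h0, inner_zero_right, if_pos i.2] at this
    simp only [hc', Fin.is_lt, dif_pos] at this
    exact this.symm
  have hlow := le_specForm_self hθ hθ0 hψ (m := j + 1) (τ := θ j)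
    (fun k hk => hθ (Nat.lt_succ_iff.1 hk)) c'
  rw [← hv] at hlow
  have hup := specForm_self_le hθ' hθ0' hψ' hvorth
  have hd := hΔ v v
  have hpos : 0 < ‖v‖ ^ 2 := by positivity
  refine le_of_mul_le_mul_right ?_ hpos
  nlinarith

/-- Davis–Kahan bound for the `j`-th eigenvector. -/
lemma gap_mul_norm_sub_le (hθ : Antitone θ) (hθ0 : ∀ k, 0 ≤ θ k) (hψ : Orthonormal ℝ ψ)
    (hψ' : Orthonormal ℝ ψ')
    (hΔ : ∀ u v, |specForm θ ψ u v - specForm θ' ψ' u v| ≤ Δ * (‖u‖ * ‖v‖)) {j : ℕ}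
    (hj : |θ' j - θ j| ≤ Δ) {g : ℝ} (hg : ∀ k < j, g ≤ θ k - θ j) (hg' : g ≤ θ j - θ (j + 1)) :
    g * ‖ψ' j - (inner ℝ (ψ j) (ψ' j) : ℝ) • ψ j‖ ≤ 2 * Δ := by
  set c : ℝ := inner ℝ (ψ j) (ψ' j) with hc
  obtain ⟨v, hv⟩ : ∃ v : H, v = ψ' j - c • ψ j := ⟨_, rfl⟩
  rw [← hv]
  have hΔ0 : 0 ≤ Δ := (abs_nonneg _).trans hj
  have hvj : inner ℝ (ψ j) v = 0 := by
    rw [hv, inner_sub_right, inner_smul_right, real_inner_self_eq_norm_sq, hψ.1 j, ← hc]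
    ring
  obtain ⟨v₁, hv1⟩ : ∃ x : H, x = ∑ k ∈ Finset.range j, (inner ℝ (ψ k) v : ℝ) • ψ k :=
    ⟨_, rfl⟩
  obtain ⟨v₂, hv2⟩ : ∃ x : H, x = v - v₁ := ⟨_, rfl⟩
  have hin1 : ∀ k, inner ℝ (ψ k) v₁ = if k < j then inner ℝ (ψ k) v else 0 :=
    hv1 ▸ inner_sum_range hψ _ j
  have hin2 : ∀ k < j + 1, inner ℝ (ψ k) v₂ = 0 := by
    intro k hk
    rw [hv2, inner_sub_right, hin1]
    split_ifs with h
    · ring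
    · obtain rfl : k = j := by omega
      rw [hvj]; ring
  have horth : inner ℝ v₁ v₂ = 0 := by
    rw [hv1, sum_inner]
    refine Finset.sum_eq_zero fun k hk => ?_
    rw [real_inner_smul_left, hin2 k (by have := Finset.mem_range.1 hk; omega), mul_zero]
  have horth' : inner ℝ v₂ v₁ = 0 := by rw [real_inner_comm]; exact horth
  have hvsum : v = v₁ + v₂ := by rw [hv2]; abel
  have hnormv : ‖v‖ ^ 2 = ‖v₁‖ ^ 2 + ‖v₂‖ ^ 2 := by
    rw [hvsum, ← real_inner_self_eq_norm_sq, inner_add_left, inner_add_right, inner_add_right,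
      horth, horth', real_inner_self_eq_norm_sq, real_inner_self_eq_norm_sq]
    ring
  -- The test vector flips the part of `v` beyond index `j`, so the gaps on both sides of `θ j` add
  -- up: the form at `(v, w)` is at least `θ j ⟨v, w⟩ + g ‖v‖²`. Since `w` is orthogonal to `ψ j`,
  -- `v` may be replaced by `ψ' j` in the first argument.
  obtain ⟨w, hw⟩ : ∃ x : H, x = v₁ - v₂ := ⟨_, rfl⟩
  have hnormw : ‖w‖ ^ 2 = ‖v₁‖ ^ 2 + ‖v₂‖ ^ 2 := by
    rw [hw, ← real_inner_self_eq_norm_sq, inner_sub_left, inner_sub_right, inner_sub_right,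
      horth, horth', real_inner_self_eq_norm_sq, real_inner_self_eq_norm_sq]
    ring
  have hwv : ‖w‖ = ‖v‖ := by
    rw [← sq_eq_sq₀ (norm_nonneg _) (norm_nonneg _), hnormw, hnormv]
  have hvw : inner ℝ v w = ‖v₁‖ ^ 2 - ‖v₂‖ ^ 2 := by
    rw [hvsum, hw, inner_add_left, inner_sub_right, inner_sub_right,
      horth, horth', real_inner_self_eq_norm_sq, real_inner_self_eq_norm_sq]
    ring
  have hwj : inner ℝ (ψ j) w = 0 := by
    rw [hw, inner_sub_right, hin1, if_neg (lt_irrefl j), hin2 j (by omega), sub_zero]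
  have hBvw : specForm θ ψ v w = specForm θ ψ v₁ v₁ - specForm θ ψ v₂ v₂ := by
    have h1 : ∀ x, specForm θ ψ x w = specForm θ ψ x v₁ - specForm θ ψ x v₂ := fun x => by
      rw [specForm_comm, hw, specForm_sub_left hθ hθ0 hψ, specForm_comm v₁, specForm_comm v₂]
    have h2 : v₂ = v - v₁ := hv2
    have h3 : ∀ x, specForm θ ψ v x = specForm θ ψ v₁ x + specForm θ ψ v₂ x := fun x => by
      rw [h2, specForm_sub_left hθ hθ0 hψ]; ring
    rw [h1, h3, h3, specForm_comm v₂ v₁]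
    ring
  have hlow := le_specForm_self hθ hθ0 hψ (m := j) (τ := θ j + g)
    (fun k hk => by linarith [hg k hk]) (fun k => inner ℝ (ψ k) v)
  rw [← hv1] at hlow
  have hup := specForm_self_le hθ hθ0 hψ hin2
  have hup' : θ (j + 1) * ‖v₂‖ ^ 2 ≤ (θ j - g) * ‖v₂‖ ^ 2 :=
    mul_le_mul_of_nonneg_right (by linarith) (sq_nonneg _)
  have hBv : specForm θ ψ v w = specForm θ ψ (ψ' j) w := by
    rw [hv, specForm_sub_left hθ hθ0 hψ, specForm_smul_left, specForm_eigenvector hψ, hwj]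
    ring
  have hB' := (abs_le.1 (hΔ (ψ' j) w)).2
  rw [specForm_eigenvector hψ', hψ'.1 j, one_mul] at hB'
  have hinw : inner ℝ (ψ' j) w = inner ℝ v w := by
    rw [hv, inner_sub_left, real_inner_smul_left, hwj]; ring
  rw [hinw] at hB'
  have hv_le : ‖v‖ ≤ 1 := by
    have h1 : ‖v‖ ^ 2 = 1 - c ^ 2 := by
      rw [hv, ← real_inner_self_eq_norm_sq, inner_sub_left, inner_sub_right, inner_sub_right,
        real_inner_smul_left, inner_smul_right, real_inner_smul_left, inner_smul_right,
        real_inner_self_eq_norm_sq, real_inner_self_eq_norm_sq, hψ.1 j, hψ'.1 j,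
        real_inner_comm, ← hc]
      ring
    nlinarith [norm_nonneg v, sq_nonneg c]
  have hinle : |inner ℝ v w| ≤ ‖v‖ * ‖v‖ := by
    have := abs_real_inner_le_norm v w
    rwa [hwv] at this
  have hdiff : (θ' j - θ j) * inner ℝ v w ≤ Δ * (‖v‖ * ‖v‖) := by
    refine (le_abs_self _).trans ?_
    rw [abs_mul]
    exact mul_le_mul hj hinle (abs_nonneg _) hΔ0
  -- After division by `‖v‖`, the bound `‖v‖ ≤ 1` turns the right-hand side into `2 * Δ`.
  have hmain : g * ‖v‖ ^ 2 ≤ Δ * (‖v‖ * ‖v‖) + Δ * ‖v‖ := by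
    rw [hwv] at hB'
    rw [hvw] at hB' hdiff
    rw [hnormv]
    nlinarith
  rcases eq_or_lt_of_le (norm_nonneg v) with h0 | h0
  · rw [← h0]; simpa using hΔ0
  · refine le_of_mul_le_mul_right ?_ h0
    nlinarith [mul_nonneg hΔ0 h0.le]

/-- The normalized eigenvectors `θⱼ^{-1/2} ψⱼ` are, up to sign, Lipschitz functions of the
quadratic form. -/
theorem exists_sign_norm_sub_le (hθ : Antitone θ) (hθ0 : ∀ k, 0 ≤ θ k) (hψ : Orthonormal ℝ ψ)
    (hθ' : Antitone θ') (hθ0' : ∀ k, 0 ≤ θ' k) (hψ' : Orthonormal ℝ ψ')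
    (hΔ : ∀ u v, |specForm θ ψ u v - specForm θ' ψ' u v| ≤ Δ * (‖u‖ * ‖v‖)) {j : ℕ}
    {g : ℝ} (hg0 : 0 < g) (hg : ∀ k < j, g ≤ θ k - θ j) (hg' : g ≤ θ j - θ (j + 1))
    (hΔj : Δ ≤ θ j / 2) :
    ∃ s : ℝ, (s = 1 ∨ s = -1) ∧ ‖(s / √(θ' j)) • ψ' j - (1 / √(θ j)) • ψ j‖
      ≤ (8 / (g * √(θ j)) + 2 / (θ j * √(θ j))) * Δ := by
  have hj : |θ' j - θ j| ≤ Δ := by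
    rw [abs_le]
    constructor
    · linarith [eigenvalue_le_add hθ hθ0 hψ hθ' hθ0' hψ' (fun u v => (abs_le.1 (hΔ u v)).2) j]
    · linarith [eigenvalue_le_add hθ' hθ0' hψ' hθ hθ0 hψ
        (fun u v => by linarith [(abs_le.1 (hΔ u v)).1]) j]
  have hdk := gap_mul_norm_sub_le hθ hθ0 hψ hψ' hΔ hj hg hg'
  have hΔ0 : 0 ≤ Δ := (abs_nonneg _).trans hj
  have hθj : 0 < θ j := by linarith [hθ0 (j + 1)]
  have hθ'j : θ j / 2 ≤ θ' j := by linarith [(abs_le.1 hj).1]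
  set c : ℝ := inner ℝ (ψ j) (ψ' j) with hc
  have hcle : |c| ≤ 1 := by
    have := abs_real_inner_le_norm (ψ j) (ψ' j)
    rwa [hψ.1, hψ'.1, one_mul] at this
  have hvsq : ‖ψ' j - c • ψ j‖ ^ 2 = 1 - c ^ 2 := by
    rw [← real_inner_self_eq_norm_sq, inner_sub_left, inner_sub_right, inner_sub_right,
      real_inner_smul_left, inner_smul_right, real_inner_smul_left, inner_smul_right,
      real_inner_self_eq_norm_sq, real_inner_self_eq_norm_sq, hψ.1 j, hψ'.1 j,
      real_inner_comm, ← hc]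
    ring
  obtain ⟨s, hs, hsc⟩ : ∃ s : ℝ, (s = 1 ∨ s = -1) ∧ s * c = |c| := by
    rcases le_total 0 c with h | h
    · exact ⟨1, Or.inl rfl, by rw [abs_of_nonneg h, one_mul]⟩
    · exact ⟨-1, Or.inr rfl, by rw [abs_of_nonpos h]; ring⟩
  have hs2 : s * s = 1 := by rcases hs with rfl | rfl <;> norm_num
  refine ⟨s, hs, ?_⟩
  -- With the sign aligned, `2 - 2|c| ≤ 4(1 - c²)`, so passing from the projection residual to the
  -- difference costs a factor `2`.
  have hsub : ‖s • ψ' j - ψ j‖ ≤ 4 * Δ / g := by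
    have h1 : ‖s • ψ' j - ψ j‖ ^ 2 = 2 - 2 * |c| := by
      rw [← real_inner_self_eq_norm_sq, inner_sub_left, inner_sub_right, inner_sub_right,
        real_inner_smul_left, inner_smul_right, real_inner_smul_left, inner_smul_right,
        real_inner_self_eq_norm_sq, real_inner_self_eq_norm_sq, hψ.1 j, hψ'.1 j,
        real_inner_comm, ← hc, hsc]
      linear_combination hs2
    have h2 : ‖s • ψ' j - ψ j‖ ^ 2 ≤ (2 * ‖ψ' j - c • ψ j‖) ^ 2 := by
      rw [h1, mul_pow, hvsq]
      nlinarith [sq_abs c, abs_nonneg c]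
    have h3 : ‖s • ψ' j - ψ j‖ ≤ 2 * ‖ψ' j - c • ψ j‖ :=
      le_of_sq_le_sq h2 (by positivity)
    rw [le_div_iff₀ hg0]
    nlinarith
  set r := √(θ j) with hr
  set r' := √(θ' j) with hr'
  have hrpos : 0 < r := Real.sqrt_pos.2 hθj
  have hr2 : r ^ 2 = θ j := Real.sq_sqrt hθj.le
  have hr'pos : 0 < r' := Real.sqrt_pos.2 (by linarith)
  have hr'2 : r' ^ 2 = θ' j := Real.sq_sqrt (by linarith)
  have hrr' : r ≤ 2 * r' := le_of_sq_le_sq (by rw [mul_pow, hr2, hr'2]; linarith) (by positivity)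
  have hdecomp : (s / r') • ψ' j - (1 / r) • ψ j
      = (1 / r') • (s • ψ' j - ψ j) + (1 / r' - 1 / r) • ψ j := by
    rw [smul_sub, smul_smul, sub_smul]
    rw [one_div_mul_eq_div]
    abel
  rw [hdecomp]
  have hinv : 1 / r' ≤ 2 / r := by
    rw [div_le_div_iff₀ hr'pos hrpos]; linarith
  have hdiff : |1 / r' - 1 / r| ≤ 2 * Δ / (θ j * r) := by
    have h1 : 1 / r' - 1 / r = (θ j - θ' j) / (r * r' * (r + r')) := by
      rw [← hr2, ← hr'2]; field_simp; ring
    rw [h1, abs_div, abs_of_pos (by positivity : 0 < r * r' * (r + r')),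
      div_le_div_iff₀ (by positivity) (by positivity), abs_sub_comm]
    have h2 : θ j * r ≤ 2 * (r * r' * (r + r')) := by
      rw [← hr2]
      nlinarith [mul_pos hrpos hr'pos, mul_pos hrpos hrpos,
        mul_nonneg (mul_pos hrpos hrpos).le (sub_nonneg.2 hrr'), mul_pos hrpos (mul_pos hr'pos hr'pos)]
    calc |θ' j - θ j| * (θ j * r) ≤ Δ * (2 * (r * r' * (r + r'))) := by
          apply mul_le_mul hj h2 (by positivity) hΔ0
      _ = _ := by ring
  calc ‖(1 / r') • (s • ψ' j - ψ j) + (1 / r' - 1 / r) • ψ j‖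
      ≤ 1 / r' * ‖s • ψ' j - ψ j‖ + |1 / r' - 1 / r| := by
        refine (norm_add_le _ _).trans ?_
        rw [norm_smul, norm_smul, hψ.1 j, mul_one, Real.norm_of_nonneg (by positivity),
          Real.norm_eq_abs]
    _ ≤ 2 / r * (4 * Δ / g) + 2 * Δ / (θ j * r) := by
        gcongr
    _ = _ := by field_simp; ring

end Perturbation

end

section

/-! ### From kernels to quadratic forms -/

instance instIsFiniteMeasureLeb (a b : ℝ) : IsFiniteMeasure (leb a b) := by
  constructor
  rw [(MeasurableEmbedding.subtype_coe measurableSet_Icc).comap_apply, Set.image_univ,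
    Subtype.range_coe]
  exact measure_Icc_lt_top

lemma eLpNorm_two_sq {α : Type*} [MeasurableSpace α] {μ : Measure α} (f : α → ℝ) :
    eLpNorm f 2 μ ^ 2 = ∫⁻ x, ‖f x‖ₑ ^ 2 ∂μ := by
  simpa using eLpNorm_pow_eq_lintegral (μ := μ) f (two_ne_zero (α := ℕ))

lemma eLpNorm_two_prod_mul {S T : Type*} [MeasurableSpace S] [MeasurableSpace T]
    {μ : Measure S} {ν : Measure T} [SFinite ν] {f : S → ℝ} {g : T → ℝ}
    (hf : AEStronglyMeasurable f μ) (hg : AEStronglyMeasurable g ν) :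
    eLpNorm (fun p : S × T => f p.1 * g p.2) 2 (μ.prod ν) = eLpNorm f 2 μ * eLpNorm g 2 ν := by
  refine (ENNReal.pow_right_strictMono two_ne_zero).injective ?_
  show _ ^ 2 = _ ^ 2
  simp only [mul_pow, eLpNorm_two_sq, enorm_mul]
  exact lintegral_prod_mul (hf.enorm.pow_const 2) (hg.enorm.pow_const 2)

lemma enorm_integral_mul_le {S : Type*} [MeasurableSpace S] {μ : Measure S} {f g : S → ℝ}
    (hf : AEStronglyMeasurable f μ) (hg : AEStronglyMeasurable g μ) :
    ‖∫ x, f x * g x ∂μ‖ₑ ≤ eLpNorm f 2 μ * eLpNorm g 2 μ := by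
  refine (enorm_integral_le_lintegral_enorm _).trans ?_
  rw [← eLpNorm_one_eq_lintegral_enorm]
  have := eLpNorm_smul_le_mul_eLpNorm (p := 2) (q := 2) (r := 1) hg hf
  exact this

variable {a b : ℝ}

lemma integral_mul_eq_inner (u v : L2 a b) :
    ∫ t, u t * v t ∂(leb a b) = inner ℝ u v := by
  rw [L2.inner_def]
  exact integral_congr_ae (Eventually.of_forall fun t => by simp [mul_comm])

lemma memLp_prod_mul (u v : L2 a b) :
    MemLp (fun p : Set.Icc a b × Set.Icc a b => u p.1 * v p.2) 2 ((leb a b).prod (leb a b)) := by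
  refine ⟨(Lp.aestronglyMeasurable u).comp_fst.mul (Lp.aestronglyMeasurable v).comp_snd, ?_⟩
  rw [eLpNorm_two_prod_mul (Lp.aestronglyMeasurable u) (Lp.aestronglyMeasurable v)]
  exact ENNReal.mul_lt_top (Lp.eLpNorm_lt_top u) (Lp.eLpNorm_lt_top v)

lemma memLp_spectral_sum (θ : ℕ → ℝ) (ψ : ℕ → L2 a b) (m : ℕ) :
    MemLp (fun p : Set.Icc a b × Set.Icc a b => ∑ k ∈ Finset.range m, θ k * ψ k p.1 * ψ k p.2) 2
      ((leb a b).prod (leb a b)) := by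
  refine memLp_finsetSum _ fun k _ => ?_
  simp only [mul_assoc]
  exact (memLp_prod_mul (ψ k) (ψ k)).const_mul _

lemma integral_spectral_sum_mul (θ : ℕ → ℝ) (ψ : ℕ → L2 a b) (m : ℕ) (u v : L2 a b) :
    ∫ p : Set.Icc a b × Set.Icc a b,
      (∑ k ∈ Finset.range m, θ k * ψ k p.1 * ψ k p.2) * (u p.1 * v p.2)
        ∂((leb a b).prod (leb a b))
      = ∑ k ∈ Finset.range m, θ k * (inner ℝ (ψ k) u * inner ℝ (ψ k) v) := by
  simp only [Finset.sum_mul]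
  rw [integral_finsetSum]
  · refine Finset.sum_congr rfl fun k _ => ?_
    rw [← integral_mul_eq_inner, ← integral_mul_eq_inner, ← integral_prod_mul, ← integral_const_mul]
    congr 1 with p
    ring
  · intro k _
    refine ((memLp_prod_mul (ψ k) (ψ k)).const_mul (θ k)).integrable_mul (memLp_prod_mul u v)
      |>.congr (Eventually.of_forall fun p => ?_)
    simp [mul_assoc]

/-- The quadratic form of a kernel is given by its spectral expansion. -/
lemma IsSpectralExpansion.integral_eq {K : Set.Icc a b → Set.Icc a b → ℝ} {θ : ℕ → ℝ}
    {ψ : ℕ → L2 a b} (h : IsSpectralExpansion K θ ψ)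
    (hK : MemLp (fun p : Set.Icc a b × Set.Icc a b => K p.1 p.2) 2 ((leb a b).prod (leb a b)))
    (u v : L2 a b) :
    ∫ p : Set.Icc a b × Set.Icc a b, K p.1 p.2 * (u p.1 * v p.2) ∂((leb a b).prod (leb a b))
      = specForm θ ψ u v := by
  have h1 := (summable_specForm h.antitone h.nonneg h.orthonormal u v).hasSum.tendsto_sum_nat
  refine tendsto_nhds_unique ?_ h1
  rw [tendsto_iff_edist_tendsto_0]
  have hc : eLpNorm (fun p : Set.Icc a b × Set.Icc a b => u p.1 * v p.2) 2
      ((leb a b).prod (leb a b)) ≠ ⊤ := (memLp_prod_mul u v).2.ne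
  have h2 := ENNReal.Tendsto.mul_const h.expansion (Or.inr hc)
  rw [zero_mul] at h2
  refine tendsto_of_tendsto_of_tendsto_of_le_of_le tendsto_const_nhds h2 (fun _ => zero_le)
    fun m => ?_
  have hS := memLp_spectral_sum θ ψ m
  show edist _ _ ≤ _
  rw [edist_comm, edist_eq_enorm_sub, ← integral_spectral_sum_mul, ← integral_sub]
  · simp only [← sub_mul]
    exact enorm_integral_mul_le (hK.sub hS).1 (memLp_prod_mul u v).1
  · exact hK.integrable_mul (memLp_prod_mul u v)
  · exact hS.integrable_mul (memLp_prod_mul u v)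

/-- Cauchy–Schwarz on the square against `u ⊗ v`: the operator norm is at most the Hilbert–Schmidt
norm. -/
lemma specForm_sub_le {K K' : Set.Icc a b → Set.Icc a b → ℝ} {θ θ' : ℕ → ℝ} {ψ ψ' : ℕ → L2 a b}
    (h : IsSpectralExpansion K θ ψ) (h' : IsSpectralExpansion K' θ' ψ')
    (hK : MemLp (fun p : Set.Icc a b × Set.Icc a b => K p.1 p.2) 2 ((leb a b).prod (leb a b)))
    (hK' : MemLp (fun p : Set.Icc a b × Set.Icc a b => K' p.1 p.2) 2 ((leb a b).prod (leb a b)))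
    {Δ : ℝ} (hΔ0 : 0 ≤ Δ) (hΔ : eLpNorm (fun p : Set.Icc a b × Set.Icc a b => K p.1 p.2 - K' p.1 p.2) 2
      ((leb a b).prod (leb a b)) ≤ ENNReal.ofReal Δ) (u v : L2 a b) :
    |specForm θ ψ u v - specForm θ' ψ' u v| ≤ Δ * (‖u‖ * ‖v‖) := by
  have huv := memLp_prod_mul u v
  have i1 : Integrable (fun p : Set.Icc a b × Set.Icc a b => K p.1 p.2 * (u p.1 * v p.2))
    ((leb a b).prod (leb a b)) := hK.integrable_mul huv
  have i2 : Integrable (fun p : Set.Icc a b × Set.Icc a b => K' p.1 p.2 * (u p.1 * v p.2))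
    ((leb a b).prod (leb a b)) := hK'.integrable_mul huv
  rw [← h.integral_eq hK, ← h'.integral_eq hK', ← integral_sub i1 i2,
    ← Real.norm_eq_abs, ← ENNReal.ofReal_le_ofReal_iff (by positivity),
    ofReal_norm]
  simp only [← sub_mul]
  refine (enorm_integral_mul_le (hK.sub hK').1 huv.1).trans ?_
  rw [eLpNorm_two_prod_mul (Lp.aestronglyMeasurable u) (Lp.aestronglyMeasurable v),
    ENNReal.ofReal_mul hΔ0, ENNReal.ofReal_mul (norm_nonneg _), ofReal_norm, ofReal_norm,
    Lp.enorm_def, Lp.enorm_def]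
  gcongr
  exact hΔ

end

section

/-! ### Functionals of the sample paths -/

lemma enorm_sub_pow_le (x y : ℝ) (q : ℕ) : ‖x - y‖ₑ ^ q ≤ 2 ^ q * (‖x‖ₑ ^ q + ‖y‖ₑ ^ q) := by
  have h : ‖x - y‖ₑ ≤ 2 * max ‖x‖ₑ ‖y‖ₑ := by
    refine (enorm_sub_le).trans ?_
    rw [two_mul]
    exact add_le_add (le_max_left _ _) (le_max_right _ _)
  calc ‖x - y‖ₑ ^ q ≤ (2 * max ‖x‖ₑ ‖y‖ₑ) ^ q := by gcongr
    _ = 2 ^ q * (max ‖x‖ₑ ‖y‖ₑ) ^ q := mul_pow _ _ _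
    _ ≤ _ := by
      gcongr
      rcases le_total ‖x‖ₑ ‖y‖ₑ with h | h
      · rw [max_eq_right h]; exact le_add_self
      · rw [max_eq_left h]; exact le_self_add

variable {Ω : Type*} [MeasurableSpace Ω] {a b : ℝ}

/-- Independent identically distributed random functions with the moment and Hölder conditions. -/
structure IsSample (P : Measure Ω) (X : ℕ → Ω → Set.Icc a b → ℝ) : Prop where
  measurable_uncurry : ∀ i, Measurable (Function.uncurry (X i))
  indep : iIndepFun X P
  ident : ∀ i, IdentDistrib (X i) (X 0) P P
  momentHolder : MomentHolder P (X 0)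

lemma MomentHolder.exists_lintegral_pow_le {P : Measure Ω} [IsProbabilityMeasure P]
    {Y : Ω → Set.Icc a b → ℝ} (h : MomentHolder P Y) (q : ℕ) :
    ∃ M : ℝ≥0, ∀ t, ∫⁻ ω, ‖Y ω t‖ₑ ^ q ∂P ≤ M := by
  rcases Nat.eq_zero_or_pos q with rfl | hq
  · exact ⟨1, fun t => by simp⟩
  · obtain ⟨δ, -, h1, -⟩ := h q (by exact_mod_cast hq)
    refine ⟨(⨆ t : Set.Icc a b, ∫⁻ ω, ENNReal.ofReal (|Y ω t| ^ (q : ℝ)) ∂P).toNNReal,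
      fun t => ?_⟩
    rw [ENNReal.coe_toNNReal h1.ne]
    refine le_trans (le_of_eq (lintegral_congr fun ω => ?_))
      (le_iSup (fun t : Set.Icc a b => ∫⁻ ω, ENNReal.ofReal (|Y ω t| ^ (q : ℝ)) ∂P) t)
    rw [Real.rpow_natCast, ENNReal.ofReal_pow (abs_nonneg _), ← Real.norm_eq_abs, ofReal_norm]

/-- The case `C = 2`. Mean-square continuity justifies replacing a path by finitely many of its
values. -/
lemma MomentHolder.exists_lintegral_sub_le {P : Measure Ω}
    {Y : Ω → Set.Icc a b → ℝ} (h : MomentHolder P Y) :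
    ∃ (M : ℝ≥0) (δ : ℝ), 0 < δ ∧ ∀ s t : Set.Icc a b,
      ∫⁻ ω, ‖Y ω s - Y ω t‖ₑ ^ 2 ∂P ≤ M * ENNReal.ofReal (|(s : ℝ) - t| ^ δ) := by
  obtain ⟨δ, hδ, -, h2⟩ := h 2 two_pos
  refine ⟨(⨆ (s : Set.Icc a b) (t : Set.Icc a b) (_ : s ≠ t),
      ∫⁻ ω, ENNReal.ofReal (|(s : ℝ) - (t : ℝ)| ^ (-δ) * |Y ω s - Y ω t| ^ (2 : ℝ)) ∂P).toNNReal,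
    δ, hδ, fun s t => ?_⟩
  rw [ENNReal.coe_toNNReal h2.ne]
  rcases eq_or_ne s t with rfl | hst
  · simp
  · have h3 : ∫⁻ ω, ENNReal.ofReal (|(s : ℝ) - (t : ℝ)| ^ (-δ) * |Y ω s - Y ω t| ^ (2 : ℝ)) ∂P
        ≤ ⨆ (s : Set.Icc a b) (t : Set.Icc a b) (_ : s ≠ t),
          ∫⁻ ω, ENNReal.ofReal (|(s : ℝ) - (t : ℝ)| ^ (-δ) * |Y ω s - Y ω t| ^ (2 : ℝ)) ∂P :=
      le_iSup_of_le s (le_iSup_of_le t (le_iSup_of_le hst le_rfl))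
    have hpos : 0 < |(s : ℝ) - t| := abs_pos.2 (sub_ne_zero.2 fun h => hst (Subtype.ext h))
    refine le_trans (le_of_eq ?_) (mul_le_mul_left h3 _)
    rw [← lintegral_mul_const' _ _ ENNReal.ofReal_ne_top]
    refine lintegral_congr fun ω => ?_
    rw [← ENNReal.ofReal_mul (by positivity), mul_right_comm, ← Real.rpow_add hpos,
      neg_add_cancel, Real.rpow_zero, one_mul, Real.rpow_two, ENNReal.ofReal_pow (abs_nonneg _),
      ← Real.norm_eq_abs, ofReal_norm]

namespace IsSample

variable {P : Measure Ω} {X : ℕ → Ω → Set.Icc a b → ℝ}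

lemma measurable_apply (h : IsSample P X) (i : ℕ) (t : Set.Icc a b) :
    Measurable fun ω => X i ω t :=
  (h.measurable_uncurry i).comp measurable_prodMk_right

lemma measurable (h : IsSample P X) (i : ℕ) : Measurable (X i) :=
  measurable_pi_iff.2 fun t => h.measurable_apply i t

lemma measurable_path (h : IsSample P X) (i : ℕ) (ω : Ω) : Measurable (X i ω) :=
  (h.measurable_uncurry i).comp measurable_prodMk_left

lemma ident_apply (h : IsSample P X) (i : ℕ) (t : Set.Icc a b) :
    IdentDistrib (fun ω => X i ω t) (fun ω => X 0 ω t) P P :=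
  (h.ident i).comp (measurable_pi_apply t)

lemma lintegral_pow_eq (h : IsSample P X) (i q : ℕ) (t : Set.Icc a b) :
    ∫⁻ ω, ‖X i ω t‖ₑ ^ q ∂P = ∫⁻ ω, ‖X 0 ω t‖ₑ ^ q ∂P :=
  ((h.ident_apply i t).comp (measurable_id.enorm.pow_const q)).lintegral_eq

lemma measurable_meanFn [IsProbabilityMeasure P] (h : IsSample P X) :
    Measurable (meanFn P (X 0)) := by
  have : StronglyMeasurable fun p : Set.Icc a b × Ω => X 0 p.2 p.1 :=
    ((h.measurable_uncurry 0).comp measurable_swap).stronglyMeasurable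
  exact this.integral_prod_right.measurable

lemma exists_meanFn_le [IsProbabilityMeasure P] (h : IsSample P X) :
    ∃ M : ℝ≥0, ∀ t, ‖meanFn P (X 0) t‖ₑ ≤ M := by
  obtain ⟨M, hM⟩ := h.momentHolder.exists_lintegral_pow_le 1
  refine ⟨M, fun t => (enorm_integral_le_lintegral_enorm _).trans ?_⟩
  simpa using hM t

/-- Uniform moments of the centred process. -/
lemma exists_lintegral_sub_meanFn_pow_le [IsProbabilityMeasure P] (h : IsSample P X) (q : ℕ) :
    ∃ M : ℝ≥0, ∀ i t, ∫⁻ ω, ‖X i ω t - meanFn P (X 0) t‖ₑ ^ q ∂P ≤ M := by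
  obtain ⟨M, hM⟩ := h.momentHolder.exists_lintegral_pow_le q
  obtain ⟨M', hM'⟩ := h.exists_meanFn_le
  refine ⟨2 ^ q * (M + M' ^ q), fun i t => ?_⟩
  calc ∫⁻ ω, ‖X i ω t - meanFn P (X 0) t‖ₑ ^ q ∂P
      ≤ ∫⁻ ω, 2 ^ q * (‖X i ω t‖ₑ ^ q + ‖meanFn P (X 0) t‖ₑ ^ q) ∂P :=
        lintegral_mono fun ω => enorm_sub_pow_le _ _ _
    _ = 2 ^ q * (∫⁻ ω, ‖X i ω t‖ₑ ^ q ∂P + ‖meanFn P (X 0) t‖ₑ ^ q) := by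
        rw [lintegral_const_mul' _ _ (by simp), lintegral_add_right _ measurable_const]
        simp
    _ ≤ 2 ^ q * (M + M' ^ q) := by
        rw [h.lintegral_pow_eq]
        gcongr
        · exact hM t
        · exact hM' t
    _ = _ := by push_cast; rfl

lemma memLp_meanFn [IsProbabilityMeasure P] (h : IsSample P X) :
    MemLp (meanFn P (X 0)) 2 (leb a b) := by
  obtain ⟨M, hM⟩ := h.exists_meanFn_le
  refine MemLp.of_bound h.measurable_meanFn.aestronglyMeasurable M (Eventually.of_forall fun t => ?_)
  have := hM t
  rwa [← ofReal_norm, ENNReal.ofReal_le_iff_le_toReal ENNReal.coe_ne_top, ENNReal.coe_toReal] at this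

lemma measurable_uncurry_sub_meanFn [IsProbabilityMeasure P] (h : IsSample P X) (i : ℕ) :
    Measurable fun p : Ω × Set.Icc a b => X i p.1 p.2 - meanFn P (X 0) p.2 :=
  (h.measurable_uncurry i).sub (h.measurable_meanFn.comp measurable_snd)

lemma exists_lintegral_eLpNorm_pow_le [IsProbabilityMeasure P] (h : IsSample P X) (q : ℕ) :
    ∃ M : ℝ≥0, ∀ i,
      ∫⁻ ω, ∫⁻ t, ‖X i ω t - meanFn P (X 0) t‖ₑ ^ q ∂(leb a b) ∂P ≤ M := by
  obtain ⟨M, hM⟩ := h.exists_lintegral_sub_meanFn_pow_le q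
  refine ⟨(M * leb a b Set.univ).toNNReal, fun i => ?_⟩
  rw [ENNReal.coe_toNNReal (ENNReal.mul_ne_top ENNReal.coe_ne_top (measure_ne_top _ _)),
    lintegral_lintegral_swap ((h.measurable_uncurry_sub_meanFn i).enorm.pow_const q).aemeasurable]
  refine (lintegral_mono (fun t => hM i t)).trans ?_
  rw [lintegral_const]

lemma ae_memLp_sub_meanFn [IsProbabilityMeasure P] (h : IsSample P X) :
    ∀ᵐ ω ∂P, ∀ i, MemLp (fun t => X i ω t - meanFn P (X 0) t) 2 (leb a b) := by
  rw [ae_all_iff]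
  intro i
  obtain ⟨M, hM⟩ := h.exists_lintegral_eLpNorm_pow_le 2
  have hm : Measurable fun ω => ∫⁻ t, ‖X i ω t - meanFn P (X 0) t‖ₑ ^ 2 ∂(leb a b) :=
    Measurable.lintegral_prod_right'
      (f := fun p : Ω × Set.Icc a b => ‖X i p.1 p.2 - meanFn P (X 0) p.2‖ₑ ^ 2)
      ((h.measurable_uncurry_sub_meanFn i).enorm.pow_const 2)
  filter_upwards [ae_lt_top hm (ne_top_of_le_ne_top ENNReal.coe_ne_top (hM i))] with ω hω
  refine ⟨((h.measurable_path i ω).sub h.measurable_meanFn).aestronglyMeasurable, ?_⟩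
  rw [← eLpNorm_two_sq] at hω
  by_contra hcon
  rw [not_lt, top_le_iff] at hcon
  simp [hcon] at hω

lemma ae_memLp [IsProbabilityMeasure P] (h : IsSample P X) :
    ∀ᵐ ω ∂P, ∀ i, MemLp (X i ω) 2 (leb a b) := by
  filter_upwards [h.ae_memLp_sub_meanFn] with ω hω i
  have := (hω i).add h.memLp_meanFn
  convert this using 1
  ext t
  simp

end IsSample

lemma integral_comp_simpleFunc_mul {T : Type*} [MeasurableSpace T] {ν : Measure T}
    (π : SimpleFunc T T) (x : T → ℝ) {φ : T → ℝ} (hφ : Integrable φ ν) :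
    ∫ t, x (π t) * φ t ∂ν = ∑ y ∈ π.range, x y * ∫ t in π ⁻¹' {y}, φ t ∂ν := by
  classical
  have h1 : ∀ t, x (π t) * φ t = ∑ y ∈ π.range, (π ⁻¹' {y}).indicator (fun t => x y * φ t) t := by
    intro t
    rw [Finset.sum_eq_single (π t)]
    · simp
    · intro y _ hy
      exact Set.indicator_of_notMem (fun h => hy (by simpa using h.symm)) _
    · intro hy
      exact absurd (π.mem_range_self t) hy
  simp only [h1]
  rw [integral_finsetSum]
  · refine Finset.sum_congr rfl fun y _ => ?_
    rw [integral_indicator (π.measurableSet_fiber y), integral_const_mul]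
  · intro y _
    exact (hφ.const_mul _).indicator (π.measurableSet_fiber y)

/-- Although `x ↦ ∫ x φ` is not measurable for the product σ-algebra on the space of paths, it
agrees almost surely with a measurable functional along each `X i`. -/
theorem IsSample.exists_measurable_functional {P : Measure Ω} [IsProbabilityMeasure P]
    {X : ℕ → Ω → Set.Icc a b → ℝ} (h : IsSample P X) (hab : a ≤ b) (φ : L2 a b) :
    ∃ G : (Set.Icc a b → ℝ) → ℝ, Measurable G ∧
      ∀ i, ∀ᵐ ω ∂P, ∫ t, X i ω t * φ t ∂(leb a b) = G (X i ω) := by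
  have y0 : Set.Icc a b := ⟨a, le_rfl, hab⟩
  -- `π m` approximates the identity of `[a, b]` and takes finitely many values, so `∫ x(π m t) φ(t)
  -- dt` is a finite combination of evaluations of `x`, hence measurable for the product σ-algebra.
  set π : ℕ → SimpleFunc (Set.Icc a b) (Set.Icc a b) :=
    SimpleFunc.approxOn id measurable_id Set.univ y0 (Set.mem_univ _) with hπ
  have hπlim : ∀ t, Tendsto (fun m => π m t) atTop (𝓝 t) := fun t =>
    SimpleFunc.tendsto_approxOn measurable_id (Set.mem_univ y0) (by simp)
  obtain ⟨M, δ, hδ, hM⟩ := h.momentHolder.exists_lintegral_sub_le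
  have hφi : Integrable φ (leb a b) := (Lp.memLp φ).integrable (by norm_num)
  set e : ℕ → ℝ≥0∞ := fun m => ∫⁻ t, ∫⁻ ω, ‖X 0 ω t - X 0 ω (π m t)‖ₑ ^ 2 ∂P ∂(leb a b) with he
  have he0 : Tendsto e atTop (𝓝 0) := by
    have h1 : Tendsto (fun m => ∫⁻ t, M * ENNReal.ofReal (|(t : ℝ) - π m t| ^ δ) ∂(leb a b)) atTop
        (𝓝 (∫⁻ _, 0 ∂(leb a b))) := by
      refine tendsto_lintegral_of_dominated_convergence
        (fun _ => M * ENNReal.ofReal ((b - a) ^ δ)) (fun m => ?_) (fun m => ?_) ?_ ?_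
      · exact ((((measurable_subtype_coe.sub
          (measurable_subtype_coe.comp (π m).measurable)).abs).pow_const δ).ennreal_ofReal).const_mul _
      · refine Eventually.of_forall fun t => ?_
        show _ * _ ≤ _ * _
        gcongr
        rw [abs_le]
        have h1 := t.2.1
        have h2 := t.2.2
        have h3 := (π m t).2.1
        have h4 := (π m t).2.2
        constructor <;> linarith
      · rw [lintegral_const]
        exact ENNReal.mul_ne_top (ENNReal.mul_ne_top ENNReal.coe_ne_top ENNReal.ofReal_ne_top)
          (measure_ne_top _ _)
      · refine Eventually.of_forall fun t => ?_
        have h1 : Tendsto (fun m => ((π m t : Set.Icc a b) : ℝ)) atTop (𝓝 (t : ℝ)) :=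
          (continuous_subtype_val.tendsto t).comp (hπlim t)
        have h2 : Tendsto (fun m => |(t : ℝ) - π m t| ^ δ) atTop (𝓝 0) := by
          have h3 := ((tendsto_const_nhds (x := (t : ℝ))).sub h1).abs.rpow_const (p := δ)
            (Or.inr hδ.le)
          simpa [Real.zero_rpow hδ.ne'] using h3
        have h3 := ENNReal.Tendsto.const_mul (a := (M : ℝ≥0∞)) (ENNReal.tendsto_ofReal h2)
          (Or.inr ENNReal.coe_ne_top)
        simpa using h3
    rw [lintegral_zero] at h1
    exact tendsto_of_tendsto_of_tendsto_of_le_of_le tendsto_const_nhds h1 (fun _ => zero_le)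
      fun m => lintegral_mono fun t => hM t (π m t)
  have hev : ∀ r : ℕ, ∀ᶠ m in atTop, e m ≤ (2 : ℝ≥0∞)⁻¹ ^ r := fun r =>
    he0.eventually_le_const (ENNReal.pow_pos (by simp) r)
  -- Along this subsequence the mean-square errors are summable, which gives almost sure
  -- convergence. The limit functional is `limUnder`, measurable everywhere whatever its values off
  -- the convergence set.
  choose m hm using fun r => (hev r).exists
  set Gm : ℕ → (Set.Icc a b → ℝ) → ℝ := fun r x =>
    ∑ y ∈ (π (m r)).range, x y * ∫ t in (π (m r)) ⁻¹' {y}, φ t ∂(leb a b) with hGm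
  have hGmeas : ∀ r, Measurable (Gm r) := fun r =>
    Finset.measurable_sum _ fun y _ => (measurable_pi_apply y).mul_const _
  refine ⟨fun x => limUnder atTop fun r => Gm r x,
    (StronglyMeasurable.limUnder fun r => (hGmeas r).stronglyMeasurable).measurable, fun i => ?_⟩
  have hπmeas : ∀ r, Measurable fun p : Ω × Set.Icc a b => X i p.1 (π (m r) p.2) := fun r =>
    (h.measurable_uncurry i).comp
      (measurable_fst.prodMk ((π (m r)).measurable.comp measurable_snd))
  have hint_meas : Measurable fun ω => ∫ t, X i ω t * φ t ∂(leb a b) := by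
    have : StronglyMeasurable fun p : Ω × Set.Icc a b => X i p.1 p.2 * φ p.2 :=
      ((h.measurable_uncurry i).mul
        ((Lp.stronglyMeasurable φ).measurable.comp measurable_snd)).stronglyMeasurable
    exact this.integral_prod_right.measurable
  set F : ℕ → Ω → ℝ≥0∞ := fun r ω =>
    ‖(∫ t, X i ω t * φ t ∂(leb a b)) - Gm r (X i ω)‖ₑ ^ 2 with hF
  have hFmeas : ∀ r, AEMeasurable (F r) P := fun r =>
    ((hint_meas.sub ((hGmeas r).comp (h.measurable i))).enorm.pow_const 2).aemeasurable
  have hFle : ∀ r, ∫⁻ ω, F r ω ∂P ≤ (2 : ℝ≥0∞)⁻¹ ^ r * ‖φ‖ₑ ^ 2 := by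
    intro r
    have h1 : ∀ᵐ ω ∂P, F r ω
        ≤ (∫⁻ t, ‖X i ω t - X i ω (π (m r) t)‖ₑ ^ 2 ∂(leb a b)) * ‖φ‖ₑ ^ 2 := by
      filter_upwards [h.ae_memLp] with ω hω
      have hmem2 : MemLp (fun t => X i ω (π (m r) t)) 2 (leb a b) :=
        ((π (m r)).map (X i ω)).memLp_of_isFiniteMeasure 2 (leb a b)
      have h2 : (∫ t, X i ω t * φ t ∂(leb a b)) - Gm r (X i ω)
          = ∫ t, (X i ω t - X i ω (π (m r) t)) * φ t ∂(leb a b) := by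
        simp only [hGm]
        rw [← integral_comp_simpleFunc_mul _ _ hφi]
        have i1 : Integrable (fun t => X i ω t * φ t) (leb a b) :=
          (hω i).integrable_mul (Lp.memLp φ)
        have i2 : Integrable (fun t => X i ω (π (m r) t) * φ t) (leb a b) :=
          hmem2.integrable_mul (Lp.memLp φ)
        rw [← integral_sub i1 i2]
        simp only [sub_mul]
      rw [hF, ← eLpNorm_two_sq, Lp.enorm_def, ← mul_pow]
      simp only [h2]
      gcongr
      exact enorm_integral_mul_le ((hω i).sub hmem2).1 (Lp.aestronglyMeasurable φ)
    refine (lintegral_mono_ae h1).trans ?_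
    rw [lintegral_mul_const' _ _ (by simp), lintegral_lintegral_swap
      (((h.measurable_uncurry i).sub (hπmeas r)).enorm.pow_const 2).aemeasurable]
    gcongr
    refine le_trans (le_of_eq (lintegral_congr fun t => ?_)) (hm r)
    have hid : IdentDistrib (fun ω => ‖X i ω t - X i ω (π (m r) t)‖ₑ ^ 2)
        (fun ω => ‖X 0 ω t - X 0 ω (π (m r) t)‖ₑ ^ 2) P P :=
      (h.ident i).comp (u := fun x : Set.Icc a b → ℝ => ‖x t - x (π (m r) t)‖ₑ ^ 2)
        (((measurable_pi_apply t).sub (measurable_pi_apply (π (m r) t))).enorm.pow_const 2)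
    exact hid.lintegral_eq
  have hsum : ∑' r, ∫⁻ ω, F r ω ∂P ≠ ⊤ := by
    refine ne_top_of_le_ne_top ?_ (ENNReal.tsum_le_tsum hFle)
    rw [ENNReal.tsum_mul_right, ENNReal.tsum_geometric]
    refine ENNReal.mul_ne_top ?_ (by simp)
    simp
  filter_upwards [ae_tendsto_zero_of_tsum_lintegral_ne_top hFmeas hsum] with ω hω
  refine (Tendsto.limUnder_eq ?_).symm
  rw [tendsto_iff_edist_tendsto_0]
  have h1 : Tendsto (fun r => (F r ω) ^ (1 / 2 : ℝ)) atTop (𝓝 (0 ^ (1 / 2 : ℝ))) :=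
    (ENNReal.continuous_rpow_const.tendsto 0).comp hω
  rw [ENNReal.zero_rpow_of_pos (by norm_num)] at h1
  refine h1.congr fun r => ?_
  simp only [hF]
  rw [edist_comm, edist_eq_enorm_sub, ← ENNReal.rpow_natCast, ← ENNReal.rpow_mul]
  norm_num

end

section

/-! ### Rate of convergence of the sample covariance -/

variable {Ω : Type*} [MeasurableSpace Ω] {a b : ℝ}

lemma memLp_two_prod_mul {S T : Type*} [MeasurableSpace S] [MeasurableSpace T]
    {μ : Measure S} {ν : Measure T} [SFinite ν] {f : S → ℝ} {g : T → ℝ}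
    (hf : MemLp f 2 μ) (hg : MemLp g 2 ν) :
    MemLp (fun p : S × T => f p.1 * g p.2) 2 (μ.prod ν) := by
  refine ⟨hf.1.comp_fst.mul hg.1.comp_snd, ?_⟩
  rw [eLpNorm_two_prod_mul hf.1 hg.1]
  exact ENNReal.mul_lt_top hf.2 hg.2

lemma enorm_mul_pow_le (x y : ℝ) (q : ℕ) :
    ‖x * y‖ₑ ^ q ≤ ‖x‖ₑ ^ (2 * q) + ‖y‖ₑ ^ (2 * q) := by
  rw [enorm_mul]
  rcases le_total ‖x‖ₑ ‖y‖ₑ with h | h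
  · refine le_trans ?_ le_add_self
    rw [pow_mul]
    gcongr
    rw [sq]; gcongr
  · refine le_trans ?_ le_self_add
    rw [pow_mul]
    gcongr
    rw [sq]; gcongr

namespace IsSample

variable {P : Measure Ω} {X : ℕ → Ω → Set.Icc a b → ℝ}

lemma exists_lintegral_mul_pow_le [IsProbabilityMeasure P] (h : IsSample P X) (q : ℕ) :
    ∃ M : ℝ≥0, ∀ i s t, ∫⁻ ω, ‖(X i ω s - meanFn P (X 0) s) * (X i ω t - meanFn P (X 0) t)‖ₑ ^ q ∂P
      ≤ M := by
  obtain ⟨M, hM⟩ := h.exists_lintegral_sub_meanFn_pow_le (2 * q)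
  refine ⟨M + M, fun i s t => ?_⟩
  refine (lintegral_mono fun ω => enorm_mul_pow_le _ _ q).trans ?_
  rw [lintegral_add_left (((h.measurable_apply i s).sub_const _).enorm.pow_const _)]
  push_cast
  exact add_le_add (hM i s) (hM i t)

lemma measurable_covFn [IsProbabilityMeasure P] (h : IsSample P X) :
    Measurable fun p : Set.Icc a b × Set.Icc a b => covFn P (X 0) p.1 p.2 := by
  have hm := h.measurable_uncurry_sub_meanFn 0
  have : StronglyMeasurable fun q : (Set.Icc a b × Set.Icc a b) × Ω =>
      (X 0 q.2 q.1.1 - meanFn P (X 0) q.1.1) * (X 0 q.2 q.1.2 - meanFn P (X 0) q.1.2) :=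
    ((hm.comp (measurable_snd.prodMk (measurable_fst.comp measurable_fst))).mul
      (hm.comp (measurable_snd.prodMk (measurable_snd.comp measurable_fst)))).stronglyMeasurable
  exact this.integral_prod_right.measurable

lemma memLp_covFn [IsProbabilityMeasure P] (h : IsSample P X) :
    MemLp (fun p : Set.Icc a b × Set.Icc a b => covFn P (X 0) p.1 p.2) 2
      ((leb a b).prod (leb a b)) := by
  obtain ⟨M, hM⟩ := h.exists_lintegral_mul_pow_le 1
  refine MemLp.of_bound h.measurable_covFn.aestronglyMeasurable M
    (Eventually.of_forall fun p => ?_)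
  have h1 : ‖covFn P (X 0) p.1 p.2‖ₑ ≤ M := by
    refine (enorm_integral_le_lintegral_enorm _).trans ?_
    have h2 := hM 0 p.1 p.2
    simp only [pow_one] at h2
    exact h2
  rwa [← ofReal_norm, ENNReal.ofReal_le_iff_le_toReal ENNReal.coe_ne_top, ENNReal.coe_toReal] at h1

end IsSample

lemma memLp_sampleCov {α : Type*} {X : ℕ → α → Set.Icc a b → ℝ} {ω : α}
    (hω : ∀ i, MemLp (X i ω) 2 (leb a b)) (n : ℕ) :
    MemLp (fun p : Set.Icc a b × Set.Icc a b => sampleCov X n ω p.1 p.2) 2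
      ((leb a b).prod (leb a b)) := by
  have h1 : ∀ i, MemLp (fun t => X i ω t - sampleMean X n ω t) 2 (leb a b) := fun i =>
    (hω i).sub ((memLp_finsetSum (Finset.range n) fun i _ => hω i).const_mul _)
  exact (memLp_finsetSum (Finset.range n)
    fun i _ => memLp_two_prod_mul (h1 i) (h1 i)).const_mul _

/-- Recentring at any `m` costs one product of averages. With `m` the true mean both factors are
small and the leading term is an average of independent variables. -/
lemma sampleCov_eq {α : Type*} {X : ℕ → α → Set.Icc a b → ℝ} {n : ℕ} (hn : 1 ≤ n) (ω : α)
    (m : Set.Icc a b → ℝ) (s t : Set.Icc a b) :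
    sampleCov X n ω s t = (1 / (n : ℝ)) * ∑ i ∈ Finset.range n, (X i ω s - m s) * (X i ω t - m t)
      - ((1 / (n : ℝ)) * ∑ i ∈ Finset.range n, (X i ω s - m s))
        * ((1 / (n : ℝ)) * ∑ i ∈ Finset.range n, (X i ω t - m t)) := by
  have hn0 : (n : ℝ) ≠ 0 := by positivity
  set A : Set.Icc a b → ℝ := fun t => (1 / (n : ℝ)) * ∑ i ∈ Finset.range n, (X i ω t - m t) with hA
  have hmean : ∀ t, sampleMean X n ω t = A t + m t := fun t => by
    simp only [hA, sampleMean, Finset.sum_sub_distrib, Finset.sum_const, Finset.card_range,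
      nsmul_eq_mul]
    field_simp
    ring
  have hsum : ∀ t, ∑ i ∈ Finset.range n, (X i ω t - m t) = n * A t := fun t => by
    simp only [hA]; field_simp
  have h1 : ∀ i, (X i ω s - sampleMean X n ω s) * (X i ω t - sampleMean X n ω t)
      = (X i ω s - m s) * (X i ω t - m t) - A s * (X i ω t - m t) - A t * (X i ω s - m s)
        + A s * A t := fun i => by rw [hmean, hmean]; ring
  show (1 / (n : ℝ)) * _ = _ - A s * A t
  rw [Finset.sum_congr rfl fun i _ => h1 i, Finset.sum_add_distrib, Finset.sum_sub_distrib,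
    Finset.sum_sub_distrib, ← Finset.mul_sum, ← Finset.mul_sum, hsum, hsum, Finset.sum_const,
    Finset.card_range, nsmul_eq_mul]
  field_simp
  ring

namespace IsSample

variable {P : Measure Ω} {X : ℕ → Ω → Set.Icc a b → ℝ}

/-- The sample covariance converges in `L²` at rate `n ^ (-1/2 + ε)`. -/
theorem ae_eventually_eLpNorm_covFn_sub_le [IsProbabilityMeasure P] (h : IsSample P X) {ε : ℝ}
    (hε : 0 < ε) (hε' : ε ≤ 1 / 2) :
    ∀ᵐ ω ∂P, ∀ᶠ n : ℕ in atTop,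
      eLpNorm (fun p : Set.Icc a b × Set.Icc a b =>
        covFn P (X 0) p.1 p.2 - sampleCov X n ω p.1 p.2) 2 ((leb a b).prod (leb a b))
        ≤ ENNReal.ofReal (2 * (n : ℝ) ^ (-(1 / 2) + ε : ℝ)) := by
  set μ := meanFn P (X 0) with hμ
  have hm := h.measurable_uncurry_sub_meanFn
  have hA := ae_eventually_eLpNorm_average_sub_le (ν := (leb a b).prod (leb a b)) (ι := Unit)
    h.measurable h.indep h.ident
    (g := fun _ _ p x => (x p.1 - μ p.1) * (x p.2 - μ p.2))
    (fun _ _ p => ((measurable_pi_apply p.1).sub_const _).mul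
      ((measurable_pi_apply p.2).sub_const _))
    (fun _ _ i => ((hm i).comp (measurable_fst.prodMk (measurable_fst.comp measurable_snd))).mul
      ((hm i).comp (measurable_fst.prodMk (measurable_snd.comp measurable_snd))))
    (fun q => by
      obtain ⟨M, hM⟩ := h.exists_lintegral_mul_pow_le q
      exact ⟨M, fun _ _ p => hM 0 p.1 p.2⟩)
    (G := fun _ => {()}) (fun n => by simp) hε
  have hB := ae_eventually_eLpNorm_average_sub_le (ν := leb a b) (ι := Unit)
    h.measurable h.indep h.ident
    (g := fun _ _ t x => x t - μ t)
    (fun _ _ t => (measurable_pi_apply t).sub_const _)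
    (fun _ _ i => hm i)
    (fun q => by
      obtain ⟨M, hM⟩ := h.exists_lintegral_sub_meanFn_pow_le q
      exact ⟨M, fun _ _ t => hM 0 t⟩)
    (G := fun _ => {()}) (fun n => by simp) hε
  obtain ⟨M1, hM1⟩ := h.momentHolder.exists_lintegral_pow_le 1
  have hzero : ∀ t, ∫ ω, (X 0 ω t - μ t) ∂P = 0 := fun t => by
    rw [integral_sub]
    · simp [hμ, meanFn]
    · have := memLp_of_lintegral_pow_le (h.measurable_apply 0 t).aestronglyMeasurable (hM1 t)
      exact this.integrable (by simp)
    · exact integrable_const _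
  filter_upwards [hA, hB, h.ae_memLp_sub_meanFn] with ω hAω hBω hω
  filter_upwards [hAω, hBω, eventually_ge_atTop 1] with n hAn hBn hn
  have hAn := hAn () (by simp)
  have hBn := hBn () (by simp)
  simp only [hzero, sub_zero] at hBn
  set r : ℝ := (n : ℝ) ^ (-(1 / 2) + ε : ℝ) with hr
  have hn1 : (1 : ℝ) ≤ n := by exact_mod_cast hn
  have hr0 : 0 ≤ r := by positivity
  have hr1 : r ≤ 1 := Real.rpow_le_one_of_one_le_of_nonpos hn1 (by linarith)
  set A : Set.Icc a b → ℝ := fun t => (1 / (n : ℝ)) * ∑ i ∈ Finset.range n, (X i ω t - μ t) with hAdef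
  have hAmem : MemLp A 2 (leb a b) :=
    (memLp_finsetSum (Finset.range n) fun i _ => hω i).const_mul _
  have hSmem : MemLp (fun p : Set.Icc a b × Set.Icc a b => (1 / (n : ℝ)) * ∑ i ∈ Finset.range n,
      (X i ω p.1 - μ p.1) * (X i ω p.2 - μ p.2)) 2 ((leb a b).prod (leb a b)) :=
    (memLp_finsetSum (Finset.range n)
      fun i _ => memLp_two_prod_mul (hω i) (hω i)).const_mul _
  have hdecomp : (fun p : Set.Icc a b × Set.Icc a b =>
      covFn P (X 0) p.1 p.2 - sampleCov X n ω p.1 p.2)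
      = (fun p : Set.Icc a b × Set.Icc a b => A p.1 * A p.2)
        - fun p : Set.Icc a b × Set.Icc a b => (1 / (n : ℝ)) * ∑ i ∈ Finset.range n,
          (X i ω p.1 - μ p.1) * (X i ω p.2 - μ p.2)
          - ∫ ω', (X 0 ω' p.1 - μ p.1) * (X 0 ω' p.2 - μ p.2) ∂P := by
    ext p
    rw [sampleCov_eq hn ω μ]
    simp only [Pi.sub_apply, hAdef, covFn, covariance, hμ, meanFn]
    ring
  rw [hdecomp]
  refine (eLpNorm_sub_le (memLp_two_prod_mul hAmem hAmem).1 (hSmem.sub h.memLp_covFn).1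
    (by norm_num)).trans ?_
  rw [eLpNorm_two_prod_mul hAmem.1 hAmem.1, two_mul, ENNReal.ofReal_add hr0 hr0]
  -- The mean correction has norm at most `r * r ≤ r`, using `r ≤ 1`; this is the second `r` in the
  -- factor `2`.
  refine add_le_add ?_ hAn
  calc eLpNorm A 2 (leb a b) * eLpNorm A 2 (leb a b)
      ≤ ENNReal.ofReal r * 1 := mul_le_mul' hBn (hBn.trans (by simpa using hr1))
    _ = ENNReal.ofReal r := mul_one _

end IsSample

end

section

/-! ### Conditional means given a principal component score -/

variable {Ω : Type*} [MeasurableSpace Ω] {a b : ℝ}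

namespace IsSample

variable {P : Measure Ω} {X : ℕ → Ω → Set.Icc a b → ℝ}

lemma memLp_prod_sub_meanFn [IsProbabilityMeasure P] (h : IsSample P X) (i : ℕ) :
    MemLp (fun p : Ω × Set.Icc a b => X i p.1 p.2 - meanFn P (X 0) p.2) 2 (P.prod (leb a b)) := by
  obtain ⟨M, hM⟩ := h.exists_lintegral_eLpNorm_pow_le 2
  have hm := h.measurable_uncurry_sub_meanFn i
  refine memLp_of_lintegral_pow_le (q := 2) (M := M) hm.aestronglyMeasurable ?_
  rw [lintegral_prod _ (hm.enorm.pow_const 2).aemeasurable]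
  exact hM i

/-- Fubini for `E (ζ ∫ (X - E X) φ)`. -/
lemma integral_mul_centredCoeff [IsProbabilityMeasure P] (h : IsSample P X) {ζ : Ω → ℝ}
    (hζ : MemLp ζ 2 P) (φ : L2 a b) :
    ∫ ω, ζ ω * centredCoeff P (X 0) φ ω ∂P
      = ∫ t, (∫ ω, ζ ω * (X 0 ω t - meanFn P (X 0) t) ∂P) * φ t ∂(leb a b) := by
  have hint : Integrable (fun p : Ω × Set.Icc a b =>
      (ζ p.1 * φ p.2) * (X 0 p.1 p.2 - meanFn P (X 0) p.2)) (P.prod (leb a b)) :=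
    (memLp_two_prod_mul hζ (Lp.memLp φ)).integrable_mul (h.memLp_prod_sub_meanFn 0)
  calc ∫ ω, ζ ω * centredCoeff P (X 0) φ ω ∂P
      = ∫ ω, ∫ t, (ζ ω * φ t) * (X 0 ω t - meanFn P (X 0) t) ∂(leb a b) ∂P := by
        refine integral_congr_ae (Eventually.of_forall fun ω => ?_)
        simp only [centredCoeff]
        rw [← integral_const_mul]
        exact integral_congr_ae (Eventually.of_forall fun t => by ring)
    _ = ∫ t, ∫ ω, (ζ ω * φ t) * (X 0 ω t - meanFn P (X 0) t) ∂P ∂(leb a b) :=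
        integral_integral_swap hint
    _ = _ := by
        refine integral_congr_ae (Eventually.of_forall fun t => ?_)
        simp only
        rw [← integral_mul_const]
        exact integral_congr_ae (Eventually.of_forall fun t => by ring)

lemma measurable_centredCoeff [IsProbabilityMeasure P] (h : IsSample P X) (φ : L2 a b) :
    Measurable (centredCoeff P (X 0) φ) := by
  have : StronglyMeasurable fun p : Ω × Set.Icc a b =>
      (X 0 p.1 p.2 - meanFn P (X 0) p.2) * φ p.2 :=
    ((h.measurable_uncurry_sub_meanFn 0).mul
      ((Lp.stronglyMeasurable φ).measurable.comp measurable_snd)).stronglyMeasurable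
  exact this.integral_prod_right.measurable

lemma memLp_centredCoeff [IsProbabilityMeasure P] (h : IsSample P X) (φ : L2 a b) :
    MemLp (centredCoeff P (X 0) φ) 2 P := by
  obtain ⟨M, hM⟩ := h.exists_lintegral_eLpNorm_pow_le 2
  refine memLp_of_lintegral_pow_le (q := 2) (M := M * ‖φ‖₊ ^ 2)
    (h.measurable_centredCoeff φ).aestronglyMeasurable ?_
  have h1 : ∀ᵐ ω ∂P, ‖centredCoeff P (X 0) φ ω‖ₑ ^ 2
      ≤ (∫⁻ t, ‖X 0 ω t - meanFn P (X 0) t‖ₑ ^ 2 ∂(leb a b)) * ‖φ‖ₑ ^ 2 := by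
    filter_upwards [h.ae_memLp_sub_meanFn] with ω hω
    rw [← eLpNorm_two_sq, Lp.enorm_def, ← mul_pow]
    gcongr
    exact enorm_integral_mul_le (hω 0).1 (Lp.aestronglyMeasurable φ)
  refine (lintegral_mono_ae h1).trans ?_
  rw [lintegral_mul_const' _ _ (by simp)]
  push_cast
  gcongr
  · exact hM 0
  · exact le_rfl

lemma integral_centredCoeff_sq [IsProbabilityMeasure P] (h : IsSample P X)
    {θ : ℕ → ℝ} {ψ : ℕ → L2 a b} (hspec : IsSpectralExpansion (covFn P (X 0)) θ ψ) (φ : L2 a b) :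
    ∫ ω, centredCoeff P (X 0) φ ω ^ 2 ∂P = specForm θ ψ φ φ := by
  obtain ⟨M, hM⟩ := h.exists_lintegral_sub_meanFn_pow_le 2
  have hY : ∀ t, MemLp (fun ω => X 0 ω t - meanFn P (X 0) t) 2 P := fun t =>
    memLp_of_lintegral_pow_le (q := 2) ((h.measurable_apply 0 t).sub_const _).aestronglyMeasurable
      (hM 0 t)
  have hK := h.memLp_covFn
  have hKint : Integrable (fun p : Set.Icc a b × Set.Icc a b =>
      covFn P (X 0) p.1 p.2 * (φ p.1 * φ p.2)) ((leb a b).prod (leb a b)) :=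
    hK.integrable_mul (memLp_prod_mul φ φ)
  rw [← hspec.integral_eq hK, integral_prod_symm _ hKint]
  simp only [sq]
  rw [h.integral_mul_centredCoeff (h.memLp_centredCoeff φ) φ]
  refine integral_congr_ae (Eventually.of_forall fun t => ?_)
  simp only
  have h1 : ∫ ω, centredCoeff P (X 0) φ ω * (X 0 ω t - meanFn P (X 0) t) ∂P
      = ∫ s, covFn P (X 0) s t * φ s ∂(leb a b) := by
    simp only [mul_comm (centredCoeff P (X 0) φ _)]
    rw [h.integral_mul_centredCoeff (hY t) φ]
    refine integral_congr_ae (Eventually.of_forall fun s => ?_)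
    simp only [covFn, covariance, meanFn]
    congr 1
    exact integral_congr_ae (Eventually.of_forall fun ω => mul_comm _ _)
  rw [h1, ← integral_mul_const]
  exact integral_congr_ae (Eventually.of_forall fun s => by ring)

lemma integral_sub_meanFn [IsProbabilityMeasure P] (h : IsSample P X) (t : Set.Icc a b) :
    ∫ ω, (X 0 ω t - meanFn P (X 0) t) ∂P = 0 := by
  obtain ⟨M1, hM1⟩ := h.momentHolder.exists_lintegral_pow_le 1
  rw [integral_sub]
  · simp [meanFn]
  · have := memLp_of_lintegral_pow_le (h.measurable_apply 0 t).aestronglyMeasurable (hM1 t)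
    exact this.integrable (by simp)
  · exact integrable_const _

lemma integral_centredCoeff [IsProbabilityMeasure P] (h : IsSample P X) (φ : L2 a b) :
    ∫ ω, centredCoeff P (X 0) φ ω ∂P = 0 := by
  have := h.integral_mul_centredCoeff (ζ := fun _ => 1) (memLp_const 1) φ
  simp only [one_mul] at this
  rw [this]
  simp [h.integral_sub_meanFn]

/-- The form at `φ` is the variance of this centred coefficient. Directions of zero form therefore
carry nothing, which makes completeness of `(ψₖ)` unnecessary. -/
lemma ae_centredCoeff_eq_zero [IsProbabilityMeasure P] (h : IsSample P X)
    {θ : ℕ → ℝ} {ψ : ℕ → L2 a b} (hspec : IsSpectralExpansion (covFn P (X 0)) θ ψ) {φ : L2 a b}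
    (hφ : specForm θ ψ φ φ = 0) : ∀ᵐ ω ∂P, centredCoeff P (X 0) φ ω = 0 := by
  rw [← h.integral_centredCoeff_sq hspec, integral_eq_zero_iff_of_nonneg
    (fun ω => sq_nonneg _) (h.memLp_centredCoeff φ).integrable_sq] at hφ
  filter_upwards [hφ] with ω hω
  simpa using hω

/-- If the scores are independent, `E {g(ξⱼ) (X - E X)}` is a multiple of `ψⱼ`. -/
theorem eLpNorm_integral_mul_sub_meanFn_eq [IsProbabilityMeasure P] (h : IsSample P X)
    {θ : ℕ → ℝ} {ψ : ℕ → L2 a b} (hspec : IsSpectralExpansion (covFn P (X 0)) θ ψ)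
    (hscores : iIndepFun (score P (X 0) θ ψ) P) {j : ℕ} (hj : 0 < θ j) {g : ℝ → ℝ}
    (hg : Measurable g) {B : ℝ} (hB : ∀ u, |g u| ≤ B) :
    eLpNorm (fun t => ∫ ω, g (score P (X 0) θ ψ j ω) * (X 0 ω t - meanFn P (X 0) t) ∂P) 2 (leb a b)
      = ENNReal.ofReal (√(θ j) *
        |∫ ω, g (score P (X 0) θ ψ j ω) * score P (X 0) θ ψ j ω ∂P|) := by
  set ζ : Ω → ℝ := fun ω => g (score P (X 0) θ ψ j ω) with hζdef
  have hsmeas : ∀ k, Measurable (score P (X 0) θ ψ k) := fun k =>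
    (h.measurable_centredCoeff (ψ k)).div_const _
  have hζmeas : Measurable ζ := hg.comp (hsmeas j)
  have hζ : MemLp ζ 2 P := MemLp.of_bound hζmeas.aestronglyMeasurable B
    (Eventually.of_forall fun ω => hB _)
  set v : Set.Icc a b → ℝ := fun t => ∫ ω, ζ ω * (X 0 ω t - meanFn P (X 0) t) ∂P with hv
  have hvmem : MemLp v 2 (leb a b) := by
    obtain ⟨M, hM⟩ := h.exists_lintegral_sub_meanFn_pow_le 1
    have hsm : StronglyMeasurable fun p : Set.Icc a b × Ω =>
        ζ p.2 * (X 0 p.2 p.1 - meanFn P (X 0) p.1) :=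
      ((hζmeas.comp measurable_snd).mul
        ((h.measurable_uncurry_sub_meanFn 0).comp measurable_swap)).stronglyMeasurable
    refine MemLp.of_bound hsm.integral_prod_right.measurable.aestronglyMeasurable
      (|B| * M) (Eventually.of_forall fun t => ?_)
    have h1 : ‖v t‖ₑ ≤ ENNReal.ofReal (|B| * M) := by
      refine (enorm_integral_le_lintegral_enorm _).trans ?_
      calc ∫⁻ ω, ‖ζ ω * (X 0 ω t - meanFn P (X 0) t)‖ₑ ∂P
          ≤ ∫⁻ ω, ENNReal.ofReal |B| * ‖X 0 ω t - meanFn P (X 0) t‖ₑ ∂P := by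
            refine lintegral_mono fun ω => ?_
            rw [enorm_mul, ← ofReal_norm (ζ ω)]
            gcongr
            exact (hB _).trans (le_abs_self B)
        _ = ENNReal.ofReal |B| * ∫⁻ ω, ‖X 0 ω t - meanFn P (X 0) t‖ₑ ∂P :=
            lintegral_const_mul' _ _ ENNReal.ofReal_ne_top
        _ ≤ _ := by
            rw [ENNReal.ofReal_mul (abs_nonneg B), ENNReal.ofReal_coe_nnreal]
            gcongr
            simpa using hM 0 t
    rwa [← ofReal_norm, ENNReal.ofReal_le_ofReal_iff (by positivity)] at h1
  -- By Fubini, pairing `V` with `φ` gives the mean of `ζ` times the coefficient of `X - EX` along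
  -- `φ`.
  set V : L2 a b := hvmem.toLp v with hV
  have hinner : ∀ φ : L2 a b, inner ℝ V φ = ∫ ω, ζ ω * centredCoeff P (X 0) φ ω ∂P := by
    intro φ
    rw [h.integral_mul_centredCoeff hζ, ← integral_mul_eq_inner]
    refine integral_congr_ae ?_
    filter_upwards [hvmem.coeFn_toLp] with t ht
    rw [hV, ht]
  have hzero : ∀ φ : L2 a b, specForm θ ψ φ φ = 0 → inner ℝ V φ = 0 := by
    intro φ hφ
    rw [hinner]
    refine integral_eq_zero_of_ae ?_
    filter_upwards [h.ae_centredCoeff_eq_zero hspec hφ] with ω hω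
    simp [hω]
  have hsc : ∀ k, 0 < θ k → ∀ ω, centredCoeff P (X 0) (ψ k) ω
      = √(θ k) * score P (X 0) θ ψ k ω := fun k hk ω => by
    have : √(θ k) ≠ 0 := (Real.sqrt_pos.2 hk).ne'
    simp only [score]
    field_simp
  have hinner' : ∀ k, 0 < θ k →
      inner ℝ V (ψ k) = √(θ k) * ∫ ω, ζ ω * score P (X 0) θ ψ k ω ∂P := fun k hk => by
    rw [hinner, ← integral_const_mul]
    refine integral_congr_ae (Eventually.of_forall fun ω => ?_)
    simp only [hsc k hk]
    ring
  -- If `θ k = 0` the coefficient vanishes almost surely; otherwise independence factors the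
  -- expectation and the `k`th score is centred.
  have hk : ∀ k, k ≠ j → inner ℝ V (ψ k) = 0 := by
    intro k hkj
    rcases eq_or_lt_of_le (hspec.nonneg k) with h0 | h0
    · exact hzero _ (by rw [specForm_eigenvector hspec.orthonormal, ← h0, zero_mul])
    · have hind : IndepFun ζ (score P (X 0) θ ψ k) P :=
        (hscores.indepFun hkj.symm).comp hg measurable_id
      have h1 := h.integral_centredCoeff (ψ k)
      simp only [hsc k h0, integral_const_mul] at h1
      have h2 : ∫ ω, score P (X 0) θ ψ k ω ∂P = 0 :=
        (mul_eq_zero.1 h1).resolve_left (Real.sqrt_pos.2 h0).ne'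
      rw [hinner' k h0, hind.integral_fun_mul_eq_mul_integral hζmeas.aestronglyMeasurable
        (hsmeas k).aestronglyMeasurable, h2]
      simp
  set c : ℝ := inner ℝ V (ψ j) with hc
  have horth : ∀ k, inner ℝ (ψ k) (V - c • ψ j) = 0 := by
    intro k
    rw [inner_sub_right, inner_smul_right, real_inner_comm]
    rcases eq_or_ne k j with rfl | hkj
    · rw [real_inner_self_eq_norm_sq, hspec.orthonormal.1 k, ← hc]; ring
    · rw [hk k hkj, hspec.orthonormal.2 hkj]; ring
  -- `V - c • ψ j` is orthogonal to every `ψ k`, so its form is zero and `V` is orthogonal to it.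
  -- This is what identifies `V` with `c • ψ j` in norm.
  have hV2 : ‖V‖ ^ 2 = c ^ 2 := by
    have h1 := hzero (V - c • ψ j) (by simp [specForm, horth])
    rw [inner_sub_right, inner_smul_right, real_inner_self_eq_norm_sq, ← hc] at h1
    linarith
  have hVn : ‖V‖ = |c| := by
    rw [← sq_eq_sq₀ (norm_nonneg _) (abs_nonneg _), hV2, sq_abs]
  have hnorm : eLpNorm v 2 (leb a b) = ENNReal.ofReal ‖V‖ := by
    rw [hV, ofReal_norm, Lp.enorm_toLp]
  rw [hnorm, hVn, hc, hinner' j hj, abs_mul, abs_of_nonneg (Real.sqrt_nonneg _)]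

end IsSample

/-! ### Integrals of the derivative of a kernel against a density -/

section Kernel

variable {W : ℝ → ℝ}

lemma IsKernel.exists_support (hW : IsKernel W) :
    ∃ K : ℝ, 0 < K ∧ (∀ u, K ≤ |u| → W u = 0) ∧ ∀ u, K ≤ |u| → deriv W u = 0 := by
  obtain ⟨K, hK⟩ := hW.compactSupport.isCompact.isBounded.subset_ball 0
  have key : ∀ u, max K 1 ≤ |u| → u ∉ tsupport W := fun u hu hmem => by
    have := hK hmem
    rw [mem_ball_zero_iff, Real.norm_eq_abs] at this
    exact absurd ((le_max_left K 1).trans hu) (not_le.2 this)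
  refine ⟨max K 1, by positivity, fun u hu => image_eq_zero_of_notMem_tsupport (key u hu),
    fun u hu => ?_⟩
  exact Function.notMem_support.1 fun hs => key u hu (support_deriv_subset hs)

/-- The derivative of a symmetric kernel annihilates constants. -/
lemma IsKernel.abs_integral_deriv_mul_le (hW : IsKernel W) {K B : ℝ} (hK : 0 < K)
    (hKW : ∀ u, K ≤ |u| → deriv W u = 0) (hB : ∀ u, |deriv W u| ≤ B) {φ : ℝ → ℝ}
    (hφ : Continuous φ) {h z Λ : ℝ} (hh : 0 < h) (hΛ : ∀ u, |u - z| ≤ K * h → |φ u - φ z| ≤ Λ) :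
    |∫ u, deriv W ((u - z) / h) * φ u| ≤ B * Λ * (2 * K * h) := by
  have hle : z - K * h ≤ z + K * h := by nlinarith
  have hcont : Continuous (deriv W) := hW.differentiable_deriv.continuous
  have hcont2 : Continuous fun u => deriv W ((u - z) / h) := by fun_prop
  have hB0 : 0 ≤ B := (abs_nonneg _).trans (hB 0)
  have h1 : ∫ u, deriv W ((u - z) / h) * φ u
      = ∫ u in (z - K * h)..(z + K * h), deriv W ((u - z) / h) * φ u := by
    rw [intervalIntegral.integral_of_le hle, ← integral_Icc_eq_integral_Ioc]
    refine (setIntegral_eq_integral_of_forall_compl_eq_zero fun u hu => ?_).symm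
    rw [hKW, zero_mul]
    rw [abs_div, abs_of_pos hh, le_div_iff₀ hh]
    by_contra hcon
    rw [not_le, abs_lt] at hcon
    exact hu ⟨by linarith, by linarith⟩
  -- Evenness makes the two boundary values of the primitive `h * W((u - z) / h)` equal, so `φ z`
  -- can be subtracted from `φ u` at no cost.
  have h2 : ∫ u in (z - K * h)..(z + K * h), deriv W ((u - z) / h) = 0 := by
    have hd : ∀ u ∈ Set.uIcc (z - K * h) (z + K * h),
        HasDerivAt (fun u => h * W ((u - z) / h)) (deriv W ((u - z) / h)) u := by
      intro u _
      have h3 : HasDerivAt (fun u => (u - z) / h) (1 / h) u :=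
        ((hasDerivAt_id u).sub_const z).div_const h
      have h4 := ((hW.differentiable ((u - z) / h)).hasDerivAt.comp u h3).const_mul h
      have h5 : h * (deriv W ((u - z) / h) * (1 / h)) = deriv W ((u - z) / h) := by field_simp
      rwa [h5] at h4
    rw [intervalIntegral.integral_eq_sub_of_hasDerivAt hd (hcont2.intervalIntegrable _ _)]
    have e1 : (z + K * h - z) / h = K := by field_simp; ring
    have e2 : (z - K * h - z) / h = -K := by field_simp; ring
    rw [e1, e2, hW.symm, sub_self]
  have h3 : ∫ u in (z - K * h)..(z + K * h), deriv W ((u - z) / h) * φ u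
      = ∫ u in (z - K * h)..(z + K * h), deriv W ((u - z) / h) * (φ u - φ z) := by
    have i1 : IntervalIntegrable (fun u => deriv W ((u - z) / h) * φ u) volume
        (z - K * h) (z + K * h) := (hcont2.mul hφ).intervalIntegrable _ _
    have i2 : IntervalIntegrable (fun u => deriv W ((u - z) / h) * φ z) volume
        (z - K * h) (z + K * h) := (hcont2.mul continuous_const).intervalIntegrable _ _
    simp only [mul_sub]
    rw [intervalIntegral.integral_sub i1 i2, intervalIntegral.integral_mul_const, h2]
    ring
  rw [h1, h3, ← Real.norm_eq_abs]
  refine (intervalIntegral.norm_integral_le_of_norm_le_const (C := B * Λ) fun u hu => ?_).trans ?_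
  · rw [Set.uIoc_of_le hle] at hu
    rw [norm_mul]
    refine mul_le_mul (hB _) (hΛ u ?_) (norm_nonneg _) hB0
    rw [abs_le]
    exact ⟨by linarith [hu.1], by linarith [hu.2]⟩
  · rw [abs_of_nonneg (by nlinarith)]
    apply le_of_eq; ring

end Kernel

/-- Expectations with respect to a variable with a smooth density of functions at scale `h`. -/
theorem HasSmoothDensity.exists_bounds {P : Measure Ω} [IsProbabilityMeasure P] {Z : Ω → ℝ}
    (hZ : HasSmoothDensity P Z) (hZm : Measurable Z) {W : ℝ → ℝ} (hW : IsKernel W) (M : ℝ) :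
    ∃ C : ℝ, 0 ≤ C ∧ ∀ h z : ℝ, 0 < h → |z| ≤ M →
      |∫ ω, deriv W ((Z ω - z) / h) ∂P| ≤ C * h ^ 2 ∧
      |∫ ω, deriv W ((Z ω - z) / h) * Z ω ∂P| ≤ C * h ^ 2 ∧
      ∫ ω, (Set.Icc (z - h) (z + h)).indicator (fun _ => (1 : ℝ)) (Z ω) ∂P ≤ C * h := by
  obtain ⟨f, hf0, hmap, ⟨B, hB⟩, hfd, ⟨B', hB'⟩⟩ := hZ
  obtain ⟨K, hK, -, hKW⟩ := hW.exists_support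
  obtain ⟨D, hD⟩ := hW.deriv_bounded
  have hD0 : 0 ≤ D := (abs_nonneg _).trans (hD 0)
  have hB0 : 0 ≤ B := (hf0 0).trans (hB 0)
  have hB0' : 0 ≤ B' := (abs_nonneg _).trans (hB' 0)
  have hfc : Continuous f := hfd.continuous
  have hcont : Continuous (deriv W) := hW.differentiable_deriv.continuous
  have hint : ∀ q : ℝ → ℝ, Measurable q → ∫ ω, q (Z ω) ∂P = ∫ u, q u * f u := by
    intro q hq
    rw [← integral_map hZm.aemeasurable hq.aestronglyMeasurable, hmap,
      integral_withDensity_eq_integral_toReal_smul hfc.measurable.ennreal_ofReal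
        (Eventually.of_forall fun _ => ENNReal.ofReal_lt_top)]
    refine integral_congr_ae (Eventually.of_forall fun u => ?_)
    simp only [smul_eq_mul, ENNReal.toReal_ofReal (hf0 u)]
    ring
  have hlip : ∀ u z, |f u - f z| ≤ B' * |u - z| := fun u z =>
    Convex.norm_image_sub_le_of_norm_deriv_le (s := Set.univ) (fun x _ => hfd x)
      (fun x _ => hB' x) convex_univ (Set.mem_univ z) (Set.mem_univ u)
  have hbound : ∀ u, |f u| ≤ B := fun u => by rw [abs_of_nonneg (hf0 u)]; exact hB u
  -- One summand for each bound. The oscillation `Λ` over the window is `B' K h` for `f` and `(B +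
  -- |M| B') K h` for `u ↦ u f u`; the window length brings the second factor `h`.
  refine ⟨D * (B' * K) * (2 * K) + D * ((B + |M| * B') * K) * (2 * K) + 2 * B, by positivity,
    fun h z hh hz => ⟨?_, ?_, ?_⟩⟩
  · have hm : Measurable fun u => deriv W ((u - z) / h) :=
      (hcont.comp (by fun_prop : Continuous fun u : ℝ => (u - z) / h)).measurable
    rw [hint (fun u => deriv W ((u - z) / h)) hm]
    refine (hW.abs_integral_deriv_mul_le hK hKW hD hfc hh (Λ := B' * (K * h)) fun u hu =>
      (hlip u z).trans (mul_le_mul_of_nonneg_left hu hB0')).trans ?_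
    have h1 : 0 ≤ D * ((B + |M| * B') * K) * (2 * K) + 2 * B := by positivity
    nlinarith [mul_nonneg h1 (sq_nonneg h)]
  · have hm : Measurable fun u => deriv W ((u - z) / h) * u :=
      ((hcont.comp (by fun_prop : Continuous fun u : ℝ => (u - z) / h)).mul
        continuous_id).measurable
    rw [hint (fun u => deriv W ((u - z) / h) * u) hm]
    simp only [mul_assoc (deriv W _)]
    have hΛ : ∀ u, |u - z| ≤ K * h → |u * f u - z * f z| ≤ (B + |M| * B') * (K * h) := by
      intro u hu
      have e : u * f u - z * f z = (u - z) * f u + z * (f u - f z) := by ring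
      rw [e]
      refine (abs_add_le _ _).trans ?_
      rw [abs_mul, abs_mul]
      have hz' : |z| ≤ |M| := hz.trans (le_abs_self M)
      have h1 : |u - z| * |f u| ≤ K * h * B :=
        mul_le_mul hu (hbound u) (abs_nonneg _) (by positivity)
      have h2 : |z| * |f u - f z| ≤ |M| * (B' * (K * h)) :=
        mul_le_mul hz' ((hlip u z).trans (mul_le_mul_of_nonneg_left hu hB0')) (abs_nonneg _)
          (abs_nonneg _)
      linarith
    refine (hW.abs_integral_deriv_mul_le hK hKW hD (φ := fun u => u * f u)
      (continuous_id.mul hfc) hh hΛ).trans ?_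
    have h1 : 0 ≤ D * (B' * K) * (2 * K) + 2 * B := by positivity
    nlinarith [mul_nonneg h1 (sq_nonneg h)]
  · rw [hint _ (measurable_const.indicator measurableSet_Icc)]
    have h1 : ∫ u, (Set.Icc (z - h) (z + h)).indicator (fun _ => (1 : ℝ)) u * f u
        = ∫ u in Set.Icc (z - h) (z + h), f u := by
      rw [← integral_indicator measurableSet_Icc]
      congr 1 with u
      by_cases hu : u ∈ Set.Icc (z - h) (z + h) <;> simp [hu]
    rw [h1]
    have h2 := norm_setIntegral_le_of_norm_le_const (μ := volume) (s := Set.Icc (z - h) (z + h))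
      (f := f) (C := B) (by simp) fun u _ => hbound u
    have h3 : volume.real (Set.Icc (z - h) (z + h)) = 2 * h := by
      rw [Real.volume_real_Icc_of_le (by linarith)]; ring
    rw [h3] at h2
    have h4 : 0 ≤ D * (B' * K) * (2 * K) + D * ((B + |M| * B') * K) * (2 * K) := by positivity
    nlinarith [le_abs_self (∫ u in Set.Icc (z - h) (z + h), f u), mul_nonneg h4 hh.le,
      Real.norm_eq_abs (∫ u in Set.Icc (z - h) (z + h), f u)]

end

section

/-! ### Uniform bounds for averages of functions of the scores -/

variable {Ω : Type*} [MeasurableSpace Ω] {a b : ℝ}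

namespace IsSample

variable {P : Measure Ω} {X : ℕ → Ω → Set.Icc a b → ℝ}

/-- The norms of the first `n` centred data are eventually at most `n ^ ε`. -/
lemma ae_eventually_eLpNorm_le [IsProbabilityMeasure P] (h : IsSample P X) {ε : ℝ} (hε : 0 < ε) :
    ∀ᵐ ω ∂P, ∀ᶠ n : ℕ in atTop, ∀ i < n,
      eLpNorm (fun t => X i ω t - meanFn P (X 0) t) 2 (leb a b)
        ≤ ENNReal.ofReal ((n : ℝ) ^ ε) := by
  obtain ⟨p, hp⟩ : ∃ p : ℕ, 3 / ε < p := exists_nat_gt _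
  -- `qε ≥ 3` makes the sum of `n` terms `O(n^{-2})`; the `+ 2` ensures `2 ≤ q` for the comparison
  -- with `L²`.
  set q := p + 2 with hq
  have hqε : 3 ≤ q * ε := by
    rw [div_lt_iff₀ hε] at hp
    push_cast [hq]
    nlinarith
  obtain ⟨M, hM⟩ := h.exists_lintegral_eLpNorm_pow_le q
  obtain ⟨κ, hκ, hκle⟩ := exists_pos_eLpNorm_two_le (leb a b) (by omega : 2 ≤ q)
  set r : ℕ → ℝ≥0∞ := fun n => ENNReal.ofReal ((n : ℝ) ^ (-ε)) with hr
  have hm := h.measurable_uncurry_sub_meanFn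
  have hinner : ∀ i, Measurable fun ω => ∫⁻ t, ‖X i ω t - meanFn P (X 0) t‖ₑ ^ q ∂(leb a b) :=
    fun i => Measurable.lintegral_prod_right'
      (f := fun p : Ω × Set.Icc a b => ‖X i p.1 p.2 - meanFn P (X 0) p.2‖ₑ ^ q)
      ((hm i).enorm.pow_const _)
  set F : ℕ → Ω → ℝ≥0∞ := fun n ω => ∑ i ∈ Finset.range n,
    r n ^ q * ∫⁻ t, ‖X i ω t - meanFn P (X 0) t‖ₑ ^ q ∂(leb a b) with hF
  have hFmeas : ∀ n, Measurable (F n) := fun n =>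
    Finset.measurable_sum _ fun i _ => (hinner i).const_mul _
  have hFle : ∀ n : ℕ, 1 ≤ n → ∫⁻ ω, F n ω ∂P ≤ ENNReal.ofReal (M * (n : ℝ) ^ (-2 : ℝ)) := by
    intro n hn
    have hn0 : (0 : ℝ) < n := by exact_mod_cast hn
    have hn1 : (1 : ℝ) ≤ n := by exact_mod_cast hn
    rw [hF, lintegral_finsetSum _ fun i _ => (hinner i).const_mul _]
    have h1 : ∀ i ∈ Finset.range n,
        ∫⁻ ω, r n ^ q * ∫⁻ t, ‖X i ω t - meanFn P (X 0) t‖ₑ ^ q ∂(leb a b) ∂P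
        ≤ ENNReal.ofReal (M * (n : ℝ) ^ (-3 : ℝ)) := by
      intro i _
      rw [lintegral_const_mul _ (hinner i), hr, ← ENNReal.ofReal_pow (by positivity), mul_comm,
        ENNReal.ofReal_mul (NNReal.coe_nonneg M), ENNReal.ofReal_coe_nnreal]
      refine mul_le_mul' (hM i) (ENNReal.ofReal_le_ofReal ?_)
      rw [← Real.rpow_natCast, ← Real.rpow_mul hn0.le]
      exact Real.rpow_le_rpow_of_exponent_le hn1 (by nlinarith)
    refine (Finset.sum_le_card_nsmul _ _ _ h1).trans ?_
    rw [nsmul_eq_mul, ← ENNReal.ofReal_natCast, ← ENNReal.ofReal_mul (Nat.cast_nonneg _),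
      Finset.card_range]
    refine ENNReal.ofReal_le_ofReal (le_of_eq ?_)
    have h3 : (n : ℝ) ^ (-2 : ℝ) = n * (n : ℝ) ^ (-3 : ℝ) := by
      rw [← Real.rpow_one_add' hn0.le (by norm_num : (1 : ℝ) + -3 ≠ 0)]
      norm_num
    rw [h3]; ring
  filter_upwards [ae_tendsto_zero_of_lintegral_le_rpow (fun n => (hFmeas n).aemeasurable) hFle]
    with ω hω
  filter_upwards [hω.eventually (gt_mem_nhds hκ), eventually_ge_atTop 1] with n hn hn1 i hi
  have hn0 : (0 : ℝ) < n := by exact_mod_cast hn1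
  have hterm : r n ^ q * ∫⁻ t, ‖X i ω t - meanFn P (X 0) t‖ₑ ^ q ∂(leb a b) ≤ κ :=
    (Finset.single_le_sum
      (f := fun i => r n ^ q * ∫⁻ t, ‖X i ω t - meanFn P (X 0) t‖ₑ ^ q ∂(leb a b))
      (fun _ _ => zero_le) (Finset.mem_range.2 hi)).trans hn.le
  have hr0 : r n ≠ 0 := by
    simp only [hr, ne_eq, ENNReal.ofReal_eq_zero, not_le]
    positivity
  refine (hκle _ (r n) ((h.measurable_path i ω).sub h.measurable_meanFn).aestronglyMeasurable
    hr0 ENNReal.ofReal_ne_top hterm).trans (le_of_eq ?_)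
  rw [hr, ← ENNReal.ofReal_inv_of_pos (by positivity), ← Real.rpow_neg hn0.le, neg_neg]

/-- A measurable functional of the path computing `∫ (X - E X) φ / √τ`. -/
lemma exists_score_functional [IsProbabilityMeasure P] (h : IsSample P X) (hab : a ≤ b)
    (φ : L2 a b) (τ : ℝ) :
    ∃ Z : (Set.Icc a b → ℝ) → ℝ, Measurable Z ∧ ∀ᵐ ω ∂P, ∀ i,
      (∫ t, (X i ω t - meanFn P (X 0) t) * φ t ∂(leb a b)) / √τ = Z (X i ω) := by
  obtain ⟨G, hG, hGX⟩ := h.exists_measurable_functional hab φ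
  refine ⟨fun x => (G x - ∫ t, meanFn P (X 0) t * φ t ∂(leb a b)) / √τ,
    (hG.sub_const _).div_const _, ?_⟩
  filter_upwards [ae_all_iff.2 hGX, h.ae_memLp] with ω hω hmem i
  have i1 : Integrable (fun t => X i ω t * φ t) (leb a b) := (hmem i).integrable_mul (Lp.memLp φ)
  have i2 : Integrable (fun t => meanFn P (X 0) t * φ t) (leb a b) :=
    h.memLp_meanFn.integrable_mul (Lp.memLp φ)
  simp only [sub_mul]
  rw [integral_sub i1 i2, hω i]

variable {Z : (Set.Icc a b → ℝ) → ℝ} {g : ℕ → ℕ → ℝ → ℝ} {D : ℝ} {ε : ℝ}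

/-- The scalar case of the `L²` rate: over a one-point space with Dirac mass the norm is the
absolute value. -/
lemma ae_eventually_abs_average_sub_le [IsProbabilityMeasure P] (h : IsSample P X)
    (hZ : Measurable Z) (hg : ∀ n l, Measurable (g n l)) (hD : ∀ n l u, |g n l u| ≤ D)
    (hε : 0 < ε) :
    ∀ᵐ ω ∂P, ∀ᶠ n : ℕ in atTop, ∀ l ≤ n,
      |(1 / (n : ℝ)) * ∑ i ∈ Finset.range n, g n l (Z (X i ω)) - ∫ ω', g n l (Z (X 0 ω')) ∂P|
        ≤ (n : ℝ) ^ (-(1 / 2) + ε : ℝ) := by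
  have hA := ae_eventually_eLpNorm_average_sub_le (ν := Measure.dirac ()) (ι := ℕ)
    h.measurable h.indep h.ident
    (g := fun n l _ x => g n l (Z x))
    (fun n l _ => (hg n l).comp hZ)
    (fun n l i => ((hg n l).comp hZ).comp ((h.measurable i).comp measurable_fst))
    (fun q => by
      refine ⟨‖D‖₊ ^ q, fun n l _ => ?_⟩
      calc ∫⁻ ω, ‖g n l (Z (X 0 ω))‖ₑ ^ q ∂P ≤ ∫⁻ _, ‖D‖ₑ ^ q ∂P := by
            refine lintegral_mono fun ω => ?_
            gcongr
            rw [← ofReal_norm, ← ofReal_norm]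
            exact ENNReal.ofReal_le_ofReal ((hD n l _).trans (le_abs_self D))
        _ = _ := by simp [enorm_eq_nnnorm])
    (G := fun n => Finset.range (n + 1)) (fun n => by simp) hε
  filter_upwards [hA] with ω hω
  filter_upwards [hω] with n hn l hl
  have h1 := hn l (Finset.mem_range.2 (by omega))
  rw [eLpNorm_const _ (by simp) (by simp [Measure.dirac_ne_zero]), ← ofReal_norm] at h1
  simp only [measure_univ, ENNReal.one_rpow, mul_one] at h1
  rwa [ENNReal.ofReal_le_ofReal_iff (by positivity)] at h1

lemma ae_eventually_eLpNorm_average_mul_sub_le [IsProbabilityMeasure P] (h : IsSample P X)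
    (hZ : Measurable Z) (hg : ∀ n l, Measurable (g n l)) (hD : ∀ n l u, |g n l u| ≤ D)
    (hε : 0 < ε) :
    ∀ᵐ ω ∂P, ∀ᶠ n : ℕ in atTop, ∀ l ≤ n,
      eLpNorm (fun t => (1 / (n : ℝ)) * ∑ i ∈ Finset.range n,
          g n l (Z (X i ω)) * (X i ω t - meanFn P (X 0) t)
          - ∫ ω', g n l (Z (X 0 ω')) * (X 0 ω' t - meanFn P (X 0) t) ∂P) 2 (leb a b)
        ≤ ENNReal.ofReal ((n : ℝ) ^ (-(1 / 2) + ε : ℝ)) := by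
  have hA := ae_eventually_eLpNorm_average_sub_le (ν := leb a b) (ι := ℕ)
    h.measurable h.indep h.ident
    (g := fun n l t x => g n l (Z x) * (x t - meanFn P (X 0) t))
    (fun n l t => ((hg n l).comp hZ).mul ((measurable_pi_apply t).sub_const _))
    (fun n l i => (((hg n l).comp hZ).comp ((h.measurable i).comp measurable_fst)).mul
      (h.measurable_uncurry_sub_meanFn i))
    (fun q => by
      obtain ⟨M, hM⟩ := h.exists_lintegral_sub_meanFn_pow_le q
      refine ⟨‖D‖₊ ^ q * M, fun n l t => ?_⟩
      calc ∫⁻ ω, ‖g n l (Z (X 0 ω)) * (X 0 ω t - meanFn P (X 0) t)‖ₑ ^ q ∂P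
          ≤ ∫⁻ ω, ‖D‖ₑ ^ q * ‖X 0 ω t - meanFn P (X 0) t‖ₑ ^ q ∂P := by
            refine lintegral_mono fun ω => ?_
            rw [enorm_mul, mul_pow]
            gcongr
            rw [← ofReal_norm, ← ofReal_norm]
            exact ENNReal.ofReal_le_ofReal ((hD n l _).trans (le_abs_self D))
        _ = ‖D‖ₑ ^ q * ∫⁻ ω, ‖X 0 ω t - meanFn P (X 0) t‖ₑ ^ q ∂P :=
            lintegral_const_mul' _ _ (by simp)
        _ ≤ _ := by
            push_cast
            gcongr
            · exact le_rfl
            · exact hM 0 t)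
    (G := fun n => Finset.range (n + 1)) (fun n => by simp) hε
  filter_upwards [hA] with ω hω
  filter_upwards [hω] with n hn l hl
  exact hn l (Finset.mem_range.2 (by omega))

end IsSample

end

/-! ### Discretisation of the location and uniform bounds -/

section

lemma exists_grid_point {M z : ℝ} (hM : 0 < M) (hz : |z| ≤ M) {n : ℕ} (hn : 1 ≤ n) :
    ∃ l ≤ n, |-M + 2 * M * l / n| ≤ M ∧ |z - (-M + 2 * M * l / n)| ≤ 2 * M / n := by
  have hn0 : (0 : ℝ) < n := by exact_mod_cast hn
  obtain ⟨hz1, hz2⟩ := abs_le.1 hz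
  set x : ℝ := (z + M) * n / (2 * M) with hx
  have hx0 : 0 ≤ x := div_nonneg (mul_nonneg (by linarith) hn0.le) (by linarith)
  have hxn : x ≤ n := by
    rw [hx, div_le_iff₀ (by linarith)]
    nlinarith
  have h1 : (⌊x⌋₊ : ℝ) ≤ x := Nat.floor_le hx0
  have h2 : x < ⌊x⌋₊ + 1 := Nat.lt_floor_add_one x
  have hln : ⌊x⌋₊ ≤ n := by
    have : (⌊x⌋₊ : ℝ) ≤ n := h1.trans hxn
    exact_mod_cast this
  have hzx : z = -M + 2 * M * x / n := by
    rw [hx]; field_simp; ring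
  have hc : 0 < 2 * M / n := by positivity
  have e1 : 2 * M * (⌊x⌋₊ : ℝ) / n = 2 * M / n * ⌊x⌋₊ := by ring
  have e2 : 2 * M * x / n = 2 * M / n * x := by ring
  have e3 : 2 * M / n * n = 2 * M := by field_simp
  have h3 : 2 * M / n * ⌊x⌋₊ ≤ 2 * M := by
    calc 2 * M / n * (⌊x⌋₊ : ℝ) ≤ 2 * M / n * n := by gcongr
      _ = 2 * M := e3
  have h4 : 0 ≤ 2 * M / n * (⌊x⌋₊ : ℝ) := by positivity
  refine ⟨⌊x⌋₊, hln, ?_, ?_⟩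
  · rw [e1, abs_le]; constructor <;> linarith
  · rw [hzx, e1, e2, abs_le]
    have h5 := mul_le_mul_of_nonneg_left h1 hc.le
    have h6 := mul_lt_mul_of_pos_left h2 hc
    rw [mul_add, mul_one] at h6
    constructor <;> linarith

lemma abs_deriv_sub_le {W : ℝ → ℝ} (hW : IsKernel W) {L : ℝ} (hL : ∀ u, |deriv (deriv W) u| ≤ L)
    (u v : ℝ) : |deriv W u - deriv W v| ≤ L * |u - v| :=
  Convex.norm_image_sub_le_of_norm_deriv_le (s := Set.univ) (fun x _ => hW.differentiable_deriv x)
    (fun x _ => hL x) convex_univ (Set.mem_univ v) (Set.mem_univ u)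

/-- `W'` is Lipschitz, so moving the location by `|z - z'|` changes each weight by at most `L |z -
z'| / h`. Used with `V = L²` and with `V = ℝ`, `y = 1`. -/
lemma norm_average_deriv_smul_sub_le {V : Type*} [NormedAddCommGroup V] [NormedSpace ℝ V]
    {W : ℝ → ℝ} (hW : IsKernel W) {L : ℝ} (hL : ∀ u, |deriv (deriv W) u| ≤ L) {n : ℕ} (hn : 1 ≤ n)
    {y : ℕ → V} {R : ℝ} (hy : ∀ i < n, ‖y i‖ ≤ R) (ζ : ℕ → ℝ) {h : ℝ} (hh : 0 < h) (z z' : ℝ) :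
    ‖(1 / (n : ℝ)) • ∑ i ∈ Finset.range n, deriv W ((ζ i - z) / h) • y i
      - (1 / (n : ℝ)) • ∑ i ∈ Finset.range n, deriv W ((ζ i - z') / h) • y i‖
      ≤ L * (|z - z'| / h) * R := by
  have hn0 : (0 : ℝ) < n := by exact_mod_cast hn
  have hL0 : 0 ≤ L := (abs_nonneg _).trans (hL 0)
  rw [← smul_sub, ← Finset.sum_sub_distrib, norm_smul, Real.norm_of_nonneg (by positivity)]
  have h1 : ‖∑ i ∈ Finset.range n, (deriv W ((ζ i - z) / h) • y i - deriv W ((ζ i - z') / h) • y i)‖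
      ≤ n * (L * (|z - z'| / h) * R) := by
    refine (norm_sum_le_of_le (f := fun i => deriv W ((ζ i - z) / h) • y i
      - deriv W ((ζ i - z') / h) • y i) (n := fun _ => L * (|z - z'| / h) * R) _
      fun i hi => ?_).trans ?_
    · rw [← sub_smul, norm_smul]
      refine mul_le_mul ?_ (hy i (Finset.mem_range.1 hi)) (norm_nonneg _) (by positivity)
      refine (abs_deriv_sub_le hW hL _ _).trans (le_of_eq ?_)
      rw [← sub_div, abs_div, abs_of_pos hh, sub_sub_sub_cancel_left, abs_sub_comm]
    · simp
  calc 1 / (n : ℝ) * _ ≤ 1 / (n : ℝ) * (n * (L * (|z - z'| / h) * R)) := by gcongr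
    _ = _ := by field_simp

variable {a b : ℝ}

lemma coeFn_sum_smul {ι : Type*} {y : ι → L2 a b} {Y : ι → Set.Icc a b → ℝ}
    (hy : ∀ i, y i =ᵐ[leb a b] Y i) (c : ι → ℝ) (s : Finset ι) :
    (∑ i ∈ s, c i • y i : L2 a b) =ᵐ[leb a b] fun t => ∑ i ∈ s, c i * Y i t := by
  classical
  induction s using Finset.induction_on with
  | empty =>
    simp only [Finset.sum_empty]
    exact Lp.coeFn_zero _ _ _
  | insert i s hi ih =>
    rw [Finset.sum_insert hi]
    filter_upwards [Lp.coeFn_add (c i • y i) (∑ i ∈ s, c i • y i), Lp.coeFn_smul (c i) (y i),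
      ih, hy i] with t h1 h2 h3 h4
    rw [h1, Finset.sum_insert hi, Pi.add_apply, h2, h3, Pi.smul_apply, h4, smul_eq_mul]

lemma enorm_smul_sum_smul {ι : Type*} {y : ι → L2 a b} {Y : ι → Set.Icc a b → ℝ}
    (hy : ∀ i, y i =ᵐ[leb a b] Y i) (r : ℝ) (c : ι → ℝ) (s : Finset ι) :
    ‖r • ∑ i ∈ s, c i • y i‖ₑ = eLpNorm (fun t => r * ∑ i ∈ s, c i * Y i t) 2 (leb a b) := by
  rw [Lp.enorm_def]
  refine eLpNorm_congr_ae ?_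
  filter_upwards [Lp.coeFn_smul r (∑ i ∈ s, c i • y i), coeFn_sum_smul hy c s] with t h1 h2
  rw [h1, Pi.smul_apply, h2, smul_eq_mul]

variable {Ω : Type*} [MeasurableSpace Ω]

lemma add_add_le_mul_add {r s A E T : ℝ} (hr : 0 ≤ r) (hs : 0 ≤ s) (h1 : 1 + E ≤ T) (h2 : A ≤ T) :
    r + A * s + E * r ≤ T * (r + s) := by
  nlinarith [mul_le_mul_of_nonneg_right h1 hr, mul_le_mul_of_nonneg_right h2 hs]

lemma norm_le_add_of_norm_sub_le {V : Type*} [SeminormedAddCommGroup V] {x y : V} {A B : ℝ}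
    (h1 : ‖y‖ ≤ A) (h2 : ‖x - y‖ ≤ B) : ‖x‖ ≤ A + B := by
  have := norm_add_le y (x - y)
  rw [add_sub_cancel] at this
  linarith

set_option maxHeartbeats 1000000 in
/-- Bounds, uniform over compact sets of locations `z`, for averages at scale `bw n` of functions of
the empirical scores. -/
theorem IsSample.ae_eventually_uniform_bounds {P : Measure Ω} [IsProbabilityMeasure P]
    {X : ℕ → Ω → Set.Icc a b → ℝ} (h : IsSample P X) (hab : a ≤ b)
    {θ : ℕ → ℝ} {ψ : ℕ → L2 a b} (hspec : IsSpectralExpansion (covFn P (X 0)) θ ψ)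
    (hscores : iIndepFun (score P (X 0) θ ψ) P) {j : ℕ} (hj : 0 < θ j)
    (hdens : HasSmoothDensity P (score P (X 0) θ ψ j)) {W : ℝ → ℝ} (hW : IsKernel W)
    {bw : ℕ → ℝ} (hbw0 : ∀ n, 0 < bw n) {ε : ℝ} (hε : 0 < ε)
    (hbw : ∀ᶠ n : ℕ in atTop, (n : ℝ) ^ (-(1 / 2) + ε : ℝ) ≤ bw n) {M : ℝ} (hM : 0 < M)
    {ρ : ℝ} (hρ : 0 < ρ) :
    ∃ C : ℝ, 0 ≤ C ∧ ∀ᵐ ω ∂P, ∃ y : ℕ → L2 a b,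
      (∀ i, y i =ᵐ[leb a b] fun t => X i ω t - meanFn P (X 0) t) ∧
      ∀ᶠ n : ℕ in atTop, (∀ i < n, ‖y i‖ ≤ (n : ℝ) ^ ε) ∧ ∀ z : ℝ, |z| ≤ M →
        ‖(1 / (n : ℝ)) • ∑ i ∈ Finset.range n,
          deriv W ((inner ℝ (y i) (ψ j) / √(θ j) - z) / bw n) • y i‖
            ≤ C * ((n : ℝ) ^ (-(1 / 2) + ε : ℝ) + bw n ^ 2) ∧
        |(1 / (n : ℝ)) * ∑ i ∈ Finset.range n,
          deriv W ((inner ℝ (y i) (ψ j) / √(θ j) - z) / bw n)|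
            ≤ C * ((n : ℝ) ^ (-(1 / 2) + ε : ℝ) + bw n ^ 2) ∧
        (1 / (n : ℝ)) * ∑ i ∈ Finset.range n, (Set.Icc (z - ρ * bw n) (z + ρ * bw n)).indicator
          (fun _ => (1 : ℝ)) (inner ℝ (y i) (ψ j) / √(θ j)) ≤ C * bw n := by
  obtain ⟨Z, hZ, hZX⟩ := h.exists_score_functional hab (ψ j) (θ j)
  have hZ0 : ∀ᵐ ω ∂P, score P (X 0) θ ψ j ω = Z (X 0 ω) := by
    filter_upwards [hZX] with ω hω using hω 0
  have hsm : Measurable (score P (X 0) θ ψ j) := (h.measurable_centredCoeff (ψ j)).div_const _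
  obtain ⟨C₀, hC0, hC⟩ := hdens.exists_bounds hsm hW M
  obtain ⟨D, hD⟩ := hW.deriv_bounded
  obtain ⟨L, hL⟩ := hW.deriv_deriv_bounded
  have hL0 : 0 ≤ L := (abs_nonneg _).trans (hL 0)
  have hcont : Continuous (deriv W) := hW.differentiable_deriv.continuous
  set zg : ℕ → ℕ → ℝ := fun n l => -M + 2 * M * l / n with hzg
  set g₁ : ℕ → ℕ → ℝ → ℝ := fun n l u => deriv W ((u - zg n l) / bw n) with hg1
  have hg1m : ∀ n l, Measurable (g₁ n l) := fun n l =>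
    (hcont.comp (by fun_prop : Continuous fun u : ℝ => (u - zg n l) / bw n)).measurable
  -- The radius `ρ + 1` instead of `ρ` absorbs the mesh, which is at most one bandwidth: the window
  -- at a grid point then contains the window at every nearby `z`.
  set g₂ : ℕ → ℕ → ℝ → ℝ := fun n l => (Set.Icc (zg n l - (ρ + 1) * bw n)
    (zg n l + (ρ + 1) * bw n)).indicator (fun _ => (1 : ℝ)) with hg2
  have hg2m : ∀ n l, Measurable (g₂ n l) := fun n l =>
    measurable_const.indicator measurableSet_Icc
  have hg2le : ∀ n l u, |g₂ n l u| ≤ 1 := fun n l u => by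
    simp only [hg2, Set.indicator_apply]
    split_ifs <;> simp
  have hA := h.ae_eventually_eLpNorm_average_mul_sub_le hZ hg1m (D := D) (fun n l u => hD _) hε
  have hB := h.ae_eventually_abs_average_sub_le hZ hg1m (D := D) (fun n l u => hD _) hε
  have hI := h.ae_eventually_abs_average_sub_le hZ hg2m hg2le hε
  have hE : ∀ᶠ n : ℕ in atTop, 2 * M * (n : ℝ) ^ (-(1 / 2) - ε : ℝ) ≤ 1 := by
    have h1 : Tendsto (fun n : ℕ => 2 * M * (n : ℝ) ^ (-(1 / 2 + ε) : ℝ)) atTop (𝓝 (2 * M * 0)) :=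
      ((tendsto_rpow_neg_atTop (by positivity)).comp tendsto_natCast_atTop_atTop).const_mul _
    rw [mul_zero] at h1
    filter_upwards [h1.eventually (gt_mem_nhds one_pos)] with n hn
    rw [neg_add'] at hn
    exact hn.le
  -- The parts are, in order, the fluctuation and mean at a grid point, the move from `z` to the
  -- grid, and the count of scores, where the fluctuation `r` is at most `bw n`.
  refine ⟨(1 + √(θ j) * C₀ + C₀) + 2 * M * L + (1 + C₀ * (ρ + 1)), by positivity, ?_⟩
  filter_upwards [hA, hB, hI, hZX, h.ae_memLp_sub_meanFn, h.ae_eventually_eLpNorm_le hε]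
    with ω hAω hBω hIω hZω hmem hnorm
  set y : ℕ → L2 a b := fun i => (hmem i).toLp with hy
  have hyY : ∀ i, y i =ᵐ[leb a b] fun t => X i ω t - meanFn P (X 0) t := fun i =>
    (hmem i).coeFn_toLp
  have hζ : ∀ i, inner ℝ (y i) (ψ j) / √(θ j) = Z (X i ω) := fun i => by
    rw [← hZω i, ← integral_mul_eq_inner]
    congr 1
    refine integral_congr_ae ?_
    filter_upwards [hyY i] with t ht
    rw [ht]
  refine ⟨y, hyY, ?_⟩
  filter_upwards [hAω, hBω, hIω, hnorm, hbw, hE, eventually_ge_atTop 1]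
    with n hAn hBn hIn hnn hbn hEn hn
  have hn0 : (0 : ℝ) < n := by exact_mod_cast hn
  have hn1 : (1 : ℝ) ≤ n := by exact_mod_cast hn
  have hynorm : ∀ i < n, ‖y i‖ ≤ (n : ℝ) ^ ε := fun i hi => by
    have h1 := hnn i hi
    rw [← Lp.enorm_toLp (hf := hmem i), ← ofReal_norm,
      ENNReal.ofReal_le_ofReal_iff (by positivity)] at h1
    exact h1
  set r : ℝ := (n : ℝ) ^ (-(1 / 2) + ε : ℝ) with hr
  have hr0 : 0 < r := by positivity
  have hbn0 := hbw0 n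
  have hb2 : 0 < bw n ^ 2 := by positivity
  -- the mesh is fine compared with the bandwidth
  have hmesh : 2 * M / n ≤ bw n := by
    refine le_trans ?_ hbn
    have e : 2 * M / n = 2 * M * (n : ℝ) ^ (-(1 / 2) - ε : ℝ) * r := by
      rw [hr, mul_assoc, ← Real.rpow_add hn0]
      have : (-(1 / 2) - ε + (-(1 / 2) + ε) : ℝ) = -1 := by ring
      rw [this, Real.rpow_neg_one, div_eq_mul_inv]
    rw [e]
    exact mul_le_of_le_one_left hr0.le hEn
  -- The move to the grid multiplies mesh over bandwidth by the largest norm, `n^{-1+ε}/bw`; this is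
  -- at most `r` because `bw n ≥ n^{-1/2}`.
  have hinvb : (2 * M / n) / bw n * (n : ℝ) ^ ε ≤ 2 * M * r := by
    have h1 : (n : ℝ) ^ (-(1 / 2) : ℝ) ≤ bw n := by
      refine le_trans (Real.rpow_le_rpow_of_exponent_le hn1 ?_) hbn
      linarith
    have h2 : 2 * M / n * (n : ℝ) ^ ε = 2 * M * r * (n : ℝ) ^ (-(1 / 2) : ℝ) := by
      rw [hr, mul_assoc (2 * M), ← Real.rpow_add hn0]
      have : (-(1 / 2) + ε + -(1 / 2) : ℝ) = ε + -1 := by ring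
      rw [this, Real.rpow_add hn0, Real.rpow_neg_one]
      ring
    rw [div_mul_eq_mul_div, h2, div_le_iff₀ hbn0]
    gcongr
  have hnε : 1 ≤ (n : ℝ) ^ ε := Real.one_le_rpow hn1 hε.le
  have hEg : ∀ g : ℝ → ℝ, ∫ ω', g (Z (X 0 ω')) ∂P = ∫ ω', g (score P (X 0) θ ψ j ω') ∂P := by
    intro g
    refine integral_congr_ae ?_
    filter_upwards [hZ0] with ω' hω'
    rw [hω']
  refine ⟨hynorm, fun z hz => ?_⟩
  obtain ⟨l, hl, hzl, hzzl⟩ := exists_grid_point hM hz hn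
  change |zg n l| ≤ M at hzl
  change |z - zg n l| ≤ _ at hzzl
  obtain ⟨hd1, hd2, -⟩ := hC (bw n) (zg n l) hbn0 hzl
  obtain ⟨-, -, hd3⟩ := hC ((ρ + 1) * bw n) (zg n l) (by positivity) hzl
  simp only [hζ]
  refine ⟨?_, ?_, ?_⟩
  · have hgrid : ‖(1 / (n : ℝ)) • ∑ i ∈ Finset.range n,
        deriv W ((Z (X i ω) - zg n l) / bw n) • y i‖ ≤ r + √(θ j) * (C₀ * bw n ^ 2) := by
      rw [← ENNReal.ofReal_le_ofReal_iff (by positivity), ofReal_norm,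
        enorm_smul_sum_smul hyY, ENNReal.ofReal_add hr0.le (by positivity)]
      have hEfun : (fun t => ∫ ω', g₁ n l (Z (X 0 ω')) * (X 0 ω' t - meanFn P (X 0) t) ∂P)
          = fun t => ∫ ω', g₁ n l (score P (X 0) θ ψ j ω')
            * (X 0 ω' t - meanFn P (X 0) t) ∂P := by
        ext t
        refine integral_congr_ae ?_
        filter_upwards [hZ0] with ω' hω'
        rw [hω']
      have hEm : StronglyMeasurable fun t =>
          ∫ ω', g₁ n l (Z (X 0 ω')) * (X 0 ω' t - meanFn P (X 0) t) ∂P := by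
        have : StronglyMeasurable fun p : Set.Icc a b × Ω =>
            g₁ n l (Z (X 0 p.2)) * (X 0 p.2 p.1 - meanFn P (X 0) p.1) :=
          ((((hg1m n l).comp hZ).comp (h.measurable 0) |>.comp measurable_snd).mul
            ((h.measurable_uncurry_sub_meanFn 0).comp measurable_swap)).stronglyMeasurable
        exact this.integral_prod_right
      have hEn : eLpNorm (fun t => ∫ ω', g₁ n l (Z (X 0 ω'))
          * (X 0 ω' t - meanFn P (X 0) t) ∂P) 2 (leb a b)
          ≤ ENNReal.ofReal (√(θ j) * (C₀ * bw n ^ 2)) := by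
        rw [hEfun, h.eLpNorm_integral_mul_sub_meanFn_eq hspec hscores hj (hg1m n l)
          (B := D) (fun u => hD _)]
        exact ENNReal.ofReal_le_ofReal (mul_le_mul_of_nonneg_left hd2 (Real.sqrt_nonneg _))
      have hAm : AEStronglyMeasurable (fun t => (1 / (n : ℝ)) * ∑ i ∈ Finset.range n,
          g₁ n l (Z (X i ω)) * (X i ω t - meanFn P (X 0) t)) (leb a b) :=
        ((Finset.measurable_sum _ fun i _ =>
          ((h.measurable_path i ω).sub h.measurable_meanFn).const_mul _).const_mul
            _).aestronglyMeasurable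
      have htri := eLpNorm_add_le (p := 2) (hAm.sub hEm.aestronglyMeasurable)
        hEm.aestronglyMeasurable (by norm_num)
      rw [sub_add_cancel] at htri
      exact htri.trans (add_le_add (hAn l hl) hEn)
    have hdiff := norm_average_deriv_smul_sub_le hW hL hn hynorm (fun i => Z (X i ω)) hbn0 z (zg n l)
    have hd : L * (|z - zg n l| / bw n) * (n : ℝ) ^ ε ≤ 2 * M * L * r := by
      calc L * (|z - zg n l| / bw n) * (n : ℝ) ^ ε
          ≤ L * ((2 * M / n) / bw n) * (n : ℝ) ^ ε := by gcongr
        _ = L * ((2 * M / n) / bw n * (n : ℝ) ^ ε) := by ring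
        _ ≤ L * (2 * M * r) := by gcongr
        _ = _ := by ring
    have hfin := norm_le_add_of_norm_sub_le hgrid (hdiff.trans hd)
    rw [← mul_assoc] at hfin
    refine hfin.trans (add_add_le_mul_add hr0.le hb2.le ?_ ?_) <;>
      linarith [mul_nonneg hC0 (by linarith : 0 ≤ ρ + 1), mul_nonneg (Real.sqrt_nonneg (θ j)) hC0,
        mul_nonneg (by linarith : 0 ≤ 2 * M) hL0]
  · have hgrid : ‖(1 / (n : ℝ)) • ∑ i ∈ Finset.range n,
        deriv W ((Z (X i ω) - zg n l) / bw n) • (1 : ℝ)‖ ≤ r + C₀ * bw n ^ 2 := by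
      simp only [smul_eq_mul, mul_one]
      have h1 := hBn l hl
      have h2 : |∫ ω', g₁ n l (Z (X 0 ω')) ∂P| ≤ C₀ * bw n ^ 2 := by
        rw [hEg (g₁ n l)]; exact hd1
      rw [Real.norm_eq_abs]
      calc |_| ≤ |(1 / (n : ℝ)) * ∑ i ∈ Finset.range n, g₁ n l (Z (X i ω))
            - ∫ ω', g₁ n l (Z (X 0 ω')) ∂P| + |∫ ω', g₁ n l (Z (X 0 ω')) ∂P| := by
              refine le_trans (le_of_eq ?_) (abs_add_le _ _)
              rw [sub_add_cancel]
        _ ≤ _ := add_le_add h1 h2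
    have hdiff := norm_average_deriv_smul_sub_le hW hL hn (y := fun _ => (1 : ℝ)) (R := 1)
      (fun _ _ => by simp) (fun i => Z (X i ω)) hbn0 z (zg n l)
    have hd : L * (|z - zg n l| / bw n) * 1 ≤ 2 * M * L * r := by
      calc L * (|z - zg n l| / bw n) * 1
          ≤ L * ((2 * M / n) / bw n) * (n : ℝ) ^ ε := by gcongr
        _ = L * ((2 * M / n) / bw n * (n : ℝ) ^ ε) := by ring
        _ ≤ L * (2 * M * r) := by gcongr
        _ = _ := by ring
    have hfin := norm_le_add_of_norm_sub_le hgrid (hdiff.trans hd)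
    simp only [smul_eq_mul, mul_one, Real.norm_eq_abs] at hfin
    refine hfin.trans (add_add_le_mul_add hr0.le hb2.le ?_ ?_) <;>
      linarith [mul_nonneg hC0 (by linarith : 0 ≤ ρ + 1), mul_nonneg (Real.sqrt_nonneg (θ j)) hC0,
        mul_nonneg (by linarith : 0 ≤ 2 * M) hL0]
  · have h1 := (abs_le.1 (hIn l hl)).2
    have h2 : ∫ ω', g₂ n l (Z (X 0 ω')) ∂P ≤ C₀ * ((ρ + 1) * bw n) := by
      rw [hEg (g₂ n l)]; exact hd3
    have h3 : (1 / (n : ℝ)) * ∑ i ∈ Finset.range n, (Set.Icc (z - ρ * bw n) (z + ρ * bw n)).indicator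
          (fun _ => (1 : ℝ)) (Z (X i ω))
        ≤ (1 / (n : ℝ)) * ∑ i ∈ Finset.range n, g₂ n l (Z (X i ω)) := by
      gcongr with i _
      refine Set.indicator_le_indicator_of_subset (Set.Icc_subset_Icc ?_ ?_) (fun _ => zero_le_one) _
      · have := (abs_le.1 hzzl).1
        linarith
      · have := (abs_le.1 hzzl).2
        linarith
    have e1 : 0 ≤ √(θ j) * C₀ := by positivity
    have e3 : 0 ≤ 2 * M * L := by positivity
    nlinarith [mul_nonneg e1 hbn0.le, mul_nonneg hC0 hbn0.le, mul_nonneg e3 hbn0.le]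

end

section

/-! ### Comparison of kernel estimators with perturbed directions -/

/-- Mean value inequality for `v ↦ W v - W'(u) v` on the segment. Only the Lipschitz bound for `W'`
enters, whence `L` in place of `L / 2`. -/
lemma IsKernel.abs_sub_sub_deriv_mul_le {W : ℝ → ℝ} (hW : IsKernel W) {L : ℝ}
    (hL : ∀ u, |deriv (deriv W) u| ≤ L) (u d : ℝ) :
    |W (u + d) - W u - deriv W u * d| ≤ L * d ^ 2 := by
  have hL0 : 0 ≤ L := (abs_nonneg _).trans (hL 0)
  have hdiff : ∀ v, HasDerivAt (fun v => W v - deriv W u * v) (deriv W v - deriv W u) v := fun v => by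
    have := (hW.differentiable v).hasDerivAt.sub ((hasDerivAt_id v).const_mul (deriv W u))
    rw [mul_one] at this
    exact this
  have h1 := Convex.norm_image_sub_le_of_norm_hasDerivWithin_le (s := Set.uIcc u (u + d))
    (f := fun v => W v - deriv W u * v) (f' := fun v => deriv W v - deriv W u) (C := L * |d|)
    (fun v _ => (hdiff v).hasDerivWithinAt)
    (fun v hv => (abs_deriv_sub_le hW hL v u).trans (mul_le_mul_of_nonneg_left (by
      simpa using Set.abs_sub_left_of_mem_uIcc hv) hL0))
    (convex_uIcc _ _) Set.left_mem_uIcc Set.right_mem_uIcc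
  have e : W (u + d) - deriv W u * (u + d) - (W u - deriv W u * u)
      = W (u + d) - W u - deriv W u * d := by ring
  rw [e, Real.norm_eq_abs, Real.norm_eq_abs] at h1
  refine h1.trans (le_of_eq ?_)
  rw [add_sub_cancel_left, mul_assoc, ← sq, sq_abs]

/-- If `q` is farther than `(K + 1) h` from `z`, a displacement `|d| ≤ h` leaves both arguments
outside the support of `W`. Localising the remainder gains a factor `h` after averaging. -/
lemma IsKernel.abs_sub_sub_deriv_mul_le_indicator {W : ℝ → ℝ} (hW : IsKernel W) {L K : ℝ}
    (hL : ∀ u, |deriv (deriv W) u| ≤ L) (hKW : ∀ u, K ≤ |u| → W u = 0)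
    (hKW' : ∀ u, K ≤ |u| → deriv W u = 0) {q d h z η : ℝ} (hh : 0 < h) (hd : |d| ≤ η) (hη : η ≤ h) :
    |W ((q - z + d) / h) - W ((q - z) / h) - deriv W ((q - z) / h) * (d / h)|
      ≤ L * (η / h) ^ 2
        * (Set.Icc (z - (K + 1) * h) (z + (K + 1) * h)).indicator (fun _ => (1 : ℝ)) q := by
  have hL0 : 0 ≤ L := (abs_nonneg _).trans (hL 0)
  by_cases hq : q ∈ Set.Icc (z - (K + 1) * h) (z + (K + 1) * h)
  · rw [Set.indicator_of_mem hq, mul_one, add_div]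
    refine (hW.abs_sub_sub_deriv_mul_le hL _ _).trans ?_
    rw [← sq_abs, abs_div, abs_of_pos hh]
    gcongr
  · have hgt : (K + 1) * h < |q - z| := by
      by_contra hcon
      rw [not_lt, abs_le] at hcon
      exact hq ⟨by linarith, by linarith⟩
    have h1 : K ≤ |(q - z) / h| := by
      rw [abs_div, abs_of_pos hh, le_div_iff₀ hh]
      nlinarith
    have h2 : K ≤ |(q - z + d) / h| := by
      rw [abs_div, abs_of_pos hh, le_div_iff₀ hh]
      have := abs_sub_abs_le_abs_sub (q - z) (-d)
      rw [abs_neg, sub_neg_eq_add] at this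
      nlinarith
    rw [hKW _ h1, hKW _ h2, hKW' _ h1, Set.indicator_of_notMem hq]
    simp

/-- The linear Taylor term is the inner product of `D` with a vector not depending on `D`, so
Cauchy–Schwarz separates the random direction from the averages. No independence between `D` and the
data is needed. -/
lemma IsKernel.abs_average_sub_le {H : Type*} [NormedAddCommGroup H] [InnerProductSpace ℝ H]
    {W : ℝ → ℝ} (hW : IsKernel W) {L K : ℝ}
    (hL : ∀ u, |deriv (deriv W) u| ≤ L) (hKW : ∀ u, K ≤ |u| → W u = 0)
    (hKW' : ∀ u, K ≤ |u| → deriv W u = 0) {n : ℕ} {h η : ℝ} (hh : 0 < h) (hη : η ≤ h)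
    {y : ℕ → H} {w φ D : H} (hd : ∀ i < n, |inner ℝ (y i - w) D| ≤ η) :
    |1 / (n * h) * ∑ i ∈ Finset.range n, W (inner ℝ (y i - w) (φ + D) / h)
      - 1 / (n * h) * ∑ i ∈ Finset.range n, W (inner ℝ (y i - w) φ / h)|
      ≤ 1 / h ^ 2 * (‖(1 / (n : ℝ)) • ∑ i ∈ Finset.range n,
            deriv W ((inner ℝ (y i) φ - inner ℝ w φ) / h) • y i‖
          + |(1 / (n : ℝ)) * ∑ i ∈ Finset.range n,
            deriv W ((inner ℝ (y i) φ - inner ℝ w φ) / h)| * ‖w‖) * ‖D‖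
        + 1 / h * (L * (η / h) ^ 2) * ((1 / (n : ℝ)) * ∑ i ∈ Finset.range n,
          (Set.Icc (inner ℝ w φ - (K + 1) * h) (inner ℝ w φ + (K + 1) * h)).indicator
            (fun _ => (1 : ℝ)) (inner ℝ (y i) φ)) := by
  set z : ℝ := inner ℝ w φ with hz
  set q : ℕ → ℝ := fun i => inner ℝ (y i) φ with hq
  set d : ℕ → ℝ := fun i => inner ℝ (y i - w) D with hddef
  set T : H := (1 / (n : ℝ)) • ∑ i ∈ Finset.range n, deriv W ((q i - z) / h) • y i with hT
  set T₀ : ℝ := (1 / (n : ℝ)) * ∑ i ∈ Finset.range n, deriv W ((q i - z) / h) with hT0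
  set A : ℕ → ℝ := fun i =>
    W ((q i - z + d i) / h) - W ((q i - z) / h) - deriv W ((q i - z) / h) * (d i / h) with hA
  have hlin : 1 / h ^ 2 * (inner ℝ T D - T₀ * inner ℝ w D)
      = 1 / (n * h) * ∑ i ∈ Finset.range n, deriv W ((q i - z) / h) * (d i / h) := by
    have h1 : inner ℝ T D = (1 / (n : ℝ)) * ∑ i ∈ Finset.range n,
        deriv W ((q i - z) / h) * inner ℝ (y i) D := by
      rw [hT, real_inner_smul_left, sum_inner]
      simp only [real_inner_smul_left]
    have h2 : T₀ * inner ℝ w D = (1 / (n : ℝ)) * ∑ i ∈ Finset.range n,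
        deriv W ((q i - z) / h) * inner ℝ w D := by
      rw [hT0, mul_assoc, Finset.sum_mul]
    rw [h1, h2, ← mul_sub, ← Finset.sum_sub_distrib, Finset.mul_sum, Finset.mul_sum, Finset.mul_sum]
    refine Finset.sum_congr rfl fun i _ => ?_
    simp only [hddef, inner_sub_left]
    have hh' : h ≠ 0 := hh.ne'
    rcases Nat.eq_zero_or_pos n with rfl | hn
    · simp
    · field_simp
  have hmain : 1 / (n * h) * ∑ i ∈ Finset.range n, W (inner ℝ (y i - w) (φ + D) / h)
      - 1 / (n * h) * ∑ i ∈ Finset.range n, W (inner ℝ (y i - w) φ / h)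
      = 1 / h ^ 2 * (inner ℝ T D - T₀ * inner ℝ w D)
        + 1 / (n * h) * ∑ i ∈ Finset.range n, A i := by
    rw [hlin, ← mul_sub, ← mul_add, ← Finset.sum_sub_distrib, ← Finset.sum_add_distrib]
    congr 1
    refine Finset.sum_congr rfl fun i _ => ?_
    have e1 : inner ℝ (y i - w) φ = q i - z := inner_sub_left _ _ _
    rw [inner_add_right, e1]
    simp only [hA, hddef]
    ring
  rw [hmain]
  refine (abs_add_le _ _).trans (add_le_add ?_ ?_)
  · rw [abs_mul, abs_of_pos (by positivity : (0 : ℝ) < 1 / h ^ 2), mul_assoc (1 / h ^ 2) _ ‖D‖]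
    refine mul_le_mul_of_nonneg_left ?_ (by positivity : (0 : ℝ) ≤ 1 / h ^ 2)
    refine (abs_sub _ _).trans ?_
    rw [add_mul, abs_mul, mul_assoc |T₀|]
    exact add_le_add (abs_real_inner_le_norm _ _)
      (mul_le_mul_of_nonneg_left (abs_real_inner_le_norm _ _) (abs_nonneg _))
  · have h1 : ∀ i ∈ Finset.range n, |A i| ≤ L * (η / h) ^ 2
        * (Set.Icc (z - (K + 1) * h) (z + (K + 1) * h)).indicator (fun _ => (1 : ℝ)) (q i) :=
      fun i hi => hW.abs_sub_sub_deriv_mul_le_indicator hL hKW hKW' hh (hd i (Finset.mem_range.1 hi)) hη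
    have h2 := (Finset.abs_sum_le_sum_abs _ _).trans (Finset.sum_le_sum h1)
    rw [← Finset.mul_sum] at h2
    rw [abs_mul, abs_of_nonneg (by positivity : 0 ≤ 1 / ((n : ℝ) * h))]
    calc 1 / ((n : ℝ) * h) * |∑ i ∈ Finset.range n, A i| ≤ 1 / ((n : ℝ) * h) * _ :=
          mul_le_mul_of_nonneg_left h2 (by positivity)
      _ = _ := by
        rw [show 1 / ((n : ℝ) * h) = 1 / h * (1 / n) by rw [one_div_mul_one_div, mul_comm]]
        ring

/-! ### Bandwidths -/

lemma tendsto_const_mul_natCast_rpow_neg (C : ℝ) {s : ℝ} (hs : s < 0) :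
    Tendsto (fun n : ℕ => C * (n : ℝ) ^ s) atTop (𝓝 0) := by
  have h1 := (((tendsto_rpow_neg_atTop (neg_pos.2 hs)).comp
    tendsto_natCast_atTop_atTop).const_mul C : Tendsto (fun n : ℕ => C * (n : ℝ) ^ (- -s)) _ _)
  simpa using h1

/-- The limits are the ratios of `n^{-1+4ε} h^{-2}` and of `n^{-1/2+ε}` to `(nh)^{-1/2}`. The first
uses the lower bound on `n^{1-δ} h³`, the second the bound `h = O(n^{-δ})`. -/
lemma IsBandwidth.exists_rates {h : ℕ → ℝ} (hh : IsBandwidth h) :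
    ∃ ε : ℝ, 0 < ε ∧ ε ≤ 1 / 4 ∧ (∀ᶠ n in atTop, h n ≤ 1) ∧
      Tendsto (fun n : ℕ => (n : ℝ) ^ (-(1 / 2) + 4 * ε : ℝ) * h n ^ (-(3 / 2) : ℝ)) atTop (𝓝 0) ∧
      Tendsto (fun n : ℕ => (n : ℝ) ^ ε * h n ^ (1 / 2 : ℝ)) atTop (𝓝 0) := by
  obtain ⟨hpos, δ, hδ, hO, κ, hκ, hκh⟩ := hh
  obtain ⟨C, hC0, hC⟩ := hO.exists_pos
  rw [IsBigOWith] at hC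
  have hC' : ∀ᶠ n : ℕ in atTop, h n ≤ C * (n : ℝ) ^ (-δ) := by
    filter_upwards [hC] with n hn
    rwa [Real.norm_of_nonneg (hpos n).le, Real.norm_of_nonneg (by positivity)] at hn
  -- The two limits require `4ε < δ/2` and `ε < δ/2`.
  set ε : ℝ := min (δ / 16) (1 / 4) with hε
  have hε0 : 0 < ε := lt_min (by positivity) (by norm_num)
  have hεδ : ε ≤ δ / 16 := min_le_left _ _
  refine ⟨ε, hε0, min_le_right _ _, ?_, ?_, ?_⟩
  · have h1 := tendsto_const_mul_natCast_rpow_neg C (neg_neg_of_pos hδ)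
    filter_upwards [hC', h1.eventually (gt_mem_nhds one_pos)] with n hn1 hn2
    exact hn1.trans hn2.le
  · refine squeeze_zero' (Eventually.of_forall fun n => mul_nonneg (by positivity)
      (Real.rpow_nonneg (hpos n).le _)) ?_
      (tendsto_const_mul_natCast_rpow_neg (κ ^ (-(1 / 2) : ℝ)) (by linarith : 4 * ε - δ / 2 < 0))
    filter_upwards [hκh, eventually_ge_atTop 1] with n hn hn1
    have hn0 : (0 : ℝ) < n := by exact_mod_cast hn1
    have hp := hpos n
    have h1 : κ * (n : ℝ) ^ (-(1 - δ)) ≤ h n ^ 3 := by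
      rw [Real.rpow_neg hn0.le, ← div_eq_mul_inv, div_le_iff₀ (by positivity), mul_comm]
      exact hn
    have h2 : h n ^ (-(3 / 2) : ℝ) ≤ κ ^ (-(1 / 2) : ℝ) * (n : ℝ) ^ ((1 - δ) / 2) := by
      have h3 := Real.rpow_le_rpow_of_nonpos (by positivity) h1 (by norm_num : (-(1 / 2) : ℝ) ≤ 0)
      rw [Real.mul_rpow hκ.le (by positivity), ← Real.rpow_mul hn0.le, ← Real.rpow_natCast,
        ← Real.rpow_mul hp.le] at h3
      convert h3 using 2
      · norm_num
      · congr 1; ring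
    calc (n : ℝ) ^ (-(1 / 2) + 4 * ε : ℝ) * h n ^ (-(3 / 2) : ℝ)
        ≤ (n : ℝ) ^ (-(1 / 2) + 4 * ε : ℝ) * (κ ^ (-(1 / 2) : ℝ) * (n : ℝ) ^ ((1 - δ) / 2)) := by
          gcongr
      _ = κ ^ (-(1 / 2) : ℝ) * (n : ℝ) ^ (4 * ε - δ / 2) := by
          rw [mul_left_comm, ← Real.rpow_add hn0]
          congr 2; ring
  · refine squeeze_zero' (Eventually.of_forall fun n => mul_nonneg (by positivity)
      (Real.rpow_nonneg (hpos n).le _)) ?_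
      (tendsto_const_mul_natCast_rpow_neg (C ^ (1 / 2 : ℝ)) (by linarith : ε - δ / 2 < 0))
    filter_upwards [hC', eventually_ge_atTop 1] with n hn hn1
    have hn0 : (0 : ℝ) < n := by exact_mod_cast hn1
    have h1 : h n ^ (1 / 2 : ℝ) ≤ C ^ (1 / 2 : ℝ) * (n : ℝ) ^ (-(δ / 2)) := by
      refine (Real.rpow_le_rpow (hpos n).le hn (by norm_num)).trans (le_of_eq ?_)
      rw [Real.mul_rpow hC0.le (by positivity), ← Real.rpow_mul hn0.le]
      congr 2; ring
    calc (n : ℝ) ^ ε * h n ^ (1 / 2 : ℝ)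
        ≤ (n : ℝ) ^ ε * (C ^ (1 / 2 : ℝ) * (n : ℝ) ^ (-(δ / 2))) := by gcongr
      _ = _ := by
          rw [mul_left_comm, ← Real.rpow_add hn0]
          congr 2

end

section

/-! ### Kernel estimators of score densities -/

variable {Ω : Type*} {a b : ℝ}

/-- Absorbing `1/√τ` into the direction turns the change of eigenvalue and eigenfunction into the
perturbation of one vector. With `√0 = 0` and division by zero equal to zero, this needs no
positivity of `τ`. -/
lemma scoreDensityEst_eq (W : ℝ → ℝ) (bw : ℝ) {X : ℕ → Ω → Set.Icc a b → ℝ} (n : ℕ) {ω : Ω}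
    (τ : ℝ) (φ x : L2 a b) {y : ℕ → L2 a b} {m : L2 a b}
    (hy : ∀ i, y i =ᵐ[leb a b] fun t => X i ω t - m t) :
    scoreDensityEst W bw X n ω τ φ x
      = 1 / (n * bw) * ∑ i ∈ Finset.range n, W (inner ℝ (y i - (x - m)) ((1 / √τ) • φ) / bw) := by
  unfold scoreDensityEst
  congr 1
  refine Finset.sum_congr rfl fun i _ => ?_
  have h1 : ∫ t, (X i ω t - x t) * φ t ∂(leb a b) = inner ℝ (y i - (x - m)) φ := by
    rw [← integral_mul_eq_inner]
    refine integral_congr_ae ?_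
    filter_upwards [hy i, Lp.coeFn_sub (y i) (x - m), Lp.coeFn_sub x m] with t h1 h2 h3
    rw [h2, Pi.sub_apply, h3, Pi.sub_apply, h1]
    ring
  rw [h1, inner_smul_right, div_mul_eq_div_div_swap]
  congr 1
  ring

lemma IsKernel.apply_inner_sign_smul {W : ℝ → ℝ} (hW : IsKernel W) {H : Type*}
    [NormedAddCommGroup H] [InnerProductSpace ℝ H] {s : ℝ} (hs : s = 1 ∨ s = -1) (v φ : H)
    (r bw : ℝ) : W (inner ℝ v ((s / r) • φ) / bw) = W (inner ℝ v ((1 / r) • φ) / bw) := by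
  rcases hs with rfl | rfl
  · rfl
  · rw [neg_div, neg_smul, inner_neg_right, neg_div, hW.symm]

lemma IsKernel.exists_bound {W : ℝ → ℝ} (hW : IsKernel W) : ∃ B, ∀ u, |W u| ≤ B :=
  hW.compactSupport.exists_bound_of_continuous hW.differentiable.continuous

/-- `W` is bounded, so each estimator is bounded independently of `x`. This gives the real `⨆` its
meaning, as its default on unbounded families is `0`. -/
lemma IsKernel.bddAbove_abs_sub {W : ℝ → ℝ} (hW : IsKernel W) (bw : ℝ)
    (X : ℕ → Ω → Set.Icc a b → ℝ) (n : ℕ) (ω : Ω) (τ τ' : ℝ) (φ φ' : L2 a b) {ι : Type*}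
    (x : ι → L2 a b) :
    BddAbove (Set.range fun i => |scoreDensityEst W bw X n ω τ φ (x i)
      - scoreDensityEst W bw X n ω τ' φ' (x i)|) := by
  obtain ⟨B, hB⟩ := hW.exists_bound
  have key : ∀ (τ : ℝ) (φ x : L2 a b),
      |scoreDensityEst W bw X n ω τ φ x| ≤ |1 / ((n : ℝ) * bw)| * (n * B) := fun τ φ x => by
    unfold scoreDensityEst
    rw [abs_mul]
    refine mul_le_mul_of_nonneg_left ((Finset.abs_sum_le_sum_abs _ _).trans ?_) (abs_nonneg _)
    refine (Finset.sum_le_sum fun i _ => hB _).trans (le_of_eq ?_)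
    rw [Finset.sum_const, Finset.card_range, nsmul_eq_mul]
  refine ⟨|1 / ((n : ℝ) * bw)| * (n * B) + |1 / ((n : ℝ) * bw)| * (n * B), ?_⟩
  rintro _ ⟨i, rfl⟩
  exact (abs_sub _ _).trans (add_le_add (key _ _ _) (key _ _ _))

lemma exists_gap {θ : ℕ → ℝ} (hθ : Antitone θ) {j : ℕ} (hties : ∀ k ≤ j, θ (k + 1) < θ k) :
    ∃ g, 0 < g ∧ (∀ k < j, g ≤ θ k - θ j) ∧ g ≤ θ j - θ (j + 1) := by
  have h1 := sub_pos.2 (hties j le_rfl)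
  rcases j with _ | i
  · exact ⟨_, h1, fun k hk => absurd hk (Nat.not_lt_zero k), le_rfl⟩
  · refine ⟨min (θ i - θ (i + 1)) (θ (i + 1) - θ (i + 1 + 1)),
      lt_min (sub_pos.2 (hties i (Nat.le_succ i))) h1, fun k hk => ?_, min_le_right _ _⟩
    exact (min_le_left _ _).trans (sub_le_sub_right (hθ (Nat.lt_succ_iff.1 hk)) _)

/-- Uniform comparison of the empirical and the ideal estimator in terms of the distance between
the normalized eigenfunctions. -/
lemma IsKernel.abs_scoreDensityEst_sub_le {W : ℝ → ℝ} (hW : IsKernel W) {L K : ℝ}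
    (hL : ∀ u, |deriv (deriv W) u| ≤ L) (hKW : ∀ u, K ≤ |u| → W u = 0)
    (hKW' : ∀ u, K ≤ |u| → deriv W u = 0)
    {X : ℕ → Ω → Set.Icc a b → ℝ} {n : ℕ} {ω : Ω} {y : ℕ → L2 a b} {m : L2 a b}
    (hy : ∀ i, y i =ᵐ[leb a b] fun t => X i ω t - m t) {bw τ τ' s : ℝ} {φ φ' : L2 a b}
    (hbw : 0 < bw) (hs : s = 1 ∨ s = -1) {d N R : ℝ}
    (hd : ‖(s / √τ') • φ' - (1 / √τ) • φ‖ ≤ d) (hN : ∀ i < n, ‖y i‖ ≤ N)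
    (hη : (N + R) * d ≤ bw) {x : L2 a b} (hx : ‖x - m‖ ≤ R) {B E : ℝ}
    (hB : ‖(1 / (n : ℝ)) • ∑ i ∈ Finset.range n,
      deriv W ((inner ℝ (y i) φ / √τ - inner ℝ (x - m) φ / √τ) / bw) • y i‖ ≤ B)
    (hB' : |(1 / (n : ℝ)) * ∑ i ∈ Finset.range n,
      deriv W ((inner ℝ (y i) φ / √τ - inner ℝ (x - m) φ / √τ) / bw)| ≤ B)
    (hE : (1 / (n : ℝ)) * ∑ i ∈ Finset.range n,
      (Set.Icc (inner ℝ (x - m) φ / √τ - (K + 1) * bw)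
        (inner ℝ (x - m) φ / √τ + (K + 1) * bw)).indicator (fun _ => (1 : ℝ))
          (inner ℝ (y i) φ / √τ) ≤ E) :
    |scoreDensityEst W bw X n ω τ' φ' x - scoreDensityEst W bw X n ω τ φ x|
      ≤ 1 / bw ^ 2 * (B + B * R) * d + 1 / bw * (L * ((N + R) * d / bw) ^ 2) * E := by
  have hL0 : 0 ≤ L := (abs_nonneg _).trans (hL 0)
  have hd0 : 0 ≤ d := (norm_nonneg _).trans hd
  have hR0 : 0 ≤ R := (norm_nonneg _).trans hx
  have hB0 : 0 ≤ B := (norm_nonneg _).trans hB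
  have hi : ∀ v : L2 a b, inner ℝ v ((1 / √τ) • φ) = inner ℝ v φ / √τ := fun v => by
    rw [inner_smul_right, one_div_mul_eq_div]
  rw [scoreDensityEst_eq W bw n τ' φ' x hy, scoreDensityEst_eq W bw n τ φ x hy]
  simp only [← hW.apply_inner_sign_smul hs _ φ']
  have h1 := hW.abs_average_sub_le hL hKW hKW' (n := n) hbw hη (y := y) (w := x - m)
    (φ := (1 / √τ) • φ) (D := (s / √τ') • φ' - (1 / √τ) • φ) (fun i hi => by
      refine (abs_real_inner_le_norm _ _).trans ?_
      have := norm_sub_le (y i) (x - m)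
      exact mul_le_mul (this.trans (add_le_add (hN i hi) hx)) hd (norm_nonneg _)
        (add_nonneg ((norm_nonneg _).trans (hN i hi)) hR0))
  rw [add_sub_cancel] at h1
  simp only [hi] at h1 ⊢
  refine h1.trans ?_
  gcongr

end

section

/-! ### Uniform strong consistency -/

/-- The second conclusion keeps the displacement of the scores below one bandwidth, as the localised
Taylor bound requires; the third is the final comparison with `(nh)^{-1/2}`. -/
lemma IsBandwidth.eventually_rates {h : ℕ → ℝ} (hpos : ∀ n, 0 < h n) {ε : ℝ}
    (hε : 0 < ε) (h1 : ∀ᶠ n in atTop, h n ≤ 1)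
    (ha : Tendsto (fun n : ℕ => (n : ℝ) ^ (-(1 / 2) + 4 * ε : ℝ) * h n ^ (-(3 / 2) : ℝ))
      atTop (𝓝 0))
    (hb : Tendsto (fun n : ℕ => (n : ℝ) ^ ε * h n ^ (1 / 2 : ℝ)) atTop (𝓝 0))
    {κ : ℝ} (hκ : 0 < κ) :
    ∀ᶠ n : ℕ in atTop, 1 ≤ (n : ℝ) ^ ε ∧
      (n : ℝ) ^ ε * (n : ℝ) ^ (-(1 / 2) + ε : ℝ) ≤ κ * h n ∧
      ((n : ℝ) ^ ε * (n : ℝ) ^ (-(1 / 2) + ε : ℝ) / h n) ^ 2 + (n : ℝ) ^ (-(1 / 2) + ε : ℝ)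
        ≤ κ * ((n : ℝ) * h n) ^ (-(1 / 2) : ℝ) := by
  filter_upwards [h1, ha.eventually (ge_mem_nhds (half_pos hκ)),
    hb.eventually (ge_mem_nhds (half_pos hκ)), eventually_ge_atTop 1] with n hn1 hna hnb hn
  have hn' : (1 : ℝ) ≤ n := by exact_mod_cast hn
  have hn0 : (0 : ℝ) < n := one_pos.trans_le hn'
  have hp := hpos n
  have hmul : (n : ℝ) ^ ε * (n : ℝ) ^ (-(1 / 2) + ε : ℝ) = (n : ℝ) ^ (-(1 / 2) + 2 * ε : ℝ) := by
    rw [← Real.rpow_add hn0]; congr 1; ring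
  have hS : ((n : ℝ) * h n) ^ (-(1 / 2) : ℝ) = (n : ℝ) ^ (-(1 / 2) : ℝ) * h n ^ (-(1 / 2) : ℝ) :=
    Real.mul_rpow hn0.le hp.le
  have hS0 : 0 ≤ ((n : ℝ) * h n) ^ (-(1 / 2) : ℝ) := by positivity
  refine ⟨Real.one_le_rpow hn' hε.le, ?_, ?_⟩
  · rw [hmul]
    have e : (n : ℝ) ^ (-(1 / 2) + 4 * ε : ℝ)
        = (n : ℝ) ^ (-(1 / 2) + 4 * ε : ℝ) * h n ^ (-(3 / 2) : ℝ) * h n ^ (3 / 2 : ℝ) := by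
      rw [mul_assoc, ← Real.rpow_add hp]; norm_num
    calc (n : ℝ) ^ (-(1 / 2) + 2 * ε : ℝ) ≤ (n : ℝ) ^ (-(1 / 2) + 4 * ε : ℝ) :=
          Real.rpow_le_rpow_of_exponent_le hn' (by linarith)
      _ ≤ κ / 2 * h n ^ (3 / 2 : ℝ) := by
          rw [e]; gcongr
      _ ≤ κ * h n ^ (1 : ℝ) := by
          refine mul_le_mul (half_le_self hκ.le) ?_ (by positivity) hκ.le
          exact Real.rpow_le_rpow_of_exponent_ge hp hn1 (by norm_num)
      _ = κ * h n := by rw [Real.rpow_one]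
  · have e1 : ((n : ℝ) ^ ε * (n : ℝ) ^ (-(1 / 2) + ε : ℝ) / h n) ^ 2
        = (n : ℝ) ^ (-(1 / 2) + 4 * ε : ℝ) * h n ^ (-(3 / 2) : ℝ)
          * ((n : ℝ) * h n) ^ (-(1 / 2) : ℝ) := by
      rw [hmul, hS, mul_mul_mul_comm, ← Real.rpow_add hn0, ← Real.rpow_add hp, div_pow,
        ← Real.rpow_natCast, ← Real.rpow_mul hn0.le, div_eq_mul_inv, ← Real.rpow_natCast,
        ← Real.rpow_neg hp.le]
      congr 2 <;> push_cast <;> ring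
    have e2 : (n : ℝ) ^ (-(1 / 2) + ε : ℝ)
        = (n : ℝ) ^ ε * h n ^ (1 / 2 : ℝ) * ((n : ℝ) * h n) ^ (-(1 / 2) : ℝ) := by
      rw [hS, mul_mul_mul_comm, ← Real.rpow_add hn0, ← Real.rpow_add hp, add_neg_cancel,
        Real.rpow_zero, mul_one, add_comm]
    rw [e1, e2, ← add_mul]
    refine mul_le_mul_of_nonneg_right ?_ hS0
    linarith

/-- Since `N ≥ 1`, both Taylor terms fit under `(N r / h)² + r`: the first is a multiple of `(r/h)²
+ r`, and in the second the factor `C * h` cancels `1 / h`. -/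
lemma rate_bound_le {C L D R r N h : ℝ} (hC : 0 ≤ C) (hL : 0 ≤ L) (hD : 0 ≤ D) (hR : 0 ≤ R)
    (hr : 0 ≤ r) (hN : 1 ≤ N) (hh : 0 < h)
    (hNR : (N + R) * (D * r) ≤ (1 + R) * D * (N * r)) :
    1 / h ^ 2 * (C * (r + h ^ 2) + C * (r + h ^ 2) * R) * (D * r)
        + 1 / h * (L * ((N + R) * (D * r) / h) ^ 2) * (C * h)
      ≤ (C * (1 + R) * D + L * ((1 + R) * D) ^ 2 * C) * ((N * r / h) ^ 2 + r) := by
  have hN0 : 0 ≤ N := one_pos.le.trans hN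
  have h1 : r / h ≤ N * r / h := by
    gcongr
    exact le_mul_of_one_le_left hr hN
  have h2 : (r / h) ^ 2 ≤ (N * r / h) ^ 2 := by gcongr
  have h3 : ((N + R) * (D * r) / h) ^ 2 ≤ ((1 + R) * D * (N * r) / h) ^ 2 := by gcongr
  have e1 : 1 / h ^ 2 * (C * (r + h ^ 2) + C * (r + h ^ 2) * R) * (D * r)
      = C * (1 + R) * D * ((r / h) ^ 2 + r) := by
    field_simp
  have e2 : 1 / h * (L * ((N + R) * (D * r) / h) ^ 2) * (C * h)
      = L * C * ((N + R) * (D * r) / h) ^ 2 := by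
    field_simp
  rw [e1, e2]
  calc C * (1 + R) * D * ((r / h) ^ 2 + r) + L * C * ((N + R) * (D * r) / h) ^ 2
      ≤ C * (1 + R) * D * ((N * r / h) ^ 2 + r) + L * C * ((1 + R) * D * (N * r) / h) ^ 2 := by
        gcongr
    _ = C * (1 + R) * D * ((N * r / h) ^ 2 + r)
        + L * ((1 + R) * D) ^ 2 * C * (N * r / h) ^ 2 := by ring
    _ ≤ C * (1 + R) * D * ((N * r / h) ^ 2 + r)
        + L * ((1 + R) * D) ^ 2 * C * ((N * r / h) ^ 2 + r) := by
        gcongr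
        exact le_add_of_nonneg_right hr
    _ = _ := by ring

set_option maxHeartbeats 800000 in
-- The exceptional null set is chosen before `κ` and `x`. On its complement the argument is
-- deterministic, so the estimated eigenpairs need not be measurable in `ω`.
theorem IsSample.ae_eventually_abs_scoreDensityEst_sub_le {Ω : Type*} [MeasurableSpace Ω]
    {P : Measure Ω} [IsProbabilityMeasure P] {a b : ℝ} (hab : a ≤ b)
    {X : ℕ → Ω → Set.Icc a b → ℝ} (hX : IsSample P X) {θ : ℕ → ℝ} {ψ : ℕ → L2 a b}
    (hspec : IsSpectralExpansion (covFn P (X 0)) θ ψ) (hscores : iIndepFun (score P (X 0) θ ψ) P)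
    {θhat : ℕ → Ω → ℕ → ℝ} {ψhat : ℕ → Ω → ℕ → L2 a b}
    (hspechat : ∀ᵐ ω ∂P, ∀ n, IsSpectralExpansion (sampleCov X n ω) (θhat n ω) (ψhat n ω))
    {j : ℕ} (hties : ∀ k ≤ j, θ (k + 1) < θ k) (hdensity : HasSmoothDensity P (score P (X 0) θ ψ j))
    {W : ℝ → ℝ} (hW : IsKernel W) {h : ℕ → ℝ} (hh : IsBandwidth h) {c : ℝ} (hc : 0 < c) :
    ∀ᵐ ω ∂P, ∀ κ : ℝ, 0 < κ → ∀ᶠ n : ℕ in atTop, ∀ x : L2 a b, ‖x‖ ≤ c →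
      |scoreDensityEst W (h n) X n ω (θhat n ω j) (ψhat n ω j) x
        - scoreDensityEst W (h n) X n ω (θ j) (ψ j) x| ≤ κ * ((n : ℝ) * h n) ^ (-(1 / 2) : ℝ) := by
  obtain ⟨ε, hε, hε4, hh1, ha, hb⟩ := hh.exists_rates
  have hrates := fun κ hκ => IsBandwidth.eventually_rates hh.1 hε hh1 ha hb (κ := κ) hκ
  have hθ : 0 < θ j := (hspec.nonneg (j + 1)).trans_lt (hties j le_rfl)
  obtain ⟨g, hg0, hg, hg'⟩ := exists_gap hspec.antitone hties
  obtain ⟨K, hK0, hKW, hKW'⟩ := hW.exists_support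
  obtain ⟨L, hL⟩ := hW.deriv_deriv_bounded
  have hL0 : 0 ≤ L := (abs_nonneg _).trans (hL 0)
  set m : L2 a b := hX.memLp_meanFn.toLp with hm
  set R : ℝ := c + ‖m‖ with hR
  have hR0 : 0 < R := by positivity
  have hsq : 0 < √(θ j) := Real.sqrt_pos.2 hθ
  -- The Lipschitz constant of the normalized eigenvector, times the factor `2` of the covariance
  -- rate.
  set C₁ : ℝ := (8 / (g * √(θ j)) + 2 / (θ j * √(θ j))) * 2 with hC1
  have hC10 : 0 < C₁ := by positivity
  have hbw : ∀ᶠ n : ℕ in atTop, (n : ℝ) ^ (-(1 / 2) + ε : ℝ) ≤ h n := by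
    filter_upwards [hrates 1 one_pos] with n hn
    rw [one_mul] at hn
    exact (le_mul_of_one_le_left (by positivity) hn.1).trans hn.2.1
  -- `R / √(θ j)` bounds the location of every `x` in the ball, and `K + 1` is the radius of the
  -- Taylor window.
  obtain ⟨C, hC0, hC⟩ := hX.ae_eventually_uniform_bounds hab hspec hscores hθ hdensity hW hh.1 hε
    hbw (M := R / √(θ j)) (by positivity) (ρ := K + 1) (by positivity)
  filter_upwards [hC, hX.ae_eventually_eLpNorm_covFn_sub_le hε (by linarith), hspechat, hX.ae_memLp]
    with ω ⟨y, hy, hyn⟩ hcov hsh hmem κ hκ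
  have hym : ∀ i, y i =ᵐ[leb a b] fun t => X i ω t - m t := fun i => by
    filter_upwards [hy i, hX.memLp_meanFn.coeFn_toLp] with t h1 h2
    rw [h1, hm, h2]
  set C₂ : ℝ := C * (1 + R) * C₁ + L * ((1 + R) * C₁) ^ 2 * C with hC2
  have hC20 : 0 ≤ C₂ := by positivity
  have hsmall := tendsto_const_mul_natCast_rpow_neg 2 (by linarith : -(1 / 2) + ε < 0)
  -- The rates are used twice: with `1 / ((1 + R) * C₁)` to keep displacements below `h n`, and with
  -- `κ / (C₂ + 1)` for the final bound, where `+ 1` covers `C₂ = 0`. The last condition makes the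
  -- covariance error at most `θ j / 2`.
  filter_upwards [hyn, hcov, hrates (1 / ((1 + R) * C₁)) (by positivity),
    hrates (κ / (C₂ + 1)) (by positivity), hsmall.eventually (ge_mem_nhds (half_pos hθ))]
    with n hyn hcov hr1 hr2 hΔ x hx
  set r : ℝ := (n : ℝ) ^ (-(1 / 2) + ε : ℝ) with hr
  set N : ℝ := (n : ℝ) ^ ε with hN
  have hr0 : 0 ≤ r := by positivity
  have hp := hh.1 n
  obtain ⟨s, hs, hsD⟩ := exists_sign_norm_sub_le hspec.antitone hspec.nonneg hspec.orthonormal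
    (hsh n).antitone (hsh n).nonneg (hsh n).orthonormal
    (specForm_sub_le hspec (hsh n) hX.memLp_covFn (memLp_sampleCov hmem n) (by positivity) hcov)
    hg0 hg hg' hΔ
  have hd : ‖(s / √(θhat n ω j)) • ψhat n ω j - (1 / √(θ j)) • ψ j‖ ≤ C₁ * r :=
    hsD.trans (le_of_eq (by rw [hC1]; ring))
  have hxm : ‖x - m‖ ≤ R := (norm_sub_le _ _).trans (add_le_add hx le_rfl)
  have hz : |inner ℝ (x - m) (ψ j) / √(θ j)| ≤ R / √(θ j) := by
    rw [abs_div, abs_of_pos hsq]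
    refine div_le_div_of_nonneg_right ((abs_real_inner_le_norm _ _).trans ?_) hsq.le
    rwa [hspec.orthonormal.norm_eq_one, mul_one]
  obtain ⟨hB, hB', hE⟩ := hyn.2 _ hz
  have hNR : (N + R) * (C₁ * r) ≤ (1 + R) * C₁ * (N * r) := by
    have : N + R ≤ (1 + R) * N := by nlinarith [hr1.1]
    calc (N + R) * (C₁ * r) ≤ ((1 + R) * N) * (C₁ * r) := by gcongr
      _ = _ := by ring
  have hη : (N + R) * (C₁ * r) ≤ h n := by
    refine hNR.trans ?_
    have := hr1.2.1
    rwa [one_div_mul_eq_div, le_div_iff₀' (by positivity)] at this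
  refine (hW.abs_scoreDensityEst_sub_le hL hKW hKW' hym hp hs hd hyn.1 hη hxm hB hB' hE).trans ?_
  refine (rate_bound_le hC0 hL0 hC10.le hR0.le hr0 hr1.1 hp hNR).trans ?_
  calc C₂ * ((N * r / h n) ^ 2 + r) ≤ (C₂ + 1) * ((N * r / h n) ^ 2 + r) :=
        mul_le_mul_of_nonneg_right (le_add_of_nonneg_right one_pos.le) (by positivity)
    _ ≤ (C₂ + 1) * (κ / (C₂ + 1) * ((n : ℝ) * h n) ^ (-(1 / 2) : ℝ)) :=
        mul_le_mul_of_nonneg_left hr2.2.2 (by positivity)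
    _ = _ := by
        rw [← mul_assoc, mul_div_cancel₀ _ (by positivity : C₂ + 1 ≠ 0)]

end

end FunctionalPCA

end

/-! ### The main theorem -/

theorem theorem3p1 {Ω : Type*} [MeasurableSpace Ω] (P : Measure Ω) [IsProbabilityMeasure P]
    (a b : ℝ) (hab : a < b)
    -- the data `X 0, X 1, …`: independent, identically distributed random functions on `[a, b]`
    (X : ℕ → Ω → Set.Icc a b → ℝ)
    (hmeas : ∀ i, Measurable (Function.uncurry (X i)))
    (hindep : iIndepFun X P)
    (hident : ∀ i, IdentDistrib (X i) (X 0) P P)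
    -- eigenvalues and eigenfunctions of the covariance function; independent scores
    (θ : ℕ → ℝ) (ψ : ℕ → FunctionalPCA.L2 a b)
    (hspec : FunctionalPCA.IsSpectralExpansion (FunctionalPCA.covFn P (X 0)) θ ψ)
    (hscores : iIndepFun (FunctionalPCA.score P (X 0) θ ψ) P)
    -- eigenvalues and eigenfunctions of the sample covariance function
    (θhat : ℕ → Ω → ℕ → ℝ) (ψhat : ℕ → Ω → ℕ → FunctionalPCA.L2 a b)
    (hspechat : ∀ᵐ ω ∂P, ∀ n, FunctionalPCA.IsSpectralExpansion
      (FunctionalPCA.sampleCov X n ω) (θhat n ω) (ψhat n ω))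
    (hmoment : FunctionalPCA.MomentHolder P (X 0))
    (hscoremoment : FunctionalPCA.ScoreMomentsBounded P (X 0) θ ψ)
    -- indices start at `0`: `θ j` is the `(j + 1)`-st eigenvalue, and there are no ties
    -- among the `j + 2` largest ones `θ 0, …, θ (j + 1)`
    (j : ℕ) (hties : ∀ k ≤ j, θ (k + 1) < θ k)
    (hdensity : FunctionalPCA.HasSmoothDensity P (FunctionalPCA.score P (X 0) θ ψ j))
    (W : ℝ → ℝ) (hW : FunctionalPCA.IsKernel W)
    (h : ℕ → ℝ) (hh : FunctionalPCA.IsBandwidth h) :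
    ∀ c : ℝ, 0 < c → ∀ᵐ ω ∂P,
      (∀ n, BddAbove (Set.range fun x : {x : FunctionalPCA.L2 a b // ‖x‖ ≤ c} =>
        |FunctionalPCA.scoreDensityEst W (h n) X n ω (θhat n ω j) (ψhat n ω j) x.1
          - FunctionalPCA.scoreDensityEst W (h n) X n ω (θ j) (ψ j) x.1|)) ∧
      (fun n : ℕ => ⨆ x : {x : FunctionalPCA.L2 a b // ‖x‖ ≤ c},
        |FunctionalPCA.scoreDensityEst W (h n) X n ω (θhat n ω j) (ψhat n ω j) x.1
          - FunctionalPCA.scoreDensityEst W (h n) X n ω (θ j) (ψ j) x.1|)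
        =o[atTop] (fun n : ℕ => ((n : ℝ) * h n) ^ (-(1 / 2) : ℝ)) := by
  intro c hc
  have hX : FunctionalPCA.IsSample P X := ⟨hmeas, hindep, hident, hmoment⟩
  filter_upwards [hX.ae_eventually_abs_scoreDensityEst_sub_le hab.le hspec hscores hspechat hties
    hdensity hW hh hc] with ω hω
  refine ⟨fun n => hW.bddAbove_abs_sub _ _ _ _ _ _ _ _ _, isLittleO_iff.2 fun κ hκ => ?_⟩
  filter_upwards [hω κ hκ] with n hn
  have hp := (hh.1 n).le
  rw [Real.norm_of_nonneg (Real.iSup_nonneg fun x => abs_nonneg _),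
    Real.norm_of_nonneg (by positivity)]
  exact Real.iSup_le (fun x => hn x.1 x.2) (by positivity)
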